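/- **Superconformal algebra from the Fock realization of $K(1|1)$.** Write $\delta_m=1$ if $m=0$ and $\delta_m=0$ otherwise; all indices $m,n$ are integers, $[\cdot,\cdot]_-$ is the commutator and $[\cdot,\cdot]_+$ the anticommutator. *(A) The abstract algebra.* Let $a,a',\alpha,\beta,\gamma,\gamma',e,b\in\mathbb C$ with $2\alpha-\beta=2a-b/2$. On the complex super vector space with basis $L_m,U_m,V_m,1$ (even) and $G_m,\theta_m,W_m$ (odd), the brackets $$\begin{aligned} [L_m,L_n]_-&=(n-m)L_{m+n}+(-am^3+a'm)\delta_{m+n},\\ [L_m,G_n]_-&=(n-\tfrac m2)G_{m+n}+(\alpha m^3+\beta m^2n)\theta_{m+n}-\gamma(mn+\tfrac{m^2}2)\theta_{m+n}-2\gamma'm\,\theta_{m+n},\\ [G_m,G_n]_+&=2L_{m+n}+(bm^2+2\gamma'-a')\delta_{m+n}+\big((2\alpha-e)(m^2+n^2)+(2\beta-e)mn\big)U_{m+n}\\ &\quad+eV_{m+n}-\gamma(m+n)U_{m+n}-2\gamma'U_{m+n},\\ [L_m,\theta_n]_-&=(n+\tfrac{3m}2)\theta_{m+n},\qquad [L_m,U_n]_-=(n+m)U_{m+n},\\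 [L_m,V_n]_-&=(n-m)V_{m+n}+(m^3+\tfrac{m^2n}2)U_{m+n},\qquad [L_m,W_n]_-=(n-\tfrac m2)W_{m+n},\\ [G_m,\theta_n]_+&=-\delta_{m+n}+U_{m+n},\qquad [G_m,U_n]_-=(2m+n)\theta_{m+n},\\ [G_m,V_n]_-&=(n-2m)W_{m+n}+(2m^3+3m^2n+mn^2)\theta_{m+n},\\ [G_m,W_n]_+&=V_{m+n}-(2m^2+mn)U_{m+n}, \end{aligned}$$ with $1$ central, all brackets among $\theta,U,V,W$ equal to zero and graded skew-symmetry, define a Lie superalgebra. The redefinition $$L_m\mapsto L_m-\tfrac{a'}2\delta_m+\tfrac\beta2m^2U_m,\qquad G_m\mapsto G_m-\tfrac e2W_m+\big((\beta-2\alpha)m^2+\gamma m+\gamma'\big)\theta_m$$ (the other generators being unchanged) is an isomorphism onto it from the algebra with the same $a$, with $a'=\alpha=\beta=\gamma=\gamma'=e=0$ and $b=4a$. Moreover, for every $s\in\mathbb C$, the elements $1$, $\hat L_m=L_m+\frac\beta2m^2U_m+s\,\delta_m$ and $\hat G_m=G_m-\frac e2W_m+((\beta-2\alpha)m^2+\gamma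 m+\gamma')\theta_m$ are linearly independent and satisfy the relations of the $N=1$ superconformal algebra with central charge $12a$, $$[\hat L_m,\hat L_n]_-=(n-m)\hat L_{m+n}+(-am^3+\hat a'm)\delta_{m+n},\quad [\hat L_m,\hat G_n]_-=(n-\tfrac m2)\hat G_{m+n},\quad [\hat G_m,\hat G_n]_+=2\hat L_{m+n}+(4am^2-\hat a')\delta_{m+n},$$ where $\hat a'=a'+2s$; these relations themselves define a Lie superalgebra. *(B) The Fock realization.* Let $c,k_1,k_2\in\mathbb C$ and let $V$ be a super vector space with operators $L^V_n$ (even) and $T^\mu_{\nu,n}$ (of degree $\mu+\nu$; $\mu,\nu\in\{0,1\}$, where the index $0$ is even and $1$ is odd) such that $$\begin{aligned}[L^V_m,L^V_n]&=(n-m)L^V_{m+n}-\tfrac c{12}(m^3-m)\delta_{m+n},\qquad [L^V_m,T^\mu_{\nu,n}]=n\,T^\mu_{\nu,m+n},\\ [T^\mu_{\nu,m},T^\sigma_{\tau,n}]&=\delta^\sigma_\nu T^\mu_{\tau,m+n}-(-1)^{(\mu+\nu)(\sigma+\tau)}\delta^\mu_\tau T^\sigma_{\nu,m+n}+m\big(k_1(-1)^\mu\delta^\mu_\tau\delta^\sigma_\nu+k_2(-1)^{\mu+\sigma}\delta^\mu_\nu\delta^\sigma_\tau\big)\delta_{m+n}\end{aligned}$$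 (graded commutators), and such that every vector is annihilated by all $L^V_n,T^\mu_{\nu,n}$ with $n$ sufficiently negative (for instance a lowest-weight module). Let $F$ be the fermionic Fock module with modes $\theta_{(n)},p_{(n)}$, $[p_{(m)},\theta_{(n)}]_+=\delta_{m+n}$, all other anticommutators zero, and a vacuum annihilated by $\theta_{(n)}$ for $n<0$ and by $p_{(n)}$ for $n\le0$. On $F\otimes V$ consider the fields $\theta(t)=\sum\theta_{(n)}e^{-int}$, $p(t)=\frac1{2\pi}\sum p_{(n)}e^{-int}$, $L(t)=\frac i{2\pi}\sum L^V_ne^{-int}$, $T^\mu_\nu(t)=\frac1{2\pi}\sum T^\mu_{\nu,n}e^{-int}$, where the odd $T^\mu_\nu$ anticommute with $\theta$ and $p$; let $p^>$ and $p^<$ be the parts of $p$ with modes $n>0$ and $n\le0$, and put ${:}X p{:}=Xp^<+(-1)^{\deg X}p^>X$. For a vector field $\xi=\xi^0\partial_t+\xi^1\partial_\theta$ of degree $d$ on $(1|1)$-dimensional superspace with coordinates $q=(t,\theta)$, whose components are Fourier polynomials in $t$, put $$\mathcal L_\xi=\int_0^{2\pi}dt\,\Big\{{:}\big(\xi^1(q(t))-\xi^0(q(t))\dot\theta(t)\big)p(t){:}+\xi^0(q(t))L(t)+\sum_{\mu,\nu}(-1)^{(d+\mu)\nu+\mu}\,\partial_\nu\xi^\mu(q(t))\,T^\nu_\mu(t)\Big\},$$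 where $q(t)=(t,\theta(t))$. Let $L_m=\mathcal L_{K(\ell_m)}$ and $G_m=\mathcal L_{K(g_m)}$, where $K(\ell_m)=e^{imt}(-i\partial_t+\frac m2\theta\partial_\theta)$ and $K(g_m)=e^{imt}(\theta\partial_t-i\partial_\theta)$ are the contact vector fields of $\ell_m=\frac1{2i}e^{imt}$ and $g_m=\theta e^{imt}$, and let $$\theta_m=\tfrac1{2\pi i}\!\int\!\theta e^{imt}dt,\quad U_m=\tfrac1{2\pi i}\!\int\!\dot\theta\theta e^{imt}dt,\quad V_m=\tfrac1{2\pi i}\!\int\!\ddot\theta\dot\theta e^{imt}dt,\quad W_m=\tfrac1{2\pi}\!\int\!\ddot\theta\dot\theta\theta e^{imt}dt .$$ All these operators are well defined (their mode expansions are locally finite), and $$\begin{aligned} L_m&=\int dt\,e^{imt}\Big\{i\,{:}\dot\theta p{:}+\tfrac m2{:}\theta p{:}-iL+mT^0_0-\tfrac{im^2}2\theta T^0_1+\tfrac m2T^1_1\Big\},\\ G_m&=\int dt\,e^{imt}\Big\{{:}\dot\theta\theta p{:}-ip+\theta L+im\,\theta T^0_0-mT^0_1-T^1_0\Big\}. \end{aligned}$$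 Together with $1$ acting as the identity, they form a representation (by operators of the appropriate parities) of the Lie superalgebra in (A) with the parameters $$\begin{gathered} a=-\tfrac34+\tfrac34k_1+\tfrac14k_2+\tfrac{c-2}{12},\quad a'=\tfrac{c-2}{12},\quad \alpha=-\tfrac54+\tfrac{c-2}{12},\quad \beta=-\tfrac{k_1}2-\tfrac{k_2}2-1,\\ \gamma=-\tfrac12,\quad \gamma'=\tfrac{c-2}{24},\quad e=-2+\tfrac{c-2}{12},\quad b=2k_1, \end{gathered}$$ which satisfy $2\alpha-\beta=2a-b/2$. Consequently, for every $s\in\mathbb C$, the operators $\hat L_m,\hat G_m$ represent the $N=1$ superconformal algebra with central charge $$12a=-11+9k_1+3k_2+c .$$ -/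

import Mathlib

open scoped TensorProduct

noncomputable section

/-! ### Lie superalgebras over `ℂ` -/

/-- The sign `(-1)^d` of a degree `d` modulo two. -/
def sg (d : ZMod 2) : ℂ := if d = 0 then 1 else -1

/-- A bilinear bracket `br` on `A`, with homogeneous parts `𝒜 0` (even) and `𝒜 1` (odd), is a Lie
superalgebra bracket. -/
structure IsLieSuperalgebra {A : Type*} [AddCommGroup A] [Module ℂ A]
    (𝒜 : ZMod 2 → Submodule ℂ A) (br : A →ₗ[ℂ] A →ₗ[ℂ] A) : Prop where
  grading : DirectSum.IsInternal 𝒜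
  bracket_mem : ∀ i j : ZMod 2, ∀ x ∈ 𝒜 i, ∀ y ∈ 𝒜 j, br x y ∈ 𝒜 (i + j)
  skew : ∀ i j : ZMod 2, ∀ x ∈ 𝒜 i, ∀ y ∈ 𝒜 j, br x y = -(sg (i * j) • br y x)
  jacobi : ∀ i j k : ZMod 2, ∀ x ∈ 𝒜 i, ∀ y ∈ 𝒜 j, ∀ z ∈ 𝒜 k,
    sg (i * k) • br x (br y z) + sg (j * i) • br y (br z x) + sg (k * j) • br z (br x y) = 0

/-- A homomorphism of (Lie) superalgebras: an even linear map that preserves the brackets. -/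
structure IsSuperHom {A B : Type*} [AddCommGroup A] [Module ℂ A] [AddCommGroup B] [Module ℂ B]
    (𝒜 : ZMod 2 → Submodule ℂ A) (brA : A →ₗ[ℂ] A →ₗ[ℂ] A)
    (ℬ : ZMod 2 → Submodule ℂ B) (brB : B →ₗ[ℂ] B →ₗ[ℂ] B) (f : A →ₗ[ℂ] B) : Prop where
  map_mem : ∀ i : ZMod 2, ∀ x ∈ 𝒜 i, f x ∈ ℬ i
  map_bracket : ∀ x y : A, f (brA x y) = brB (f x) (f y)

/-- A representation of a Lie superalgebra on the super vector space `W` whose even and odd parts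
are the eigenspaces of the involution `Γ` for the eigenvalues `1` and `-1`. Even elements act by
even operators, odd ones by odd operators, and brackets go to graded commutators. -/
structure IsSuperRep {A W : Type*} [AddCommGroup A] [Module ℂ A] [AddCommGroup W] [Module ℂ W]
    (𝒜 : ZMod 2 → Submodule ℂ A) (br : A →ₗ[ℂ] A →ₗ[ℂ] A)
    (Γ : Module.End ℂ W) (ρ : A →ₗ[ℂ] Module.End ℂ W) : Prop where
  parity_sq : Γ * Γ = 1
  parity : ∀ i : ZMod 2, ∀ x ∈ 𝒜 i, Γ * ρ x = sg i • (ρ x * Γ)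
  map_bracket : ∀ i j : ZMod 2, ∀ x ∈ 𝒜 i, ∀ y ∈ 𝒜 j,
    ρ (br x y) = ρ x * ρ y - sg (i * j) • (ρ y * ρ x)

/-- The homogeneous part of degree `i` of the vector space with basis `ι`, if the basis vector `k`
has degree `p k`. -/
def homogPart {ι : Type*} (p : ι → ZMod 2) (i : ZMod 2) : Submodule ℂ (ι →₀ ℂ) :=
  Finsupp.supported ℂ ℂ {k | p k = i}

/-- The bilinear bracket with prescribed values `s j k` on the basis vectors. -/
def tableBracket {ι : Type*} (s : ι → ι → (ι →₀ ℂ)) :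
    (ι →₀ ℂ) →ₗ[ℂ] (ι →₀ ℂ) →ₗ[ℂ] (ι →₀ ℂ) :=
  Finsupp.linearCombination ℂ fun j => Finsupp.linearCombination ℂ (s j)

/-- The Kronecker symbol `δ_m`, equal to `1` for `m = 0` and to `0` otherwise. -/
def kron (m : ℤ) : ℂ := if m = 0 then 1 else 0

/-! ### The abstract superalgebra generated by `L, G, θ, U, V, W` -/

/-- The parameters `a, a', α, β, γ, γ', e, b`. -/
structure XscParams where
  a : ℂ
  a' : ℂ
  α : ℂ
  β : ℂ
  γ : ℂ
  γ' : ℂ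
  e : ℂ
  b : ℂ

/-- The basis vectors: `L_m, G_m, θ_m, U_m, V_m, W_m` and the central element `1`. -/
inductive XscIdx where
  | L (m : ℤ)
  | G (m : ℤ)
  | θ (m : ℤ)
  | U (m : ℤ)
  | V (m : ℤ)
  | W (m : ℤ)
  | one

/-- `G, θ, W` are odd; `L, U, V, 1` are even. -/
def XscIdx.deg : XscIdx → ZMod 2
  | .L _ => 0
  | .G _ => 1
  | .θ _ => 1
  | .U _ => 0
  | .V _ => 0
  | .W _ => 1
  | .one => 0

/-- The underlying vector space. -/
abbrev Xsc := XscIdx →₀ ℂ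

namespace Xsc

/-- Basis vectors as elements. -/
def el (k : XscIdx) : Xsc := Finsupp.single k 1

/-- The even and the odd part. -/
def part : ZMod 2 → Submodule ℂ Xsc := homogPart XscIdx.deg

/-- The brackets of basis vectors, in the order `L, G, θ, U, V, W`. -/
def half (P : XscParams) : XscIdx → XscIdx → Xsc
  | .L m, .L n => ((n : ℂ) - m) • el (.L (m + n))
      + ((-P.a * (m : ℂ) ^ 3 + P.a' * m) * kron (m + n)) • el .one
  | .L m, .G n => ((n : ℂ) - m / 2) • el (.G (m + n))
      + (P.α * (m : ℂ) ^ 3 + P.β * (m : ℂ) ^ 2 * n) • el (.θ (m + n))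
      - (P.γ * ((m : ℂ) * n + (m : ℂ) ^ 2 / 2)) • el (.θ (m + n))
      - (2 * P.γ' * m) • el (.θ (m + n))
  | .G m, .G n => (2 : ℂ) • el (.L (m + n))
      + ((P.b * (m : ℂ) ^ 2 + 2 * P.γ' - P.a') * kron (m + n)) • el .one
      + ((2 * P.α - P.e) * ((m : ℂ) ^ 2 + (n : ℂ) ^ 2)
          + (2 * P.β - P.e) * ((m : ℂ) * n)) • el (.U (m + n))
      + P.e • el (.V (m + n))
      - (P.γ * ((m : ℂ) + n)) • el (.U (m + n))
      - (2 * P.γ') • el (.U (m + n))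
  | .L m, .θ n => ((n : ℂ) + 3 * m / 2) • el (.θ (m + n))
  | .L m, .U n => ((n : ℂ) + m) • el (.U (m + n))
  | .L m, .V n => ((n : ℂ) - m) • el (.V (m + n))
      + ((m : ℂ) ^ 3 + (m : ℂ) ^ 2 * n / 2) • el (.U (m + n))
  | .L m, .W n => ((n : ℂ) - m / 2) • el (.W (m + n))
  | .G m, .θ n => -(kron (m + n) • el .one) + el (.U (m + n))
  | .G m, .U n => (2 * (m : ℂ) + n) • el (.θ (m + n))
  | .G m, .V n => ((n : ℂ) - 2 * m) • el (.W (m + n))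
      + (2 * (m : ℂ) ^ 3 + 3 * (m : ℂ) ^ 2 * n + (m : ℂ) * (n : ℂ) ^ 2) • el (.θ (m + n))
  | .G m, .W n => el (.V (m + n))
      - (2 * (m : ℂ) ^ 2 + (m : ℂ) * n) • el (.U (m + n))
  | _, _ => 0

/-- All brackets of basis vectors: those of `half`, and their graded skew images. -/
def table (P : XscParams) : XscIdx → XscIdx → Xsc
  | .L m, .L n => half P (.L m) (.L n)
  | .G m, .G n => half P (.G m) (.G n)
  | j, k => half P j k - sg (j.deg * k.deg) • half P k j

/-- The bracket of the superalgebra with parameters `P`. -/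
def bracket (P : XscParams) : Xsc →ₗ[ℂ] Xsc →ₗ[ℂ] Xsc := tableBracket (table P)

/-- The redefined generators
`L_m - (a'/2) δ_m + (β/2) m² U_m` and
`G_m - (e/2) W_m + ((β - 2α) m² + γ m + γ') θ_m`; the other generators are unchanged. -/
def redefine (P : XscParams) : Xsc →ₗ[ℂ] Xsc :=
  Finsupp.linearCombination ℂ fun
    | .L m => el (.L m) - (P.a' / 2 * kron m) • el .one + (P.β / 2 * (m : ℂ) ^ 2) • el (.U m)
    | .G m => el (.G m) - (P.e / 2) • el (.W m)
        + ((P.β - 2 * P.α) * (m : ℂ) ^ 2 + P.γ * m + P.γ') • el (.θ m)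
    | k => el k

end Xsc

/-- The parameters with the same `a`, all others removed; `b = 4 a` is then forced by the relation
`2 α - β = 2 a - b / 2`. -/
def XscParams.reduced (P : XscParams) : XscParams :=
  { a := P.a, a' := 0, α := 0, β := 0, γ := 0, γ' := 0, e := 0, b := 4 * P.a }

/-! ### The centrally extended `N = 1` superconformal algebra -/

/-- The basis vectors: `L_m, G_m` and the central element `1`. -/
inductive SconfIdx where
  | L (m : ℤ)
  | G (m : ℤ)
  | one

def SconfIdx.deg : SconfIdx → ZMod 2
  | .L _ => 0
  | .G _ => 1
  | .one => 0

abbrev Sconf := SconfIdx →₀ ℂ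

namespace Sconf

def el (k : SconfIdx) : Sconf := Finsupp.single k 1

def part : ZMod 2 → Submodule ℂ Sconf := homogPart SconfIdx.deg

/-- The superconformal algebra with central charge `C`:
`[L_m, L_n] = (n - m) L_{m+n} + (-(C/12) m³ + a' m) δ_{m+n}`,
`[L_m, G_n] = (n - m/2) G_{m+n}`,
`[G_m, G_n] = 2 L_{m+n} + ((C/3) m² - a') δ_{m+n}`.
The number `a'` only fixes the additive constant in `L_0`; the usual normalization is
`a' = C/12`. -/
def table (C a' : ℂ) : SconfIdx → SconfIdx → Sconf
  | .L m, .L n => ((n : ℂ) - m) • el (.L (m + n))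
      + ((-(C / 12) * (m : ℂ) ^ 3 + a' * m) * kron (m + n)) • el .one
  | .L m, .G n => ((n : ℂ) - m / 2) • el (.G (m + n))
  | .G m, .L n => -(((m : ℂ) - n / 2) • el (.G (m + n)))
  | .G m, .G n => (2 : ℂ) • el (.L (m + n))
      + ((C / 3 * (m : ℂ) ^ 2 - a') * kron (m + n)) • el .one
  | _, _ => 0

def bracket (C a' : ℂ) : Sconf →ₗ[ℂ] Sconf →ₗ[ℂ] Sconf := tableBracket (table C a')

/-- The map into the algebra with generators `L, G, θ, U, V, W` given by the redefined generators,
`L_m ↦ L_m + (β/2) m² U_m + s δ_m` and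
`G_m ↦ G_m - (e/2) W_m + ((β - 2α) m² + γ m + γ') θ_m`,
where the constant `s` shifts `L_0`. -/
def embed (P : XscParams) (s : ℂ) : Sconf →ₗ[ℂ] Xsc :=
  Finsupp.linearCombination ℂ fun
    | .L m => Xsc.el (.L m) + (P.β / 2 * (m : ℂ) ^ 2) • Xsc.el (.U m)
        + (s * kron m) • Xsc.el .one
    | .G m => Xsc.el (.G m) - (P.e / 2) • Xsc.el (.W m)
        + ((P.β - 2 * P.α) * (m : ℂ) ^ 2 + P.γ * m + P.γ') • Xsc.el (.θ m)
    | .one => Xsc.el .one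

end Sconf

/-! ### Vector fields on `(1|1)`-dimensional super space-time and the contact algebra `K(1|1)`

The coordinates are `x⁰ = t` (even, periodic) and `x¹ = θ` (odd). Indices `μ, ν` are elements of
`ZMod 2`, so that an index is equal to its own degree. -/

/-- A superfunction `f(t, θ) = f₀(t) + θ f₁(t)` with `f₀ = ∑ f.1 m e^{imt}` and
`f₁ = ∑ f.2 m e^{imt}` Fourier polynomials. -/
abbrev SFun := (ℤ →₀ ℂ) × (ℤ →₀ ℂ)

namespace SFun

/-- `d/dt` on Fourier polynomials. -/
def ddt : (ℤ →₀ ℂ) →ₗ[ℂ] (ℤ →₀ ℂ) :=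
  Finsupp.linearCombination ℂ fun m : ℤ => Finsupp.single m (Complex.I * m)

/-- The partial derivatives `∂_0 = ∂/∂t` and `∂_1 = ∂/∂θ`. -/
def pd (ν : ZMod 2) (f : SFun) : SFun := if ν = 0 then (ddt f.1, ddt f.2) else (f.2, 0)

/-- The product `θ f`. -/
def thetaMul (f : SFun) : SFun := (0, f.1)

/-- The Euler operator `E = θ ∂/∂θ`. -/
def euler (f : SFun) : SFun := thetaMul (pd 1 f)

/-- `Δ = 2 - E`. -/
def Del (f : SFun) : SFun := (2 : ℂ) • f - euler f

/-- `ℓ_m = e^{imt} / (2i)`. -/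
def ell (m : ℤ) : SFun := (Finsupp.single m (1 / (2 * Complex.I)), 0)

/-- `g_m = θ e^{imt}`. -/
def gee (m : ℤ) : SFun := (0, Finsupp.single m 1)

end SFun

/-- A vector field `ξ = ξ^μ ∂_μ`, given by its components. It is homogeneous of degree `d` if
`ξ^μ` is of degree `d + μ`. -/
abbrev VField := ZMod 2 → SFun

/-- The component `H_f^1 = (-)^{f+1} ∂_1 f ω^{11}` of the Hamiltonian field of a function `f` of
degree `d`, where `ω^{11} = i`. -/
def hamComp (d : ZMod 2) (f : SFun) : SFun := (sg (d + 1) * Complex.I) • SFun.pd 1 f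

/-- The contact vector field `K_f = Δ(f) ∂_0 - H_f + ∂_0 f E` of a function `f` of degree `d`,
a vector field of degree `d`. -/
def contact (d : ZMod 2) (f : SFun) : VField := fun μ =>
  if μ = 0 then SFun.Del f else -hamComp d f + SFun.thetaMul (SFun.pd 0 f)

/-! ### Operator-valued fields -/

section Fields

variable {W : Type*} [AddCommGroup W] [Module ℂ W]

/-- A family of operators such that, on every vector, only finitely many of them are non-zero. -/
def LocFinite {ι : Type*} (A : ι → Module.End ℂ W) : Prop :=
  ∀ w : W, (Function.support fun i => A i w).Finite

open Classical in
/-- The sum of a locally finite family of operators (and `0` if the family is not locally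
finite). -/
def locSum {ι : Type*} (A : ι → Module.End ℂ W) : Module.End ℂ W :=
  if h : LocFinite A then
    { toFun := fun w => ∑ᶠ i, A i w
      map_add' := fun v w => by
        simp only [map_add]
        exact finsum_add_distrib (h v) (h w)
      map_smul' := fun r w => by
        simp only [map_smul, RingHom.id_apply]
        exact (smul_finsum' r (h w)).symm }
  else 0

/-- A field `X(t) = ∑ X_n e^{-int}`, `t ∈ S¹`, given by its modes `X_n`. -/
abbrev OpField (W : Type*) [AddCommGroup W] [Module ℂ W] := ℤ → Module.End ℂ W

namespace OpField

/-- The product `X(t) Y(t)`. -/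
def mul (X Y : OpField W) : OpField W := fun n => locSum fun j : ℤ => X j * Y (n - j)

/-- All modes of the product `X(t) Y(t)` are locally finite sums. -/
def MulDefined (X Y : OpField W) : Prop := ∀ n : ℤ, LocFinite fun j : ℤ => X j * Y (n - j)

/-- The time derivative. -/
def dot (X : OpField W) : OpField W := fun n => (-(Complex.I * n)) • X n

/-- `∫ dt e^{imt} X(t)`, over a period `2π`. -/
def fourier (X : OpField W) (m : ℤ) : Module.End ℂ W := (2 * (Real.pi : ℂ)) • X m

/-- The positive energy part `X^>(t)`. -/
def pos (X : OpField W) : OpField W := fun n => if 0 < n then X n else 0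

/-- The part `X^<(t)` of modes `n ≤ 0`. -/
def neg (X : OpField W) : OpField W := fun n => if n ≤ 0 then X n else 0

/-- The normal ordered product `:X(t) p(t): = X(t) p^<(t) + (-)^d p^>(t) X(t)` of a field `X` of
degree `d` and an odd field `p`. -/
def normal (d : ZMod 2) (X p : OpField W) : OpField W := mul X (neg p) + sg d • mul (pos p) X

end OpField

end Fields

/-! ### The Fock module and the realization -/

/-- A module of positive-energy type over the semidirect product of the Virasoro algebra with
central charge `c` and the Kac-Moody superalgebra of `gl(1|1)` with central charges `k₁, k₂`, on the
super vector space `V` with parity operator `par`. Here `L n = -i ∫ dt e^{int} L(t)` and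
`T μ ν n = ∫ dt e^{int} T^μ_ν(t)`. The last two fields say that every vector is annihilated by all
modes of sufficiently negative index, as in all lowest-weight modules. -/
structure VirGlModule (c k₁ k₂ : ℂ) (V : Type*) [AddCommGroup V] [Module ℂ V] where
  par : Module.End ℂ V
  L : ℤ → Module.End ℂ V
  T : ZMod 2 → ZMod 2 → ℤ → Module.End ℂ V
  par_par : par * par = 1
  par_L : ∀ n, par * L n = L n * par
  par_T : ∀ μ ν n, par * T μ ν n = sg (μ + ν) • (T μ ν n * par)
  L_L : ∀ m n, L m * L n - L n * L m =
    ((n : ℂ) - m) • L (m + n) - (c / 12 * ((m : ℂ) ^ 3 - m) * kron (m + n)) • (1 : Module.End ℂ V)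
  L_T : ∀ m μ ν n, L m * T μ ν n - T μ ν n * L m = (n : ℂ) • T μ ν (m + n)
  T_T : ∀ μ ν m σ τ n,
    T μ ν m * T σ τ n - sg ((μ + ν) * (σ + τ)) • (T σ τ n * T μ ν m) =
      (if σ = ν then T μ τ (m + n) else 0)
      - sg ((μ + ν) * (σ + τ)) • (if μ = τ then T σ ν (m + n) else 0)
      + ((m : ℂ) * ((if μ = τ ∧ σ = ν then k₁ * sg μ else 0)
          + (if μ = ν ∧ σ = τ then k₂ * sg (μ + σ) else 0)) * kron (m + n)) •
        (1 : Module.End ℂ V)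
  smooth_L : ∀ v, ∃ N : ℤ, ∀ n < N, L n v = 0
  smooth_T : ∀ v, ∃ N : ℤ, ∀ μ ν, ∀ n < N, T μ ν n v = 0

/-- The Fock module of the modes of `θ(t) = ∑ θ_n e^{-int}` and `p(t) = (1/2π) ∑ p_n e^{-int}`, with
`[p_m, θ_n]_+ = δ_{m+n}`. It is the exterior algebra on the creation modes: the basis vector `k` is
the mode `θ_k` if `0 ≤ k`, and the mode `p_{-k}` if `k < 0`. -/
abbrev Fock := ExteriorAlgebra ℂ (ℤ →₀ ℂ)

namespace Fock

/-- Exterior multiplication by the basis vector `k`. -/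
def create (k : ℤ) : Module.End ℂ Fock :=
  LinearMap.mulLeft ℂ (ExteriorAlgebra.ι ℂ (Finsupp.single k (1 : ℂ)))

/-- Contraction with the dual basis vector `k`. -/
def annihilate (k : ℤ) : Module.End ℂ Fock :=
  CliffordAlgebra.contractLeft (Finsupp.lapply k : (ℤ →₀ ℂ) →ₗ[ℂ] ℂ)

/-- The mode `θ_n`; it annihilates the vacuum if `n < 0`. -/
def thetaMode (n : ℤ) : Module.End ℂ Fock := if 0 ≤ n then create n else annihilate n

/-- The mode `p_n`; it annihilates the vacuum if `n ≤ 0`. -/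
def pMode (n : ℤ) : Module.End ℂ Fock := if n ≤ 0 then annihilate (-n) else create (-n)

/-- The parity operator. -/
def parity : Module.End ℂ Fock :=
  (CliffordAlgebra.involute (Q := (0 : QuadraticForm ℂ (ℤ →₀ ℂ)))).toLinearMap

end Fock

/-- The trajectory `θ(t) = q¹(t)`, acting on `Fock ⊗ V`. -/
def thetaField (V : Type*) [AddCommGroup V] [Module ℂ V] : OpField (Fock ⊗[ℂ] V) :=
  fun n => (Fock.thetaMode n).rTensor V

/-- The momentum `p_θ(t)`, acting on `Fock ⊗ V`. -/
def pField (V : Type*) [AddCommGroup V] [Module ℂ V] : OpField (Fock ⊗[ℂ] V) :=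
  fun n => (1 / (2 * (Real.pi : ℂ))) • (Fock.pMode n).rTensor V

/-- The value `f(q(t)) = f₀(t) + θ(t) f₁(t)` of a superfunction on the trajectory. -/
def evalTraj (V : Type*) [AddCommGroup V] [Module ℂ V] (f : SFun) : OpField (Fock ⊗[ℂ] V) :=
  fun n => f.1 (-n) • (1 : Module.End ℂ (Fock ⊗[ℂ] V))
    + f.2.sum fun k b => b • thetaField V (n + k)

/-- `ξ̃(t) = ξ^1(q(t)) - ξ^0(q(t)) dθ/dt`. -/
def xiTilde (V : Type*) [AddCommGroup V] [Module ℂ V] (ξ : VField) : OpField (Fock ⊗[ℂ] V) :=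
  evalTraj V (ξ 1) - (evalTraj V (ξ 0)).mul (thetaField V).dot

namespace VirGlModule

variable {c k₁ k₂ : ℂ} {V : Type*} [AddCommGroup V] [Module ℂ V]

/-- The parity operator of `Fock ⊗ V`. -/
def parity (M : VirGlModule c k₁ k₂ V) : Module.End ℂ (Fock ⊗[ℂ] V) :=
  TensorProduct.map Fock.parity M.par

/-- The field `L(t)`, acting on `Fock ⊗ V`. -/
def LField (M : VirGlModule c k₁ k₂ V) : OpField (Fock ⊗[ℂ] V) := fun n =>
  (Complex.I / (2 * (Real.pi : ℂ))) • (M.L n).lTensor Fock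

/-- The field `T^μ_ν(t)`, acting on `Fock ⊗ V` with the sign rule: the odd components anticommute
with the fermions. -/
def TField (M : VirGlModule c k₁ k₂ V) (μ ν : ZMod 2) : OpField (Fock ⊗[ℂ] V) := fun n =>
  (1 / (2 * (Real.pi : ℂ))) •
    TensorProduct.map (if μ = ν then LinearMap.id else Fock.parity) (M.T μ ν n)

/-- The operator `𝓛_ξ` of a vector field `ξ` of degree `d` in the Fock realization:
`∫ dt :ξ̃ p_θ: + ξ^0(q) L + (-)^{(d+μ)ν+μ} ∂_ν ξ^μ(q) T^ν_μ`. -/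
def realize (M : VirGlModule c k₁ k₂ V) (d : ZMod 2) (ξ : VField) :
    Module.End ℂ (Fock ⊗[ℂ] V) :=
  OpField.fourier
    (OpField.normal (d + 1) (xiTilde V ξ) (pField V)
      + (evalTraj V (ξ 0)).mul M.LField
      + ∑ μ : ZMod 2, ∑ ν : ZMod 2,
          sg ((d + μ) * ν + μ) • (evalTraj V (SFun.pd ν (ξ μ))).mul (M.TField ν μ)) 0

/-- `L_m = 𝓛(K(ℓ_m))`. -/
def opL (M : VirGlModule c k₁ k₂ V) (m : ℤ) : Module.End ℂ (Fock ⊗[ℂ] V) :=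
  M.realize 0 (contact 0 (SFun.ell m))

/-- `G_m = 𝓛(K(g_m))`. -/
def opG (M : VirGlModule c k₁ k₂ V) (m : ℤ) : Module.End ℂ (Fock ⊗[ℂ] V) :=
  M.realize 1 (contact 1 (SFun.gee m))

end VirGlModule

section Auxiliary

variable (V : Type*) [AddCommGroup V] [Module ℂ V]

/-- The field `θ̇ θ`. -/
def dThetaTheta : OpField (Fock ⊗[ℂ] V) := (thetaField V).dot.mul (thetaField V)

/-- The field `θ̈ θ̇`. -/
def ddThetaDTheta : OpField (Fock ⊗[ℂ] V) := (thetaField V).dot.dot.mul (thetaField V).dot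

/-- `θ_m = (1/2πi) ∫ dt θ e^{imt}`. -/
def opTheta (m : ℤ) : Module.End ℂ (Fock ⊗[ℂ] V) :=
  (1 / (2 * (Real.pi : ℂ) * Complex.I)) • (thetaField V).fourier m

/-- `U_m = (1/2πi) ∫ dt θ̇ θ e^{imt}`. -/
def opU (m : ℤ) : Module.End ℂ (Fock ⊗[ℂ] V) :=
  (1 / (2 * (Real.pi : ℂ) * Complex.I)) • (dThetaTheta V).fourier m

/-- `V_m = (1/2πi) ∫ dt θ̈ θ̇ e^{imt}`. -/
def opV (m : ℤ) : Module.End ℂ (Fock ⊗[ℂ] V) :=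
  (1 / (2 * (Real.pi : ℂ) * Complex.I)) • (ddThetaDTheta V).fourier m

/-- `W_m = (1/2π) ∫ dt θ̈ θ̇ θ e^{imt}`. -/
def opW (m : ℤ) : Module.End ℂ (Fock ⊗[ℂ] V) :=
  (1 / (2 * (Real.pi : ℂ))) • ((ddThetaDTheta V).mul (thetaField V)).fourier m

end Auxiliary

/-- The linear map that sends the basis vectors `L_m, G_m, θ_m, U_m, V_m, W_m, 1` to the operators
of these names on `Fock ⊗ V`. -/
def VirGlModule.rep {c k₁ k₂ : ℂ} {V : Type*} [AddCommGroup V] [Module ℂ V]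
    (M : VirGlModule c k₁ k₂ V) : Xsc →ₗ[ℂ] Module.End ℂ (Fock ⊗[ℂ] V) :=
  Finsupp.linearCombination ℂ fun
    | .L m => M.opL m
    | .G m => M.opG m
    | .θ m => opTheta V m
    | .U m => opU V m
    | .V m => opV V m
    | .W m => opW V m
    | .one => 1

/-- The parameters realized on `Fock ⊗ V`. -/
def fockParams (c k₁ k₂ : ℂ) : XscParams where
  a := -(3 / 4) + 3 / 4 * k₁ + 1 / 4 * k₂ + (c - 2) / 12
  a' := (c - 2) / 12
  α := -(5 / 4) + (c - 2) / 12
  β := -(k₁ / 2) - k₂ / 2 - 1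
  γ := -(1 / 2)
  γ' := (c - 2) / 24
  e := -2 + (c - 2) / 12
  b := 2 * k₁

end

set_option linter.unusedSimpArgs false

/-! ### Superalgebras given by brackets of basis vectors -/

/-! Abstract part. All brackets are extended bilinearly from a table, so skew symmetry, the Jacobi
identity, homomorphisms and representations need only be checked on basis vectors. The vectors θ, U,
V, W, 1 (the "tail") span a supercommutative ideal, and every parameter occurs only as the
coefficient of a tail vector in a bracket of two of the L, G. Hence a Jacobi identity with a tail
entry does not see the parameters (`jac_tail`, `jac_LG_LG_tail`), and among L, G the relation
between the parameters is needed only for the central term of the identity for L, G, G (`jac_LG`).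
The redefinition adds tail vectors to L and G and fixes the tail, so its inverse is obtained by
reversing the signs of the parameters. The superconformal algebra embeds by the same corrections and
inherits its Jacobi identity from the larger algebra.

Fock part. With the rescaled modes ϑ = -iθ and ϖ = ip, the generators become the sums `Lop` and
`Gop`, in which G has a cubic term. Multiplying out normal ordered products is avoided by a rigidity
principle, `eq_zero_of_fock`: an operator on Fock ⊗ V that commutes with all fermionic modes, or
anticommutes with all of them, and whose vacuum-to-vacuum component is zero, vanishes. Indeed it
maps a vacuum vector to a vector killed by all annihilation modes, which is again a vacuum vector
and therefore zero; creation modes then carry this to the whole space.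

To prove a bracket relation, the principle is applied to the difference D of its two sides. The
brackets of D with ϑ and ϖ follow from the graded Jacobi identity and simpler relations, since a
bracket with a mode lowers the fermionic degree. The vacuum component is controlled by the charge
(number of ϑ minus number of ϖ): a charge-raising operator has none (`vacuum_eq_zero_of_raising`).
So only the terms of D of charge at most zero have to be computed, and these involve bilinear
expressions and currents only. Their fermionic anomalies are the finite sums of `cm_N_N`; the others
come from the Virasoro and current algebras acting on V.

The coefficients of θ, U and V in the brackets of L and G are found in the same way: a bracket with
ϖ_k turns a term ϑ_{m+n} into a central term supported on m+n+k = 0, and a second bracket does this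
for U and V. Thus with Y_{m,k} = {G_m, ϖ_k}, which contains no cubic term, the anomaly in
`cm_LopZ_Y` determines [L, G] through `cm_Lop_Y` and `cm_Lop_Gop`, and the one in `cm_Y_Y_add`
determines {G, G} through `cm_Gop_Y_add` and `ac_Gop_Gop`; `cm_LopZ_LopZ` supplies the central term
of [L, L].

It remains to justify the infinite sums, by showing that one factor of each product annihilates the
other uniformly far down (`Absorbs`), and to identify the integrals over the contact fields with
`Lop` and `Gop` (`opL_eq`, `opG_eq`). -/

theorem sg_zero : sg 0 = 1 := by simp [sg]

theorem sg_one : sg 1 = -1 := by simp [sg]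

theorem ZMod.two_cases (i : ZMod 2) : i = 0 ∨ i = 1 := by
  revert i; decide

theorem homogPart_isInternal {ι : Type*} (p : ι → ZMod 2) :
    DirectSum.IsInternal (homogPart p) := by
  rw [DirectSum.isInternal_submodule_iff_isCompl (i := 0) (j := 1) _ (by decide)
    (by ext i; simpa using ZMod.two_cases i)]
  constructor
  · refine Finsupp.disjoint_supported_supported (Set.disjoint_left.mpr fun k h0 h1 => ?_)
    simp only [Set.mem_ofPred_eq] at h0 h1
    rw [h0] at h1
    exact absurd h1 (by decide)
  · refine Finsupp.codisjoint_supported_supported (codisjoint_iff.mpr ?_)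
    ext k
    simpa using ZMod.two_cases (p k)

theorem single_mem_homogPart {ι : Type*} {p : ι → ZMod 2} {i : ZMod 2} {k : ι} (h : p k = i)
    (r : ℂ) : Finsupp.single k r ∈ homogPart p i :=
  Finsupp.single_mem_supported ℂ r h

theorem homogPart_eq_span {ι : Type*} (p : ι → ZMod 2) (i : ZMod 2) :
    homogPart p i = Submodule.span ℂ ((fun k => Finsupp.single k (1 : ℂ)) '' {k | p k = i}) :=
  Finsupp.supported_eq_span_single ℂ _

@[simp] theorem tableBracket_single {ι : Type*} (s : ι → ι → (ι →₀ ℂ)) (j k : ι) :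
    tableBracket s (Finsupp.single j 1) (Finsupp.single k 1) = s j k := by
  simp [tableBracket, Finsupp.linearCombination_single]

/-- A property of elements of a homogeneous part that is linear holds if it holds for the basis. -/
theorem homogPart_induction {ι : Type*} {p : ι → ZMod 2} {i : ZMod 2} {N : Type*}
    [AddCommGroup N] [Module ℂ N] (f : (ι →₀ ℂ) →ₗ[ℂ] N) (q : Submodule ℂ N)
    (h : ∀ k, p k = i → f (Finsupp.single k 1) ∈ q) : ∀ x ∈ homogPart p i, f x ∈ q := by
  rw [homogPart_eq_span]
  intro x hx
  have : Submodule.span ℂ ((fun k => Finsupp.single k (1 : ℂ)) '' {k | p k = i}) ≤ q.comap f := by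
    rw [Submodule.span_le]
    rintro _ ⟨k, hk, rfl⟩
    exact h k hk
  exact this hx

theorem homogPart_induction₂ {ι κ : Type*} {p : ι → ZMod 2} {p' : κ → ZMod 2} {i j : ZMod 2}
    {N : Type*} [AddCommGroup N] [Module ℂ N] (f : (ι →₀ ℂ) →ₗ[ℂ] (κ →₀ ℂ) →ₗ[ℂ] N)
    (q : Submodule ℂ N)
    (h : ∀ k l, p k = i → p' l = j → f (Finsupp.single k 1) (Finsupp.single l 1) ∈ q) :
    ∀ x ∈ homogPart p i, ∀ y ∈ homogPart p' j, f x y ∈ q := by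
  intro x hx y hy
  refine homogPart_induction (f x) q (fun l hl => ?_) y hy
  exact homogPart_induction (f.flip (Finsupp.single l 1)) q (fun k hk => h k l hk hl) x hx

theorem isLieSuperalgebra_tableBracket {ι : Type*} (p : ι → ZMod 2) (s : ι → ι → (ι →₀ ℂ))
    (hmem : ∀ j k, s j k ∈ homogPart p (p j + p k))
    (hskew : ∀ j k, s j k = -(sg (p j * p k) • s k j))
    (hjac : ∀ j k l, sg (p j * p l) • tableBracket s (Finsupp.single j 1) (s k l)
      + sg (p k * p j) • tableBracket s (Finsupp.single k 1) (s l j)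
      + sg (p l * p k) • tableBracket s (Finsupp.single l 1) (s j k) = 0) :
    IsLieSuperalgebra (homogPart p) (tableBracket s) where
  grading := homogPart_isInternal p
  bracket_mem i j := homogPart_induction₂ (tableBracket s) _ (by
    rintro k l rfl rfl
    simpa using hmem k l)
  skew i j x hx y hy := by
    have := homogPart_induction₂ (p := p) (p' := p) (i := i) (j := j)
      (tableBracket s + sg (i * j) • (tableBracket s).flip) ⊥ (by
        rintro k l rfl rfl
        simp only [LinearMap.add_apply, LinearMap.smul_apply, LinearMap.flip_apply,
          tableBracket_single, Submodule.mem_bot]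
        rw [hskew k l]
        simp) x hx y hy
    simp only [LinearMap.add_apply, LinearMap.smul_apply, LinearMap.flip_apply,
      Submodule.mem_bot] at this
    exact eq_neg_of_add_eq_zero_left this
  jacobi i j k x hx y hy z hz := by
    set b := tableBracket s
    -- With the third entry frozen at a basis vector the identity is bilinear in the other two, so
    -- the two-variable induction applies; the third entry is released afterwards by linearity.
    have key : ∀ l, p l = k → sg (i * k) • b x (b y (Finsupp.single l 1))
        + sg (j * i) • b y (b (Finsupp.single l 1) x)
        + sg (k * j) • b (Finsupp.single l 1) (b x y) = 0 := by
      intro l hl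
      have := homogPart_induction₂ (p := p) (p' := p) (i := i) (j := j)
        (sg (i * k) • (b.compl₂ (b.flip (Finsupp.single l 1)))
          + sg (j * i) • (b.compl₂ (b (Finsupp.single l 1))).flip
          + sg (k * j) • b.compr₂ (b (Finsupp.single l 1))) ⊥ (by
            rintro m n rfl rfl
            subst hl
            simpa [b] using hjac m n l) x hx y hy
      simpa using this
    have := homogPart_induction (p := p) (i := k)
      (sg (i * k) • (b x ∘ₗ b y) + sg (j * i) • (b y ∘ₗ b.flip x)
        + sg (k * j) • b.flip (b x y)) ⊥ (fun l hl => by simpa using key l hl) z hz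
    simpa using this

theorem isSuperHom_of_basis {ι κ : Type*} (p : ι → ZMod 2) (s : ι → ι → (ι →₀ ℂ))
    (p' : κ → ZMod 2) (s' : κ → κ → (κ →₀ ℂ)) (f : (ι →₀ ℂ) →ₗ[ℂ] (κ →₀ ℂ))
    (hmem : ∀ k, f (Finsupp.single k 1) ∈ homogPart p' (p k))
    (hbr : ∀ j k, f (s j k) =
      tableBracket s' (f (Finsupp.single j 1)) (f (Finsupp.single k 1))) :
    IsSuperHom (homogPart p) (tableBracket s) (homogPart p') (tableBracket s') f where
  map_mem i := homogPart_induction f _ (by rintro k rfl; exact hmem k)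
  map_bracket x y := by
    have : (tableBracket s).compr₂ f = ((tableBracket s').compl₁₂ f f) := by
      ext1 j
      ext1
      ext1 k
      ext1
      simpa using hbr j k
    exact congrArg (fun g => g x y) this

theorem isSuperRep_of_basis {ι W : Type*} [AddCommGroup W] [Module ℂ W] (p : ι → ZMod 2)
    (s : ι → ι → (ι →₀ ℂ)) (Γ : Module.End ℂ W) (ρ : (ι →₀ ℂ) →ₗ[ℂ] Module.End ℂ W)
    (hΓ : Γ * Γ = 1)
    (hpar : ∀ k, Γ * ρ (Finsupp.single k 1) = sg (p k) • (ρ (Finsupp.single k 1) * Γ))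
    (hbr : ∀ j k, ρ (s j k) = ρ (Finsupp.single j 1) * ρ (Finsupp.single k 1)
      - sg (p j * p k) • (ρ (Finsupp.single k 1) * ρ (Finsupp.single j 1))) :
    IsSuperRep (homogPart p) (tableBracket s) Γ ρ where
  parity_sq := hΓ
  parity i x hx := by
    have := homogPart_induction (p := p) (i := i)
      (LinearMap.mulLeft ℂ Γ ∘ₗ ρ - sg i • (LinearMap.mulRight ℂ Γ ∘ₗ ρ)) ⊥ (by
        rintro k rfl
        simpa [sub_eq_zero] using hpar k) x hx
    simpa [sub_eq_zero] using this
  map_bracket i j x hx y hy := by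
    have := homogPart_induction₂ (p := p) (p' := p) (i := i) (j := j)
      ((tableBracket s).compr₂ ρ - ((LinearMap.mul ℂ (Module.End ℂ W)).compl₁₂ ρ ρ)
        + sg (i * j) • ((LinearMap.mul ℂ (Module.End ℂ W)).compl₁₂ ρ ρ).flip) ⊥ (by
        rintro k l rfl rfl
        simp [hbr k l]) x hx y hy
    simp only [LinearMap.add_apply, LinearMap.sub_apply, LinearMap.smul_apply,
      LinearMap.flip_apply, LinearMap.compr₂_apply, LinearMap.compl₁₂_apply,
      LinearMap.mul_apply', Submodule.mem_bot] at this
    rw [← sub_eq_zero, ← this]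
    abel

theorem IsSuperRep.comp {A B W : Type*} [AddCommGroup A] [Module ℂ A] [AddCommGroup B]
    [Module ℂ B] [AddCommGroup W] [Module ℂ W] {𝒜 : ZMod 2 → Submodule ℂ A}
    {brA : A →ₗ[ℂ] A →ₗ[ℂ] A} {ℬ : ZMod 2 → Submodule ℂ B} {brB : B →ₗ[ℂ] B →ₗ[ℂ] B}
    {Γ : Module.End ℂ W} {ρ : B →ₗ[ℂ] Module.End ℂ W} {f : A →ₗ[ℂ] B}
    (hρ : IsSuperRep ℬ brB Γ ρ) (hf : IsSuperHom 𝒜 brA ℬ brB f) :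
    IsSuperRep 𝒜 brA Γ (ρ ∘ₗ f) where
  parity_sq := hρ.parity_sq
  parity i x hx := hρ.parity i _ (hf.map_mem i x hx)
  map_bracket i j x hx y hy := by
    simp only [LinearMap.comp_apply, hf.map_bracket]
    exact hρ.map_bracket i j _ (hf.map_mem i x hx) _ (hf.map_mem j y hy)

/-- A Lie superalgebra structure pulls back along an injective homomorphism. -/
theorem IsLieSuperalgebra.of_injective {A B : Type*} [AddCommGroup A] [Module ℂ A]
    [AddCommGroup B] [Module ℂ B] {𝒜 : ZMod 2 → Submodule ℂ A} {brA : A →ₗ[ℂ] A →ₗ[ℂ] A}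
    {ℬ : ZMod 2 → Submodule ℂ B} {brB : B →ₗ[ℂ] B →ₗ[ℂ] B} {f : A →ₗ[ℂ] B}
    (hB : IsLieSuperalgebra ℬ brB) (hf : IsSuperHom 𝒜 brA ℬ brB f) (hinj : Function.Injective f)
    (hgr : DirectSum.IsInternal 𝒜)
    (hmem : ∀ i j : ZMod 2, ∀ x ∈ 𝒜 i, ∀ y ∈ 𝒜 j, brA x y ∈ 𝒜 (i + j)) :
    IsLieSuperalgebra 𝒜 brA where
  grading := hgr
  bracket_mem := hmem
  skew i j x hx y hy := hinj (by
    simp only [map_neg, map_smul, hf.map_bracket]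
    exact hB.skew i j _ (hf.map_mem i x hx) _ (hf.map_mem j y hy))
  jacobi i j k x hx y hy z hz := hinj (by
    simp only [map_add, map_smul, hf.map_bracket, map_zero]
    exact hB.jacobi i j k _ (hf.map_mem i x hx) _ (hf.map_mem j y hy) _ (hf.map_mem k z hz))

/-! ### The bracket table of the extended superalgebra -/

namespace Xsc

variable (P : XscParams)

theorem table_L_L (m n : ℤ) : table P (.L m) (.L n) =
      ((n : ℂ) - m) • el (.L (m + n))
      + ((-P.a * (m : ℂ) ^ 3 + P.a' * m) * kron (m + n)) • el .one := by
  rfl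

theorem table_G_G (m n : ℤ) : table P (.G m) (.G n) =
      (2 : ℂ) • el (.L (m + n))
      + ((P.b * (m : ℂ) ^ 2 + 2 * P.γ' - P.a') * kron (m + n)) • el .one
      + ((2 * P.α - P.e) * ((m : ℂ) ^ 2 + (n : ℂ) ^ 2)
          + (2 * P.β - P.e) * ((m : ℂ) * n) - P.γ * ((m : ℂ) + n) - 2 * P.γ') • el (.U (m + n))
      + P.e • el (.V (m + n)) := by
  simp only [table, half, XscIdx.deg, mul_zero, zero_mul, mul_one, sg_zero, sg_one]
  module

theorem table_L_G (m n : ℤ) : table P (.L m) (.G n) =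
      ((n : ℂ) - m / 2) • el (.G (m + n))
      + (P.α * (m : ℂ) ^ 3 + P.β * (m : ℂ) ^ 2 * n - P.γ * ((m : ℂ) * n + (m : ℂ) ^ 2 / 2)
        - 2 * P.γ' * m) • el (.θ (m + n)) := by
  simp only [table, half, XscIdx.deg, mul_zero, zero_mul, mul_one, sg_zero, sg_one]
  module

theorem table_L_θ (m n : ℤ) : table P (.L m) (.θ n) =
      ((n : ℂ) + 3 * m / 2) • el (.θ (m + n)) := by
  simp only [table, half, XscIdx.deg, mul_zero, zero_mul, mul_one, sg_zero, sg_one]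
  module

theorem table_L_U (m n : ℤ) : table P (.L m) (.U n) =
      ((n : ℂ) + m) • el (.U (m + n)) := by
  simp only [table, half, XscIdx.deg, mul_zero, zero_mul, mul_one, sg_zero, sg_one]
  module

theorem table_L_V (m n : ℤ) : table P (.L m) (.V n) =
      ((n : ℂ) - m) • el (.V (m + n))
      + ((m : ℂ) ^ 3 + (m : ℂ) ^ 2 * n / 2) • el (.U (m + n)) := by
  simp only [table, half, XscIdx.deg, mul_zero, zero_mul, mul_one, sg_zero, sg_one]
  module

theorem table_L_W (m n : ℤ) : table P (.L m) (.W n) =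
      ((n : ℂ) - m / 2) • el (.W (m + n)) := by
  simp only [table, half, XscIdx.deg, mul_zero, zero_mul, mul_one, sg_zero, sg_one]
  module

theorem table_G_θ (m n : ℤ) : table P (.G m) (.θ n) =
      -(kron (m + n) • el .one) + el (.U (m + n)) := by
  simp only [table, half, XscIdx.deg, mul_zero, zero_mul, mul_one, sg_zero, sg_one]
  module

theorem table_G_U (m n : ℤ) : table P (.G m) (.U n) =
      (2 * (m : ℂ) + n) • el (.θ (m + n)) := by
  simp only [table, half, XscIdx.deg, mul_zero, zero_mul, mul_one, sg_zero, sg_one]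
  module

theorem table_G_V (m n : ℤ) : table P (.G m) (.V n) =
      ((n : ℂ) - 2 * m) • el (.W (m + n))
      + (2 * (m : ℂ) ^ 3 + 3 * (m : ℂ) ^ 2 * n + (m : ℂ) * (n : ℂ) ^ 2) • el (.θ (m + n)) := by
  simp only [table, half, XscIdx.deg, mul_zero, zero_mul, mul_one, sg_zero, sg_one]
  module

theorem table_G_W (m n : ℤ) : table P (.G m) (.W n) =
      el (.V (m + n))
      - (2 * (m : ℂ) ^ 2 + (m : ℂ) * n) • el (.U (m + n)) := by
  simp only [table, half, XscIdx.deg, mul_zero, zero_mul, mul_one, sg_zero, sg_one]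
  module

theorem table_G_L (n m : ℤ) : table P (.G n) (.L m) = -table P (.L m) (.G n) := by
  simp only [table, half, XscIdx.deg, mul_zero, zero_mul, mul_one, sg_zero, sg_one]
  module

theorem table_θ_L (n m : ℤ) : table P (.θ n) (.L m) = -table P (.L m) (.θ n) := by
  simp only [table, half, XscIdx.deg, mul_zero, zero_mul, mul_one, sg_zero, sg_one]
  module

theorem table_U_L (n m : ℤ) : table P (.U n) (.L m) = -table P (.L m) (.U n) := by
  simp only [table, half, XscIdx.deg, mul_zero, zero_mul, mul_one, sg_zero, sg_one]
  module

theorem table_V_L (n m : ℤ) : table P (.V n) (.L m) = -table P (.L m) (.V n) := by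
  simp only [table, half, XscIdx.deg, mul_zero, zero_mul, mul_one, sg_zero, sg_one]
  module

theorem table_W_L (n m : ℤ) : table P (.W n) (.L m) = -table P (.L m) (.W n) := by
  simp only [table, half, XscIdx.deg, mul_zero, zero_mul, mul_one, sg_zero, sg_one]
  module

theorem table_θ_G (n m : ℤ) : table P (.θ n) (.G m) = table P (.G m) (.θ n) := by
  simp only [table, half, XscIdx.deg, mul_zero, zero_mul, mul_one, sg_zero, sg_one]
  module

theorem table_U_G (n m : ℤ) : table P (.U n) (.G m) = -table P (.G m) (.U n) := by
  simp only [table, half, XscIdx.deg, mul_zero, zero_mul, mul_one, sg_zero, sg_one]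
  module

theorem table_V_G (n m : ℤ) : table P (.V n) (.G m) = -table P (.G m) (.V n) := by
  simp only [table, half, XscIdx.deg, mul_zero, zero_mul, mul_one, sg_zero, sg_one]
  module

theorem table_W_G (n m : ℤ) : table P (.W n) (.G m) = table P (.G m) (.W n) := by
  simp only [table, half, XscIdx.deg, mul_zero, zero_mul, mul_one, sg_zero, sg_one]
  module

/-- The basis vectors that supercommute with each other. -/
def IsTail : XscIdx → Prop
  | .L _ => False
  | .G _ => False
  | _ => True

theorem isTail_θ (m : ℤ) : IsTail (.θ m) := trivial

theorem isTail_U (m : ℤ) : IsTail (.U m) := trivial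

theorem isTail_V (m : ℤ) : IsTail (.V m) := trivial

theorem isTail_W (m : ℤ) : IsTail (.W m) := trivial

theorem table_tail {j k : XscIdx} (hj : IsTail j) (hk : IsTail k) : table P j k = 0 := by
  cases j <;> cases k <;> simp_all [IsTail, table, half]

theorem table_one_left (k : XscIdx) : table P .one k = 0 := by
  cases k <;> simp [table, half]

theorem table_one_right (k : XscIdx) : table P k .one = 0 := by
  cases k <;> simp [table, half]

end Xsc

/-! ### Skew symmetry and the Jacobi identity -/

namespace Xsc

variable (P : XscParams)

theorem bracket_el (j k : XscIdx) : bracket P (el j) (el k) = table P j k :=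
  tableBracket_single _ j k

theorem kron_eq_zero_or {s : ℤ} : kron s = 0 ∨ (kron s = 1 ∧ s = 0) := by
  by_cases h : s = 0 <;> simp [kron, h]

/-- The graded Jacobi identity of three basis vectors. -/
def Jac (j k l : XscIdx) : Prop :=
  sg (j.deg * l.deg) • bracket P (el j) (table P k l)
    + sg (k.deg * j.deg) • bracket P (el k) (table P l j)
    + sg (l.deg * k.deg) • bracket P (el l) (table P j k) = 0

variable {P}

theorem Jac.cycle {j k l : XscIdx} (h : Jac P j k l) : Jac P k l j := by
  unfold Jac at *
  rw [← h]
  abel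

theorem table_skew (j k : XscIdx) : table P j k = -(sg (j.deg * k.deg) • table P k j) := by
  rcases j with m | m | m | m | m | m | _ <;> rcases k with n | n | n | n | n | n | _ <;>
    simp only [XscIdx.deg, mul_zero, zero_mul, mul_one, sg_zero, sg_one, one_smul, neg_smul,
      neg_neg, table_one_left, table_one_right, smul_zero, neg_zero, table_tail,
      isTail_θ, isTail_U, isTail_V, isTail_W,
      table_G_L, table_θ_L, table_U_L, table_V_L, table_W_L, table_θ_G, table_U_G, table_V_G,
      table_W_G]
  -- Only the pairs L, L and G, G are left. Their central terms have the right symmetry only on m +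
  -- n = 0, where the first is odd and the second even in m.
  all_goals
    simp only [table_L_L, table_G_G, add_comm n m]
    rcases kron_eq_zero_or (s := m + n) with h | ⟨h, h'⟩
    · rw [h]; module
    · obtain rfl : n = -m := by omega
      push_cast
      rw [h]; module

theorem bracket_one_left (x : Xsc) : bracket P (el .one) x = 0 := by
  have : bracket P (el .one) = 0 := by
    ext1 k
    ext1
    exact (bracket_el P .one k).trans (table_one_left P k)
  rw [this]; rfl

theorem jac_one (j k : XscIdx) : Jac P .one j k := by
  simp [Jac, table_one_left, table_one_right, bracket_one_left]

/-- The Jacobi identity of two of the supercommuting basis vectors and a third one. -/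
theorem jac_tail (j : XscIdx) {k l : XscIdx} (hk : IsTail k) (hl : IsTail l) : Jac P j k l := by
  -- The tail is an ideal with zero brackets among its elements, so each of the three double
  -- brackets vanishes separately.
  rcases j with m | m | m | m | m | m | _ <;> rcases k with n | n | n | n | n | n | _ <;>
    first
    | exact hk.elim
    | rcases l with p | p | p | p | p | p | _ <;>
    first
    | exact hl.elim
    | simp only [Jac, table_one_left, table_one_right, bracket_one_left, table_tail,
          isTail_θ, isTail_U, isTail_V, isTail_W,
        table_G_L, table_θ_L, table_U_L, table_V_L, table_W_L, table_θ_G, table_U_G, table_V_G,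
        table_W_G, table_L_θ, table_L_U, table_L_V, table_L_W, table_G_θ, table_G_U, table_G_V,
        table_G_W, map_add, map_sub, map_neg, map_smul, map_zero, bracket_el, smul_zero,
        add_zero, sub_zero, neg_zero]

-- In a bracket of two of the L, G the parameters multiply only tail vectors, and these supercommute
-- with the tail entry. The identities are therefore free of parameters, and no relation between
-- them is required.
set_option maxHeartbeats 2000000 in
theorem jac_LG_LG_tail (j k l : XscIdx) (hj : ¬ IsTail j) (hk : ¬ IsTail k) (hl : IsTail l) :
    Jac P j k l := by
  rcases j with m | m | m | m | m | m | _ <;> first | exact (hj trivial).elim | skip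
  all_goals rcases k with n | n | n | n | n | n | _ <;> first | exact (hk trivial).elim | skip
  all_goals rcases l with p | p | p | p | p | p | _ <;>
    first | exact hl.elim | with_reducible exact (jac_one _ _).cycle | skip
  all_goals
    unfold Jac
    -- All ways of adding the three indices are brought to one form, so that equal basis vectors
    -- become syntactically equal and their coefficients can be compared.
    have e1 : (m + n) + p = m + (n + p) := by ring
    have e2 : m + (p + n) = m + (n + p) := by ring
    have e3 : (m + p) + n = m + (n + p) := by ring
    have e4 : n + (m + p) = m + (n + p) := by ring
    have e5 : (n + m) + p = m + (n + p) := by ring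
    have e6 : n + (p + m) = m + (n + p) := by ring
    have e7 : (n + p) + m = m + (n + p) := by ring
    have e8 : p + (m + n) = m + (n + p) := by ring
    have e9 : (p + m) + n = m + (n + p) := by ring
    have e10 : p + (n + m) = m + (n + p) := by ring
    have e11 : (p + n) + m = m + (n + p) := by ring
    simp only [XscIdx.deg, mul_zero, zero_mul, mul_one, sg_zero, sg_one, one_smul, neg_smul,
      map_add, map_sub, map_smul, map_neg, map_zero, bracket_el, table_tail,
      isTail_θ, isTail_U, isTail_V, isTail_W,
      table_one_left, table_one_right, bracket_one_left,
      table_G_L, table_θ_L, table_U_L, table_V_L, table_W_L, table_θ_G, table_U_G, table_V_G,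
      table_W_G, table_L_θ, table_L_U, table_L_V, table_L_W, table_G_θ, table_G_U, table_G_V,
      table_G_W, table_L_L, table_L_G, table_G_G, e1, e2, e3, e4, e5, e6, e7, e8, e9, e10, e11,
      smul_zero, add_zero, zero_add, sub_zero, zero_sub, neg_zero]
    try push_cast
    try
      -- The coefficients of the central element are not equal as polynomials in three indices; they
      -- agree after one index is eliminated on the support of the Kronecker symbol.
      rcases kron_eq_zero_or (s := m + (n + p)) with h | ⟨h, h'⟩
      · try simp only [h]
        module
      · have hp : (p : ℂ) = -m - n := by
          have : p = -m - n := by omega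
          simp [this]
        try simp only [h]
        simp only [hp]
        module

-- The relation between the parameters is the m³ coefficient of the central term for L_m, G_n, G_p
-- with m + n + p = 0: the bracket of L with L gives -2a, the central term of {G, G} gives -b/2, and
-- the θ-part of [L, G] gives -2α + β. The other triples do not involve the relation; solving it for
-- b beforehand serves all cases at once.
set_option maxHeartbeats 2000000 in
theorem jac_LG (hP : 2 * P.α - P.β = 2 * P.a - P.b / 2) (j k l : XscIdx)
    (hj : ¬ IsTail j) (hk : ¬ IsTail k) (hl : ¬ IsTail l) : Jac P j k l := by
  have hb : P.b = 4 * P.a - 4 * P.α + 2 * P.β := by linear_combination 2 * hP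
  rcases j with m | m | m | m | m | m | _ <;> first | exact (hj trivial).elim | skip
  all_goals rcases k with n | n | n | n | n | n | _ <;> first | exact (hk trivial).elim | skip
  all_goals rcases l with p | p | p | p | p | p | _ <;> first | exact (hl trivial).elim | skip
  all_goals
    unfold Jac
    have e1 : (m + n) + p = m + (n + p) := by ring
    have e2 : m + (p + n) = m + (n + p) := by ring
    have e3 : (m + p) + n = m + (n + p) := by ring
    have e4 : n + (m + p) = m + (n + p) := by ring
    have e5 : (n + m) + p = m + (n + p) := by ring
    have e6 : n + (p + m) = m + (n + p) := by ring
    have e7 : (n + p) + m = m + (n + p) := by ring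
    have e8 : p + (m + n) = m + (n + p) := by ring
    have e9 : (p + m) + n = m + (n + p) := by ring
    have e10 : p + (n + m) = m + (n + p) := by ring
    have e11 : (p + n) + m = m + (n + p) := by ring
    simp only [XscIdx.deg, mul_zero, zero_mul, mul_one, sg_zero, sg_one, one_smul, neg_smul,
      map_add, map_sub, map_smul, map_neg, map_zero, bracket_el, table_tail,
      isTail_θ, isTail_U, isTail_V, isTail_W,
      table_one_left, table_one_right, bracket_one_left,
      table_G_L, table_θ_L, table_U_L, table_V_L, table_W_L, table_θ_G, table_U_G, table_V_G,
      table_W_G, table_L_θ, table_L_U, table_L_V, table_L_W, table_G_θ, table_G_U, table_G_V,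
      table_G_W, table_L_L, table_L_G, table_G_G, e1, e2, e3, e4, e5, e6, e7, e8, e9, e10, e11,
      smul_zero, add_zero, zero_add, sub_zero, zero_sub, neg_zero, hb]
    try push_cast
    try
      rcases kron_eq_zero_or (s := m + (n + p)) with h | ⟨h, h'⟩
      · try simp only [h]
        module
      · have hp : (p : ℂ) = -m - n := by
          have : p = -m - n := by omega
          simp [this]
        try simp only [h]
        simp only [hp]
        module

theorem jac_basis (hP : 2 * P.α - P.β = 2 * P.a - P.b / 2) (j k l : XscIdx) : Jac P j k l := by
  -- The identity is invariant under cyclic permutations, which move the tail entries to the last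
  -- places.
  by_cases hj : IsTail j <;> by_cases hk : IsTail k <;> by_cases hl : IsTail l
  · exact jac_tail j hk hl
  · exact (jac_tail l hj hk).cycle
  · exact (jac_tail k hl hj).cycle.cycle
  · exact (jac_LG_LG_tail k l j hk hl hj).cycle.cycle
  · exact jac_tail j hk hl
  · exact (jac_LG_LG_tail l j k hl hj hk).cycle
  · exact jac_LG_LG_tail j k l hj hk hl
  · exact jac_LG hP j k l hj hk hl

end Xsc

/-! ### The Lie superalgebra and the redefinition of its generators -/

namespace Xsc

variable {P : XscParams}

theorem el_mem_part {i : ZMod 2} {k : XscIdx} (h : k.deg = i) : el k ∈ homogPart XscIdx.deg i :=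
  single_mem_homogPart h 1

theorem table_mem (j k : XscIdx) : table P j k ∈ homogPart XscIdx.deg (j.deg + k.deg) := by
  rcases j with m | m | m | m | m | m | _ <;> rcases k with n | n | n | n | n | n | _ <;>
    simp only [table_one_left, table_one_right, table_tail, isTail_θ, isTail_U, isTail_V,
      isTail_W, table_G_L, table_θ_L, table_U_L, table_V_L, table_W_L, table_θ_G, table_U_G,
      table_V_G, table_W_G, table_L_θ, table_L_U, table_L_V, table_L_W, table_G_θ, table_G_U,
      table_G_V, table_G_W, table_L_L, table_L_G, table_G_G, Submodule.zero_mem] <;>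
    repeat' first
      | apply Submodule.add_mem
      | apply Submodule.sub_mem
      | apply Submodule.neg_mem
      | apply Submodule.smul_mem
      | exact el_mem_part rfl

theorem isLieSuperalgebra (hP : 2 * P.α - P.β = 2 * P.a - P.b / 2) :
    IsLieSuperalgebra part (bracket P) :=
  isLieSuperalgebra_tableBracket _ _ table_mem table_skew (jac_basis hP)

variable (P)

theorem redefine_L (m : ℤ) : redefine P (el (.L m)) =
    el (.L m) - (P.a' / 2 * kron m) • el .one + (P.β / 2 * (m : ℂ) ^ 2) • el (.U m) := by
  simp [redefine, el, Finsupp.linearCombination_single]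

theorem redefine_G (m : ℤ) : redefine P (el (.G m)) =
    el (.G m) - (P.e / 2) • el (.W m)
      + ((P.β - 2 * P.α) * (m : ℂ) ^ 2 + P.γ * m + P.γ') • el (.θ m) := by
  simp [redefine, el, Finsupp.linearCombination_single]

theorem redefine_tail {k : XscIdx} (hk : IsTail k) : redefine P (el k) = el k := by
  rcases k with m | m | m | m | m | m | _ <;> first | exact hk.elim | skip
  all_goals simp [redefine, el, Finsupp.linearCombination_single]

theorem isTail_one : IsTail .one := trivial

/-- The parameters of the inverse of the redefinition of the generators. -/
def _root_.XscParams.opposite (P : XscParams) : XscParams :=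
  { a := P.a, a' := -P.a', α := -P.α, β := -P.β, γ := -P.γ, γ' := -P.γ', e := -P.e, b := P.b }

/-- The corrections are tail vectors, which the redefinition fixes, and they depend linearly on the
parameters. Two redefinitions therefore compose by adding parameters. -/
theorem redefine_opposite (P Q : XscParams) (h1 : Q.a' = -P.a') (h2 : Q.α = -P.α)
    (h3 : Q.β = -P.β) (h4 : Q.γ = -P.γ) (h5 : Q.γ' = -P.γ') (h6 : Q.e = -P.e) (x : Xsc) :
    redefine Q (redefine P x) = x := by
  have : redefine Q ∘ₗ redefine P = LinearMap.id := by
    ext1 k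
    ext1
    change redefine Q (redefine P (el k)) = el k
    rcases k with m | m | m | m | m | m | _ <;>
      simp only [redefine_L, redefine_G, redefine_tail, isTail_θ, isTail_U, isTail_V,
        isTail_W, isTail_one, map_add, map_sub, map_smul, h1, h2, h3, h4, h5, h6]
    all_goals module
  exact congrArg (fun g => g x) this

theorem redefine_bijective : Function.Bijective (redefine P) :=
  Function.bijective_iff_has_inverse.mpr ⟨redefine P.opposite,
    redefine_opposite P P.opposite rfl rfl rfl rfl rfl rfl,
    redefine_opposite P.opposite P (by simp [XscParams.opposite]) (by simp [XscParams.opposite])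
      (by simp [XscParams.opposite]) (by simp [XscParams.opposite])
      (by simp [XscParams.opposite]) (by simp [XscParams.opposite])⟩

theorem cast_eq_neg_of_add_eq_zero {m n : ℤ} (h : m + n = 0) : (n : ℂ) = -m := by
  have : n = -m := by omega
  simp [this]

variable {P}

-- Each correction trivializes a cocycle. The shift of L_0 by -a'/2 absorbs the linear central term
-- because [L_m, L_{-m}] contains -2m L_0; the term -(e/2) W cancels e V in {G, G}, since {G, W}
-- contains V; the U- and θ-corrections together remove the remaining θ- and U-terms and change the
-- central term of {G, G} to 4am².
set_option maxHeartbeats 1000000 in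
theorem redefine_isSuperHom (hP : 2 * P.α - P.β = 2 * P.a - P.b / 2) :
    IsSuperHom part (bracket P.reduced) part (bracket P) (redefine P) := by
  have hb : P.b = 4 * P.a - 4 * P.α + 2 * P.β := by linear_combination 2 * hP
  refine isSuperHom_of_basis _ _ _ _ _ (fun k => ?_) (fun j k => ?_)
  · change redefine P (el k) ∈ _
    rcases k with m | m | m | m | m | m | _ <;>
      simp only [redefine_L, redefine_G, redefine_tail, isTail_θ, isTail_U, isTail_V,
        isTail_W, isTail_one]
    all_goals
      repeat' first
      | apply Submodule.add_mem
      | apply Submodule.sub_mem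
      | apply Submodule.neg_mem
      | apply Submodule.smul_mem
      | exact el_mem_part rfl
  · change redefine P (table P.reduced j k) =
      bracket P (redefine P (el j)) (redefine P (el k))
    rcases j with m | m | m | m | m | m | _ <;> rcases k with n | n | n | n | n | n | _ <;>
      simp only [redefine_L, redefine_G, redefine_tail, isTail_θ, isTail_U, isTail_V,
        isTail_W, isTail_one, map_add, map_sub, map_neg, map_smul, map_zero, LinearMap.add_apply,
        LinearMap.sub_apply, LinearMap.smul_apply, LinearMap.neg_apply, bracket_el,
        table_one_left, table_one_right, table_tail,
        table_G_L, table_θ_L, table_U_L, table_V_L, table_W_L, table_θ_G, table_U_G,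
        table_V_G, table_W_G, table_L_θ, table_L_U, table_L_V, table_L_W, table_G_θ, table_G_U,
        table_G_V, table_G_W, table_L_L, table_L_G, table_G_G, smul_zero, add_zero, zero_add,
        sub_zero, neg_zero, XscParams.reduced, hb]
    all_goals try simp only [add_comm n m]
    all_goals try push_cast
    all_goals
      rcases kron_eq_zero_or (s := m + n) with h | ⟨h, h'⟩
      · try simp only [h]
        module
      · have hn := cast_eq_neg_of_add_eq_zero h'
        try simp only [h]
        simp only [hn]
        module

end Xsc

/-! ### The superconformal algebra inside the extended superalgebra -/

namespace Sconf

theorem embed_L (P : XscParams) (s : ℂ) (m : ℤ) : embed P s (el (.L m)) =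
    Xsc.el (.L m) + (P.β / 2 * (m : ℂ) ^ 2) • Xsc.el (.U m) + (s * kron m) • Xsc.el .one := by
  simp [embed, el, Finsupp.linearCombination_single]

theorem embed_G (P : XscParams) (s : ℂ) (m : ℤ) : embed P s (el (.G m)) =
    Xsc.el (.G m) - (P.e / 2) • Xsc.el (.W m)
      + ((P.β - 2 * P.α) * (m : ℂ) ^ 2 + P.γ * m + P.γ') • Xsc.el (.θ m) := by
  simp [embed, el, Finsupp.linearCombination_single]

theorem embed_one (P : XscParams) (s : ℂ) : embed P s (el .one) = Xsc.el .one := by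
  simp [embed, el, Finsupp.linearCombination_single]

/-- The projection that forgets `θ, U, V, W`, up to a shift of `L_0`. -/
noncomputable def retract (s : ℂ) : Xsc →ₗ[ℂ] Sconf :=
  Finsupp.linearCombination ℂ fun
    | .L m => el (.L m) - (s * kron m) • el .one
    | .G m => el (.G m)
    | .one => el .one
    | _ => 0

theorem retract_el (s : ℂ) (k : XscIdx) : retract s (Xsc.el k) = match k with
    | .L m => el (.L m) - (s * kron m) • el .one
    | .G m => el (.G m)
    | .one => el .one
    | _ => 0 := by
  rcases k with m | m | m | m | m | m | _ <;>
    simp [retract, Xsc.el, Finsupp.linearCombination_single]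

theorem embed_injective (P : XscParams) (s : ℂ) : Function.Injective (embed P s) := by
  refine Function.LeftInverse.injective (g := retract s) fun x => ?_
  have : retract s ∘ₗ embed P s = LinearMap.id := by
    ext1 k
    ext1
    change retract s (embed P s (el k)) = el k
    rcases k with m | m | _ <;>
      simp only [embed_L, embed_G, embed_one, map_add, map_sub, map_smul, retract_el]
    all_goals module
  exact congrArg (fun g => g x) this

theorem el_mem_part {i : ZMod 2} {k : SconfIdx} (h : k.deg = i) :
    el k ∈ homogPart SconfIdx.deg i :=
  single_mem_homogPart h 1

theorem table_mem (C a' : ℂ) (j k : SconfIdx) :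
    table C a' j k ∈ homogPart SconfIdx.deg (j.deg + k.deg) := by
  rcases j with m | m | _ <;> rcases k with n | n | _ <;>
    simp only [table, Submodule.zero_mem] <;>
    repeat' first
      | apply Submodule.add_mem
      | apply Submodule.neg_mem
      | apply Submodule.smul_mem
      | exact el_mem_part rfl

-- The corrections by U, W and θ are those of `redefine`; only the constant in L_0 is left free.
-- Replacing L_0 by L_0 + s in -2m L_0 adds 2sm to the linear central term, whence P.a' + 2s, while
-- 12 P.a makes the cubic and quadratic central coefficients -a and 4a.
open Xsc in
set_option maxHeartbeats 1000000 in
theorem embed_isSuperHom {P : XscParams} (hP : 2 * P.α - P.β = 2 * P.a - P.b / 2) (s : ℂ) :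
    IsSuperHom part (bracket (12 * P.a) (P.a' + 2 * s)) Xsc.part (Xsc.bracket P) (embed P s) := by
  have hb : P.b = 4 * P.a - 4 * P.α + 2 * P.β := by linear_combination 2 * hP
  refine isSuperHom_of_basis _ _ _ _ _ (fun k => ?_) (fun j k => ?_)
  · change embed P s (el k) ∈ _
    rcases k with m | m | _ <;> simp only [embed_L, embed_G, embed_one]
    all_goals
      repeat' first
      | apply Submodule.add_mem
      | apply Submodule.sub_mem
      | apply Submodule.smul_mem
      | exact Xsc.el_mem_part rfl
  · change embed P s (table (12 * P.a) (P.a' + 2 * s) j k) =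
      Xsc.bracket P (embed P s (el j)) (embed P s (el k))
    rcases j with m | m | _ <;> rcases k with n | n | _ <;>
      simp only [table, embed_L, embed_G, embed_one, isTail_θ, isTail_U, isTail_V,
        isTail_W, isTail_one, map_add, map_sub, map_neg, map_smul, map_zero, LinearMap.add_apply,
        LinearMap.sub_apply, LinearMap.smul_apply, LinearMap.neg_apply, bracket_el,
        table_one_left, table_one_right, table_tail,
        table_G_L, table_θ_L, table_U_L, table_V_L, table_W_L, table_θ_G, table_U_G,
        table_V_G, table_W_G, table_L_θ, table_L_U, table_L_V, table_L_W, table_G_θ, table_G_U,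
        table_G_V, table_G_W, table_L_L, table_L_G, table_G_G, smul_zero, add_zero, zero_add,
        sub_zero, neg_zero, hb]
    all_goals try simp only [add_comm n m]
    all_goals try push_cast
    all_goals
      rcases kron_eq_zero_or (s := m + n) with h | ⟨h, h'⟩
      · try simp only [h]
        module
      · have hn := cast_eq_neg_of_add_eq_zero h'
        try simp only [h]
        simp only [hn]
        module

/-- No Jacobi identity has to be checked anew: the embedding is injective and preserves brackets, so
skew symmetry and Jacobi are inherited. -/
theorem isLieSuperalgebra {P : XscParams} (hP : 2 * P.α - P.β = 2 * P.a - P.b / 2) (s : ℂ) :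
    IsLieSuperalgebra part (bracket (12 * P.a) (P.a' + 2 * s)) :=
  (Xsc.isLieSuperalgebra hP).of_injective (embed_isSuperHom hP s) (embed_injective P s)
    (homogPart_isInternal _) fun _ _ => homogPart_induction₂ _ _ (by
      rintro k l rfl rfl
      rw [bracket, tableBracket_single]
      exact table_mem _ _ k l)

end Sconf

/-! ### Commutators and anticommutators -/

section Commutators

variable {R : Type*} [Ring R] [Algebra ℂ R]

/-- The commutator as a bilinear map. -/
noncomputable def cm : R →ₗ[ℂ] R →ₗ[ℂ] R := LinearMap.mul ℂ R - (LinearMap.mul ℂ R).flip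

/-- The anticommutator as a bilinear map. -/
noncomputable def ac : R →ₗ[ℂ] R →ₗ[ℂ] R := LinearMap.mul ℂ R + (LinearMap.mul ℂ R).flip

theorem cm_apply (A B : R) : cm A B = A * B - B * A := by simp [cm]

theorem ac_apply (A B : R) : ac A B = A * B + B * A := by simp [ac]

theorem cm_swap (A B : R) : cm A B = -cm B A := by simp [cm_apply]

theorem ac_swap (A B : R) : ac A B = ac B A := by simp [ac_apply, add_comm]

theorem cm_one_left (A : R) : cm 1 A = 0 := by simp [cm_apply]

theorem cm_one_right (A : R) : cm A 1 = 0 := by simp [cm_apply]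

/-- This and the next three identities are the graded Jacobi identity for the parities that occur
when C is a fermionic mode: A, B both even, one of each parity in either order, both odd. They
express the action of a bracket on a mode through the actions of its two entries. -/
theorem cm_cm (A B C : R) : cm (cm A B) C = cm A (cm B C) - cm B (cm A C) := by
  simp only [cm_apply]; noncomm_ring

theorem ac_cm_even_odd (A B C : R) : ac (cm A B) C = cm A (ac B C) - ac B (cm A C) := by
  simp only [cm_apply, ac_apply]; noncomm_ring

theorem ac_cm_odd_even (A B C : R) : ac (cm A B) C = ac A (cm B C) + cm (ac A C) B := by
  simp only [cm_apply, ac_apply]; noncomm_ring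

theorem cm_ac (A B C : R) : cm (ac A B) C = cm A (ac B C) + cm B (ac A C) := by
  simp only [cm_apply, ac_apply]; noncomm_ring

theorem cm_eq_zero {A B : R} : cm A B = 0 ↔ A * B = B * A := by
  rw [cm_apply, sub_eq_zero]

theorem ac_eq_zero {A B : R} : ac A B = 0 ↔ A * B = -(B * A) := by
  rw [ac_apply, ← sub_neg_eq_add, sub_eq_zero]

end Commutators

/-! ### Locally finite sums of operators -/

section LocSum

variable {W : Type*} [AddCommGroup W] [Module ℂ W] {ι κ : Type*}

theorem locSum_apply {A : ι → Module.End ℂ W} (h : LocFinite A) (w : W) :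
    locSum A w = ∑ᶠ i, A i w := by
  simp [locSum, h]

theorem LocFinite.mul_right {A : ι → Module.End ℂ W} (h : LocFinite A) (B : Module.End ℂ W) :
    LocFinite fun i => A i * B := fun w => h (B w)

theorem LocFinite.mul_left {A : ι → Module.End ℂ W} (h : LocFinite A) (B : Module.End ℂ W) :
    LocFinite fun i => B * A i := fun w =>
  (h w).subset fun i hi => by
    simp only [Function.mem_support, Module.End.mul_apply] at hi ⊢
    exact fun h0 => hi (by rw [h0, map_zero])

theorem LocFinite.add {A B : ι → Module.End ℂ W} (hA : LocFinite A) (hB : LocFinite B) :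
    LocFinite fun i => A i + B i := fun w =>
  ((hA w).union (hB w)).subset (Function.support_add _ _)

theorem LocFinite.smul {A : ι → Module.End ℂ W} (hA : LocFinite A) (f : ι → ℂ) :
    LocFinite fun i => f i • A i := fun w =>
  (hA w).subset fun i hi => by
    simp only [Function.mem_support, LinearMap.smul_apply] at hi ⊢
    exact fun h0 => hi (by rw [h0, smul_zero])

theorem LocFinite.comp_equiv {A : ι → Module.End ℂ W} (hA : LocFinite A) (e : κ ≃ ι) :
    LocFinite fun i => A (e i) := fun w =>
  (hA w).preimage e.injective.injOn

theorem LocFinite.of_finite {A : ι → Module.End ℂ W} (h : (Function.support A).Finite) :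
    LocFinite A := fun _ =>
  h.subset fun i hi h0 => hi (by simp [h0])

theorem LocFinite.of_single {A : ι → Module.End ℂ W} (i : ι) (h : ∀ j, j ≠ i → A j = 0) :
    LocFinite A :=
  .of_finite ((Set.finite_singleton i).subset fun j hj => by
    by_contra h'
    exact hj (h j h'))

theorem locSum_mul {A : ι → Module.End ℂ W} (h : LocFinite A) (B : Module.End ℂ W) :
    locSum A * B = locSum fun i => A i * B := by
  ext w
  rw [Module.End.mul_apply, locSum_apply h, locSum_apply (h.mul_right B)]
  rfl

theorem mul_locSum {A : ι → Module.End ℂ W} (h : LocFinite A) (B : Module.End ℂ W) :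
    B * locSum A = locSum fun i => B * A i := by
  ext w
  rw [Module.End.mul_apply, locSum_apply h, locSum_apply (h.mul_left B)]
  exact map_finsum B (h w)

theorem locSum_add {A B : ι → Module.End ℂ W} (hA : LocFinite A) (hB : LocFinite B) :
    (locSum fun i => A i + B i) = locSum A + locSum B := by
  ext w
  rw [LinearMap.add_apply, locSum_apply hA, locSum_apply hB, locSum_apply (hA.add hB)]
  exact finsum_add_distrib (hA w) (hB w)

theorem locSum_smul {A : ι → Module.End ℂ W} (hA : LocFinite A) (r : ℂ) :
    (locSum fun i => r • A i) = r • locSum A := by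
  ext w
  rw [LinearMap.smul_apply, locSum_apply hA, locSum_apply (hA.smul fun _ => r)]
  exact (smul_finsum' r (hA w)).symm

theorem locSum_sub {A B : ι → Module.End ℂ W} (hA : LocFinite A) (hB : LocFinite B) :
    (locSum fun i => A i - B i) = locSum A - locSum B := by
  have := locSum_add hA (hB.smul fun _ => -1)
  rw [locSum_smul hB] at this
  simpa [sub_eq_add_neg] using this

theorem locSum_comp_equiv {A : ι → Module.End ℂ W} (hA : LocFinite A) (e : κ ≃ ι) :
    (locSum fun i => A (e i)) = locSum A := by
  ext w
  rw [locSum_apply hA, locSum_apply (hA.comp_equiv e)]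
  exact finsum_comp_equiv e (f := fun i => A i w)

theorem locSum_shift {A : ℤ → Module.End ℂ W} (hA : LocFinite A) (k : ℤ) :
    (locSum fun i => A (i + k)) = locSum A :=
  locSum_comp_equiv hA (Equiv.addRight k)

theorem locSum_reflect {A : ℤ → Module.End ℂ W} (hA : LocFinite A) (k : ℤ) :
    (locSum fun i => A (k - i)) = locSum A :=
  locSum_comp_equiv hA (Equiv.subLeft k)

theorem locSum_eq_sum {A : ι → Module.End ℂ W} (s : Finset ι) (h : ∀ i, i ∉ s → A i = 0) :
    locSum A = ∑ i ∈ s, A i := by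
  have hA : LocFinite A := .of_finite (s.finite_toSet.subset fun i hi => by
    by_contra h'
    exact hi (h i h'))
  ext w
  rw [locSum_apply hA, LinearMap.sum_apply]
  refine finsum_eq_sum_of_support_subset _ fun i hi => ?_
  by_contra h'
  exact hi (by simp [h i h'])

theorem locSum_eq_single {A : ι → Module.End ℂ W} (i : ι) (h : ∀ j, j ≠ i → A j = 0) :
    locSum A = A i := by
  rw [locSum_eq_sum {i} (by simpa using h), Finset.sum_singleton]

theorem locSum_zero : locSum (fun _ : ι => (0 : Module.End ℂ W)) = 0 := by
  rw [locSum_eq_sum ∅ (by simp), Finset.sum_empty]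

theorem cm_locSum {A : ι → Module.End ℂ W} (h : LocFinite A) (B : Module.End ℂ W) :
    cm (locSum A) B = locSum fun i => cm (A i) B := by
  simp only [cm_apply]
  rw [locSum_mul h, mul_locSum h, locSum_sub (h.mul_right B) (h.mul_left B)]

theorem ac_locSum {A : ι → Module.End ℂ W} (h : LocFinite A) (B : Module.End ℂ W) :
    ac (locSum A) B = locSum fun i => ac (A i) B := by
  simp only [ac_apply]
  rw [locSum_mul h, mul_locSum h, locSum_add (h.mul_right B) (h.mul_left B)]

/-- A locally finite sum of operators that intertwine `B` up to a scalar does so, too. -/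
theorem locSum_semiconj {A : ι → Module.End ℂ W} (h : LocFinite A) (B : Module.End ℂ W) (r : ℂ)
    (hB : ∀ i, B * A i = r • (A i * B)) : B * locSum A = r • (locSum A * B) := by
  rw [mul_locSum h, locSum_mul h, ← locSum_smul (h.mul_right B)]
  simp only [hB]

theorem LocFinite.of_bounds {A : ℤ → Module.End ℂ W}
    (h : ∀ w, ∃ J K : ℤ, (∀ j < J, A j w = 0) ∧ ∀ j > K, A j w = 0) : LocFinite A := fun w => by
  obtain ⟨J, K, h1, h2⟩ := h w
  refine (Set.finite_Icc J K).subset fun j hj => ?_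
  by_contra hn
  rw [Set.mem_Icc, not_and_or, not_le, not_le] at hn
  exact hj (hn.elim (h1 j) (h2 j))

/-! ### Local finiteness of products of fields -/

namespace OpField

/-- Every vector is annihilated by all modes of sufficiently negative index. -/
def Smooth (X : OpField W) : Prop := ∀ w, ∃ N : ℤ, ∀ n < N, X n w = 0

/-- On every vector `w`, the modes of `X` of sufficiently negative index vanish on all `Y_k w`. -/
def Absorbs (X Y : OpField W) : Prop := ∀ w, ∃ N : ℤ, ∀ n < N, ∀ k, X n (Y k w) = 0

/-- In ∑ X_j Y_{n-j} w the terms with large j vanish because Y is smooth. For very negative j the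
vector Y_{n-j} w varies with j, so smoothness of X is not enough; the bound must be uniform in the
mode of Y, which is what `Absorbs` provides. -/
theorem Absorbs.mulDefined {X Y : OpField W} (h : Absorbs X Y) (hY : Smooth Y) :
    MulDefined X Y := fun n => .of_bounds fun w => by
  obtain ⟨J, hJ⟩ := h w
  obtain ⟨K, hK⟩ := hY w
  refine ⟨J, n - K, fun j hj => hJ j hj _, fun j hj => ?_⟩
  rw [Module.End.mul_apply, hK (n - j) (by omega), map_zero]

theorem mul_apply_eq_locSum {X Y : OpField W} (n : ℤ) :
    mul X Y n = locSum fun j => X j * Y (n - j) := rfl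

theorem Absorbs.smooth_mul {X Y : OpField W} (h : Absorbs X Y) (hY : Smooth Y) :
    Smooth (mul X Y) := fun w => by
  obtain ⟨J, hJ⟩ := h w
  obtain ⟨K, hK⟩ := hY w
  refine ⟨J + K, fun n hn => ?_⟩
  rw [mul_apply_eq_locSum, locSum_apply (h.mulDefined hY n)]
  refine finsum_eq_zero_of_forall_eq_zero fun j => ?_
  by_cases hj : j < J
  · exact hJ j hj _
  · rw [Module.End.mul_apply, hK (n - j) (by omega), map_zero]

/-- A smooth field absorbs every field that commutes or anticommutes with it. -/
theorem Smooth.absorbs {X Y : OpField W} (hX : Smooth X) (r : ℂ)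
    (h : ∀ j k, X j * Y k = r • (Y k * X j)) : Absorbs X Y := fun w => by
  obtain ⟨N, hN⟩ := hX w
  refine ⟨N, fun n hn k => ?_⟩
  rw [← Module.End.mul_apply, h, LinearMap.smul_apply, Module.End.mul_apply, hN n hn, map_zero,
    smul_zero]

theorem Smooth.add {X Y : OpField W} (hX : Smooth X) (hY : Smooth Y) : Smooth (X + Y) :=
  fun w => by
  obtain ⟨J, hJ⟩ := hX w
  obtain ⟨K, hK⟩ := hY w
  refine ⟨min J K, fun n hn => ?_⟩
  rw [Pi.add_apply, LinearMap.add_apply, hJ n (by omega), hK n (by omega), add_zero]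

theorem Smooth.smul {X : OpField W} (hX : Smooth X) (f : ℤ → ℂ) : Smooth fun n => f n • X n :=
  fun w => by
  obtain ⟨J, hJ⟩ := hX w
  refine ⟨J, fun n hn => ?_⟩
  rw [LinearMap.smul_apply, hJ n hn, smul_zero]

theorem Smooth.dot {X : OpField W} (hX : Smooth X) : Smooth X.dot := hX.smul _

theorem Smooth.sub {X Y : OpField W} (hX : Smooth X) (hY : Smooth Y) : Smooth (X - Y) := by
  have := hX.add (hY.smul fun _ => -1)
  convert this using 1
  ext1 n
  simp [sub_eq_add_neg]

theorem Smooth.neg_part {X : OpField W} (hX : Smooth X) : Smooth X.neg := fun w => by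
  obtain ⟨J, hJ⟩ := hX w
  refine ⟨J, fun n hn => ?_⟩
  unfold neg
  split_ifs
  · exact hJ n hn
  · rfl

/-- Only finitely many modes of index at most 0 act nontrivially on a given vector, so the bounds
for X on their images have a common lower bound. This is why normal ordering makes products converge
without any commutation relation. -/
theorem Smooth.absorbs_neg {X Y : OpField W} (hX : Smooth X) (hY : Smooth Y) :
    Absorbs X Y.neg := fun w => by
  obtain ⟨K, hK⟩ := hY w
  choose N hN using hX
  obtain ⟨J, hJ⟩ : ∃ J, ∀ k ∈ Finset.Icc K 0, J ≤ N (Y k w) := by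
    obtain ⟨J, hJ⟩ := ((Finset.Icc K 0).image fun k => N (Y k w)).bddBelow
    exact ⟨J, fun k hk => hJ (by simpa using ⟨k, by simpa using hk, rfl⟩)⟩
  refine ⟨J, fun n hn k => ?_⟩
  unfold neg
  split_ifs with hk
  · by_cases hkK : k < K
    · rw [hK k hkK, map_zero]
    · exact hN _ _ (lt_of_lt_of_le hn (hJ k (by simp; omega)))
  · simp

theorem absorbs_pos (X Y : OpField W) : Absorbs X.pos Y := fun _ =>
  ⟨0, fun n hn k => by simp [pos, show ¬ 0 < n by omega]⟩

end OpField

end LocSum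

/-! ### The Fock module -/

namespace Fock

theorem create_mul_create (j k : ℤ) : create j * create k = -(create k * create j) := by
  refine LinearMap.ext fun x => ?_
  simp only [create, Module.End.mul_apply, LinearMap.mulLeft_apply, LinearMap.neg_apply,
    ← mul_assoc]
  rw [← neg_mul, eq_neg_of_add_eq_zero_left (ExteriorAlgebra.ι_add_mul_swap _ _)]

theorem annihilate_mul_annihilate (j k : ℤ) :
    annihilate j * annihilate k = -(annihilate k * annihilate j) := by
  refine LinearMap.ext fun x => ?_
  exact CliffordAlgebra.contractLeft_comm (Q := (0 : QuadraticForm ℂ (ℤ →₀ ℂ))) _ _ _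

theorem annihilate_mul_create (j k : ℤ) :
    annihilate j * create k = (if j = k then 1 else 0) - create k * annihilate j := by
  refine LinearMap.ext fun x => ?_
  simp only [create, annihilate, Module.End.mul_apply, LinearMap.mulLeft_apply,
    LinearMap.sub_apply]
  erw [CliffordAlgebra.contractLeft_ι_mul]
  congr 1
  by_cases h : j = k
  · simp [h]
  · simp [h, Finsupp.single_apply, Ne.symm h]

theorem annihilate_one (k : ℤ) : annihilate k 1 = 0 :=
  CliffordAlgebra.contractLeft_one (Q := (0 : QuadraticForm ℂ (ℤ →₀ ℂ))) _

theorem create_apply (k : ℤ) (x : Fock) :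
    create k x = ExteriorAlgebra.ι ℂ (Finsupp.single k (1 : ℂ)) * x := rfl

theorem parity_mul_create (k : ℤ) : parity * create k = -(create k * parity) := by
  refine LinearMap.ext fun x => ?_
  simp only [create, parity, Module.End.mul_apply, LinearMap.mulLeft_apply, LinearMap.neg_apply,
    AlgHom.toLinearMap_apply, map_mul]
  erw [CliffordAlgebra.involute_ι]
  rw [neg_mul]

theorem parity_mul_parity : parity * parity = 1 := by
  refine LinearMap.ext fun x => ?_
  exact CliffordAlgebra.involute_involute x

theorem parity_one : parity 1 = 1 :=
  map_one (CliffordAlgebra.involute (Q := (0 : QuadraticForm ℂ (ℤ →₀ ℂ))))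

/-- Induction on the creation operators. -/
theorem create_induction {p : Fock → Prop} (one : p 1) (add : ∀ x y, p x → p y → p (x + y))
    (smul : ∀ (r : ℂ) x, p x → p (r • x)) (create : ∀ k x, p x → p (create k x)) (x : Fock) :
    p x := by
  induction x using CliffordAlgebra.left_induction with
  | algebraMap r => rw [Algebra.algebraMap_eq_smul_one]; exact smul r 1 one
  | add x y hx hy => exact add x y hx hy
  | ι_mul x m hx =>
    induction m using Finsupp.induction_linear with
    | zero => simpa using smul 0 1 one
    | add f g hf hg => rw [map_add, add_mul]; exact add _ _ hf hg
    | single k r =>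
      have : Finsupp.single k r = r • Finsupp.single k (1 : ℂ) := by simp
      rw [this, map_smul, smul_mul_assoc]
      exact smul r _ (create k x hx)

/-- A vector involves only finitely many creation modes. The bound on |k| serves θ and p together,
whose annihilation modes are labelled by negative and nonnegative k. -/
theorem annihilate_finite (x : Fock) : ∃ N : ℤ, ∀ k, N < |k| → annihilate k x = 0 := by
  induction x using create_induction with
  | one => exact ⟨0, fun k _ => annihilate_one k⟩
  | add x y hx hy =>
    obtain ⟨M, hM⟩ := hx
    obtain ⟨N, hN⟩ := hy
    exact ⟨max M N, fun k hk => by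
      rw [map_add, hM k (by omega), hN k (by omega), add_zero]⟩
  | smul r x hx =>
    obtain ⟨M, hM⟩ := hx
    exact ⟨M, fun k hk => by rw [map_smul, hM k hk, smul_zero]⟩
  | create l x hx =>
    obtain ⟨M, hM⟩ := hx
    refine ⟨max M |l|, fun k hk => ?_⟩
    rw [← Module.End.mul_apply, annihilate_mul_create, if_neg (by rintro rfl; omega), zero_sub,
      LinearMap.neg_apply, Module.End.mul_apply, hM k (by omega), map_zero, neg_zero]

/-- The vacuum component of a vector. -/
noncomputable def vacuum : Fock →ₗ[ℂ] ℂ := ExteriorAlgebra.algebraMapInv.toLinearMap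

theorem vacuum_one : vacuum 1 = 1 :=
  map_one (ExteriorAlgebra.algebraMapInv (R := ℂ) (M := ℤ →₀ ℂ))

theorem vacuum_create (k : ℤ) (x : Fock) : vacuum (create k x) = 0 := by
  simp [vacuum, create_apply, ExteriorAlgebra.algebraMapInv]

theorem parity_mul_annihilate (k : ℤ) : parity * annihilate k = -(annihilate k * parity) := by
  refine LinearMap.ext fun x => ?_
  induction x using create_induction with
  | one =>
    simp only [Module.End.mul_apply, LinearMap.neg_apply, parity_one, annihilate_one, map_zero,
      neg_zero]
  | add x y hx hy => rw [map_add, map_add, hx, hy]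
  | smul r x hx => rw [map_smul, map_smul, hx]
  | create l x hx =>
    have h1 (y : Fock) : annihilate k (create l y)
        = (if k = l then y else 0) - create l (annihilate k y) := by
      have := congrArg (fun f => f y) (annihilate_mul_create k l)
      simp only [Module.End.mul_apply, LinearMap.sub_apply] at this
      rw [this]
      split_ifs <;> rfl
    have h2 (y : Fock) : parity (create l y) = -create l (parity y) :=
      congrArg (fun f => f y) (parity_mul_create l)
    simp only [Module.End.mul_apply, LinearMap.neg_apply] at hx ⊢
    rw [h1, map_sub, h2, h2, map_neg, h1, hx]
    split_ifs <;> simp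

theorem locFinite_create_annihilate : LocFinite fun k => create k * annihilate k := fun x => by
  obtain ⟨N, hN⟩ := annihilate_finite x
  refine (Set.finite_Icc (-N) N).subset fun k hk => ?_
  by_contra hn
  refine hk ?_
  change create k (annihilate k x) = 0
  rw [hN k ?_, map_zero]
  by_contra h
  rw [not_lt, abs_le] at h
  exact hn h

/-- The number of creation modes. -/
noncomputable def number : Module.End ℂ Fock := locSum fun k => create k * annihilate k

theorem number_one : number 1 = 0 := by
  rw [number, locSum_apply locFinite_create_annihilate]
  refine finsum_eq_zero_of_forall_eq_zero fun k => ?_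
  rw [Module.End.mul_apply, annihilate_one, map_zero]

theorem cm_number_create (k : ℤ) : cm number (create k) = create k := by
  have (j : ℤ) : cm (create j * annihilate j) (create k) = if j = k then create j else 0 := by
    refine LinearMap.ext fun y => ?_
    have h1 : annihilate j (create k y)
        = (if j = k then y else 0) - create k (annihilate j y) := by
      have := congrArg (fun f => f y) (annihilate_mul_create j k)
      simp only [Module.End.mul_apply, LinearMap.sub_apply] at this
      rw [this]
      split_ifs <;> rfl
    have h2 (z : Fock) : create k (create j z) = -create j (create k z) :=
      congrArg (fun f => f z) (create_mul_create k j)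
    rw [cm_apply]
    simp only [LinearMap.sub_apply, Module.End.mul_apply]
    rw [h1, h2, map_sub]
    split_ifs <;> simp
  rw [number, cm_locSum locFinite_create_annihilate]
  simp only [this]
  rw [locSum_eq_single k (fun j hj => if_neg hj), if_pos rfl]

theorem create_mem_eigenspace {x : Fock} {μ : ℂ} (hx : x ∈ number.eigenspace μ) (k : ℤ) :
    create k x ∈ number.eigenspace (μ + 1) := by
  rw [Module.End.mem_eigenspace_iff] at hx ⊢
  have := congrArg (fun f => f x) (cm_number_create k)
  simp only [cm_apply, LinearMap.sub_apply, Module.End.mul_apply, hx, map_smul] at this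
  rw [sub_eq_iff_eq_add] at this
  rw [this, add_smul, one_smul, add_comm]

/-- Each creation mode raises the eigenvalue of the number operator by one, starting from 0 on the
vacuum. Everything apart from a multiple of the vacuum thus lies in eigenspaces for positive
integers. -/
theorem mem_vacuum_sup (x : Fock) :
    ∃ r : ℂ, ∃ y ∈ ⨆ n : ℕ, number.eigenspace ((n : ℂ) + 1), x = r • (1 : Fock) + y := by
  induction x using create_induction with
  | one => exact ⟨1, 0, Submodule.zero_mem _, by simp⟩
  | add x y hx hy =>
    obtain ⟨r, x', hx', rfl⟩ := hx
    obtain ⟨s, y', hy', rfl⟩ := hy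
    exact ⟨r + s, x' + y', Submodule.add_mem _ hx' hy', by module⟩
  | smul r x hx =>
    obtain ⟨s, x', hx', rfl⟩ := hx
    exact ⟨r * s, r • x', Submodule.smul_mem _ _ hx', by module⟩
  | create k x hx =>
    obtain ⟨r, y, hy, rfl⟩ := hx
    refine ⟨0, create k (r • 1 + y), ?_, by simp⟩
    rw [map_add, map_smul]
    refine Submodule.add_mem _ (Submodule.smul_mem _ _ ?_) ?_
    · refine Submodule.mem_iSup_of_mem 0 ?_
      have : (1 : Fock) ∈ number.eigenspace 0 := by
        rw [Module.End.mem_eigenspace_iff, number_one, zero_smul]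
      simpa using create_mem_eigenspace this k
    · refine Submodule.iSup_induction _ (motive := fun y => create k y ∈ _) hy ?_ ?_ ?_
      · intro n z hz
        refine Submodule.mem_iSup_of_mem (n + 1) ?_
        have := create_mem_eigenspace hz k
        push_cast
        exact this
      · rw [map_zero]; exact Submodule.zero_mem _
      · intro z w hz hw
        rw [map_add]; exact Submodule.add_mem _ hz hw

/-- A vector that is killed by all annihilation operators is a multiple of the vacuum. -/
theorem eq_vacuum_of_annihilate_eq_zero (x : Fock) (h : ∀ k, annihilate k x = 0) :
    x = vacuum x • 1 := by
  have hx : number x = 0 := by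
    rw [number, locSum_apply locFinite_create_annihilate]
    exact finsum_eq_zero_of_forall_eq_zero fun k => by rw [Module.End.mul_apply, h, map_zero]
  obtain ⟨r, y, hy, rfl⟩ := mem_vacuum_sup x
  have hy0 : y ∈ number.eigenspace 0 := by
    rw [Module.End.mem_eigenspace_iff, zero_smul]
    simpa [number_one] using hx
  -- The non-vacuum part is a null vector of the number operator and also a sum of eigenvectors for
  -- nonzero eigenvalues; independence of eigenspaces makes it zero.
  have hle : (⨆ n : ℕ, number.eigenspace ((n : ℂ) + 1)) ≤ ⨆ μ ≠ (0 : ℂ), number.eigenspace μ :=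
    iSup_le fun n => le_iSup₂_of_le ((n : ℂ) + 1) (Nat.cast_add_one_ne_zero n) le_rfl
  have hy' : y = 0 := by
    have := (Module.End.eigenspaces_iSupIndep number 0).le_bot
      (Submodule.mem_inf.mpr ⟨hy0, hle hy⟩)
    simpa using this
  subst hy'
  simp [vacuum_one]

end Fock

/-! ### Fermions together with a commuting action of the Virasoro and Kac-Moody algebras -/

/-- A module `W` over the Virasoro and Kac-Moody algebras with an additional action of fermionic
modes `[ϖ_m, ϑ_n]_+ = δ_{m+n}`, the vacuum space `V` of the fermions being embedded by `vac` with
left inverse `vacL`; `scale` acts as `2` to the number of `ϑ` minus the number of `ϖ`. -/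
structure FermiModule (c k₁ k₂ : ℂ) (W V : Type*) [AddCommGroup W] [Module ℂ W]
    [AddCommGroup V] [Module ℂ V] extends VirGlModule c k₁ k₂ W where
  ϑ : ℤ → Module.End ℂ W
  ϖ : ℤ → Module.End ℂ W
  vac : V →ₗ[ℂ] W
  vacL : W →ₗ[ℂ] V
  scale : Module.End ℂ W
  ϑ_ϑ : ∀ j k, ac (ϑ j) (ϑ k) = 0
  ϖ_ϖ : ∀ j k, ac (ϖ j) (ϖ k) = 0
  ϖ_ϑ : ∀ j k, ac (ϖ j) (ϑ k) = kron (j + k) • 1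
  L_ϑ : ∀ n k, cm (L n) (ϑ k) = 0
  L_ϖ : ∀ n k, cm (L n) (ϖ k) = 0
  T_ϑ : ∀ μ ν n k, T μ ν n * ϑ k = sg (μ + ν) • (ϑ k * T μ ν n)
  T_ϖ : ∀ μ ν n k, T μ ν n * ϖ k = sg (μ + ν) • (ϖ k * T μ ν n)
  par_ϑ : ∀ k, par * ϑ k = -(ϑ k * par)
  par_ϖ : ∀ k, par * ϖ k = -(ϖ k * par)
  smooth_ϑ : OpField.Smooth ϑ
  smooth_ϖ : OpField.Smooth ϖ
  vacL_vac : ∀ v, vacL (vac v) = v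
  ϑ_vac : ∀ k < 0, ∀ v, ϑ k (vac v) = 0
  ϖ_vac : ∀ k ≤ 0, ∀ v, ϖ k (vac v) = 0
  vacL_ϑ : ∀ k, 0 ≤ k → ∀ w, vacL (ϑ k w) = 0
  vacL_ϖ : ∀ k, 0 < k → ∀ w, vacL (ϖ k w) = 0
  scale_vac : ∀ v, scale (vac v) = vac v
  vacL_scale : ∀ w, vacL (scale w) = vacL w
  scale_ϑ : ∀ k, scale * ϑ k = (2 : ℂ) • (ϑ k * scale)
  scale_ϖ : ∀ k, (2 : ℂ) • (scale * ϖ k) = ϖ k * scale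
  scale_L : ∀ k, scale * L k = L k * scale
  scale_T : ∀ μ ν k, scale * T μ ν k = T μ ν k * scale
  eq_zero_of_cm : ∀ D : Module.End ℂ W, (∀ k, cm D (ϑ k) = 0) → (∀ k, cm D (ϖ k) = 0) →
    (∀ v, vacL (D (vac v)) = 0) → D = 0
  eq_zero_of_ac : ∀ D : Module.End ℂ W, (∀ k, ac D (ϑ k) = 0) → (∀ k, ac D (ϖ k) = 0) →
    (∀ v, vacL (D (vac v)) = 0) → D = 0

namespace FermiModule

variable {c k₁ k₂ : ℂ} {W V : Type*} [AddCommGroup W] [Module ℂ W] [AddCommGroup V] [Module ℂ V]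
  (S : FermiModule c k₁ k₂ W V)

/-! #### Charge -/

/-- The operator `A` changes the charge by `n`. -/
def HasCharge (n : ℤ) (A : Module.End ℂ W) : Prop := S.scale * A = (2 : ℂ) ^ n • (A * S.scale)

/-- Operators all of whose homogeneous components change the charge by at least `r`. -/
def raising (r : ℤ) : Submodule ℂ (Module.End ℂ W) :=
  Submodule.span ℂ {A | ∃ n, r ≤ n ∧ S.HasCharge n A}

variable {S}

theorem HasCharge.mem_raising {n r : ℤ} {A : Module.End ℂ W} (h : S.HasCharge n A)
    (hr : r ≤ n) : A ∈ S.raising r := Submodule.subset_span ⟨n, hr, h⟩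

theorem raising_anti {r s : ℤ} (h : r ≤ s) : S.raising s ≤ S.raising r :=
  Submodule.span_mono fun _ ⟨n, hn, hA⟩ => ⟨n, h.trans hn, hA⟩

theorem HasCharge.mul {m n : ℤ} {A B : Module.End ℂ W} (hA : S.HasCharge m A)
    (hB : S.HasCharge n B) : S.HasCharge (m + n) (A * B) := by
  unfold HasCharge at *
  rw [← mul_assoc, hA, smul_mul_assoc, mul_assoc, hB, mul_smul_comm, smul_smul, ← mul_assoc,
    zpow_add₀ two_ne_zero]

theorem mul_mem_raising {r s t : ℤ} {A B : Module.End ℂ W} (hA : A ∈ S.raising r)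
    (hB : B ∈ S.raising s) (h : t ≤ r + s) : A * B ∈ S.raising t := by
  have : A * B ∈ S.raising r * S.raising s := Submodule.mul_mem_mul hA hB
  rw [raising, raising, Submodule.span_mul_span] at this
  refine Submodule.span_mono ?_ this
  rintro _ ⟨A, ⟨m, hm, hA⟩, B, ⟨n, hn, hB⟩, rfl⟩
  exact ⟨m + n, by omega, hA.mul hB⟩

theorem cm_mem_raising {r s t : ℤ} {A B : Module.End ℂ W} (hA : A ∈ S.raising r)
    (hB : B ∈ S.raising s) (h : t ≤ r + s) : cm A B ∈ S.raising t := by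
  rw [cm_apply]
  exact Submodule.sub_mem _ (mul_mem_raising hA hB h) (mul_mem_raising hB hA (by omega))

theorem ac_mem_raising {r s t : ℤ} {A B : Module.End ℂ W} (hA : A ∈ S.raising r)
    (hB : B ∈ S.raising s) (h : t ≤ r + s) : ac A B ∈ S.raising t := by
  rw [ac_apply]
  exact Submodule.add_mem _ (mul_mem_raising hA hB h) (mul_mem_raising hB hA (by omega))

/-- Since `scale` fixes the vacuum on both sides, moving it through A multiplies the vacuum
component by 2^n without changing it. -/
theorem HasCharge.vacuum_eq_zero {n : ℤ} {A : Module.End ℂ W} (h : S.HasCharge n A)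
    (hn : n ≠ 0) (v : V) : S.vacL (A (S.vac v)) = 0 := by
  have := congrArg (fun f => S.vacL (f (S.vac v))) h
  simp only [Module.End.mul_apply, LinearMap.smul_apply, map_smul, S.scale_vac,
    S.vacL_scale] at this
  have h2 : (1 - (2 : ℂ) ^ n) • S.vacL (A (S.vac v)) = 0 := by
    rw [sub_smul, one_smul, ← this, sub_self]
  refine (smul_eq_zero.mp h2).resolve_left fun h0 => hn ?_
  -- Passing to norms gives the same equation for a real power of 2, which forces n = 0.
  have h1 : (2 : ℂ) ^ n = 1 := (sub_eq_zero.mp h0).symm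
  have h3 : (2 : ℝ) ^ n = 1 := by simpa using congrArg norm h1
  exact (zpow_eq_one_iff_right₀ (by norm_num) (by norm_num)).mp h3

theorem vacuum_eq_zero_of_raising {A : Module.End ℂ W} (h : A ∈ S.raising 1) (v : V) :
    S.vacL (A (S.vac v)) = 0 := by
  induction h using Submodule.span_induction with
  | mem A hA => obtain ⟨n, hn, hA⟩ := hA; exact hA.vacuum_eq_zero (by omega) v
  | zero => simp
  | add A B _ _ hA hB => rw [LinearMap.add_apply, map_add, hA, hB, add_zero]
  | smul r A _ hA => rw [LinearMap.smul_apply, map_smul, hA, smul_zero]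

/-- The form in which rigidity is mostly used: once D commutes with the modes, it suffices to
estimate charges, with no evaluation on the vacuum. -/
theorem eq_zero_of_cm_of_raising {D : Module.End ℂ W} (h1 : ∀ k, cm D (S.ϑ k) = 0)
    (h2 : ∀ k, cm D (S.ϖ k) = 0) (h : D ∈ S.raising 1) : D = 0 :=
  S.eq_zero_of_cm D h1 h2 (vacuum_eq_zero_of_raising h)

theorem eq_zero_of_ac_of_raising {D : Module.End ℂ W} (h1 : ∀ k, ac D (S.ϑ k) = 0)
    (h2 : ∀ k, ac D (S.ϖ k) = 0) (h : D ∈ S.raising 1) : D = 0 :=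
  S.eq_zero_of_ac D h1 h2 (vacuum_eq_zero_of_raising h)

theorem HasCharge.locSum {ι : Type*} {n : ℤ} {A : ι → Module.End ℂ W} (hA : LocFinite A)
    (h : ∀ i, S.HasCharge n (A i)) : S.HasCharge n (_root_.locSum A) :=
  locSum_semiconj hA _ _ h

theorem HasCharge.smul {n : ℤ} {A : Module.End ℂ W} (h : S.HasCharge n A) (r : ℂ) :
    S.HasCharge n (r • A) := by
  unfold HasCharge at *
  rw [mul_smul_comm, h, smul_mul_assoc, smul_comm]

theorem HasCharge.neg {n : ℤ} {A : Module.End ℂ W} (h : S.HasCharge n A) :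
    S.HasCharge n (-A) := by
  simpa using h.smul (-1)

variable (S)

theorem hasCharge_ϑ (k : ℤ) : S.HasCharge 1 (S.ϑ k) := by
  unfold HasCharge; rw [zpow_one]; exact S.scale_ϑ k

theorem hasCharge_ϖ (k : ℤ) : S.HasCharge (-1) (S.ϖ k) := by
  unfold HasCharge
  rw [← S.scale_ϖ, smul_smul]
  norm_num

theorem hasCharge_L (k : ℤ) : S.HasCharge 0 (S.L k) := by
  unfold HasCharge; rw [zpow_zero, one_smul]; exact S.scale_L k

theorem hasCharge_T (μ ν : ZMod 2) (k : ℤ) : S.HasCharge 0 (S.T μ ν k) := by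
  unfold HasCharge; rw [zpow_zero, one_smul]; exact S.scale_T μ ν k

/-! #### Elementary commutators -/

theorem ϑ_ϖ (j k : ℤ) : ac (S.ϑ j) (S.ϖ k) = kron (j + k) • 1 := by
  rw [ac_swap, S.ϖ_ϑ, add_comm]

theorem ϑ_mul_ϑ (j k : ℤ) : S.ϑ j * S.ϑ k = -(S.ϑ k * S.ϑ j) := ac_eq_zero.mp (S.ϑ_ϑ j k)

theorem T_ϑ_even (μ : ZMod 2) (n k : ℤ) : cm (S.T μ μ n) (S.ϑ k) = 0 := by
  rw [cm_eq_zero, S.T_ϑ, CharTwo.add_self_eq_zero, sg_zero, one_smul]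

theorem T_ϖ_even (μ : ZMod 2) (n k : ℤ) : cm (S.T μ μ n) (S.ϖ k) = 0 := by
  rw [cm_eq_zero, S.T_ϖ, CharTwo.add_self_eq_zero, sg_zero, one_smul]

theorem T_ϑ_odd {μ ν : ZMod 2} (h : μ + ν = 1) (n k : ℤ) : ac (S.T μ ν n) (S.ϑ k) = 0 := by
  rw [ac_eq_zero, S.T_ϑ, h, sg_one, neg_one_smul]

theorem T_ϖ_odd {μ ν : ZMod 2} (h : μ + ν = 1) (n k : ℤ) : ac (S.T μ ν n) (S.ϖ k) = 0 := by
  rw [ac_eq_zero, S.T_ϖ, h, sg_one, neg_one_smul]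

theorem smooth_field_L : OpField.Smooth S.L := S.smooth_L

theorem smooth_field_T (μ ν : ZMod 2) : OpField.Smooth (S.T μ ν) := fun w =>
  (S.smooth_T w).imp fun _ h => h μ ν

theorem cm_L_L (m n : ℤ) : cm (S.L m) (S.L n) =
    ((n : ℂ) - m) • S.L (m + n) - (c / 12 * ((m : ℂ) ^ 3 - m) * kron (m + n)) • 1 := by
  rw [cm_apply, S.L_L]

theorem cm_L_T (m : ℤ) (μ ν : ZMod 2) (n : ℤ) :
    cm (S.L m) (S.T μ ν n) = (n : ℂ) • S.T μ ν (m + n) := by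
  rw [cm_apply, S.L_T]

theorem cm_T00_T00 (m n : ℤ) : cm (S.T 0 0 m) (S.T 0 0 n)
    = ((m : ℂ) * (k₁ + k₂) * kron (m + n)) • 1 := by
  have := S.T_T 0 0 m 0 0 n
  simp [sg_zero] at this
  rw [cm_apply, this]

theorem cm_T00_T11 (m n : ℤ) : cm (S.T 0 0 m) (S.T 1 1 n)
    = (-((m : ℂ) * k₂ * kron (m + n))) • 1 := by
  have := S.T_T 0 0 m 1 1 n
  simp [sg_zero, sg_one] at this
  rw [cm_apply, this]
  module

theorem cm_T11_T11 (m n : ℤ) : cm (S.T 1 1 m) (S.T 1 1 n)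
    = ((m : ℂ) * (k₂ - k₁) * kron (m + n)) • 1 := by
  have := S.T_T 1 1 m 1 1 n
  have e : (1 : ZMod 2) + 1 = 0 := rfl
  simp [sg_zero, sg_one, e] at this
  rw [cm_apply, this]
  module

theorem cm_T00_T01 (m n : ℤ) : cm (S.T 0 0 m) (S.T 0 1 n) = S.T 0 1 (m + n) := by
  have := S.T_T 0 0 m 0 1 n
  simp [sg_zero, sg_one] at this
  rw [cm_apply, this]

theorem cm_T00_T10 (m n : ℤ) : cm (S.T 0 0 m) (S.T 1 0 n) = -S.T 1 0 (m + n) := by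
  have := S.T_T 0 0 m 1 0 n
  simp [sg_zero, sg_one] at this
  rw [cm_apply, this]

theorem cm_T11_T01 (m n : ℤ) : cm (S.T 1 1 m) (S.T 0 1 n) = -S.T 0 1 (m + n) := by
  have := S.T_T 1 1 m 0 1 n
  have e : (1 : ZMod 2) + 1 = 0 := rfl
  simp [sg_zero, sg_one, e] at this
  rw [cm_apply, this]

theorem cm_T11_T10 (m n : ℤ) : cm (S.T 1 1 m) (S.T 1 0 n) = S.T 1 0 (m + n) := by
  have := S.T_T 1 1 m 1 0 n
  have e : (1 : ZMod 2) + 1 = 0 := rfl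
  simp [sg_zero, sg_one, e] at this
  rw [cm_apply, this]

theorem ac_T01_T01 (m n : ℤ) : ac (S.T 0 1 m) (S.T 0 1 n) = 0 := by
  have := S.T_T 0 1 m 0 1 n
  simp [sg_zero, sg_one] at this
  rw [ac_apply, this]

theorem ac_T10_T10 (m n : ℤ) : ac (S.T 1 0 m) (S.T 1 0 n) = 0 := by
  have := S.T_T 1 0 m 1 0 n
  simp [sg_zero, sg_one] at this
  rw [ac_apply, this]

theorem ac_T10_T01 (m n : ℤ) : ac (S.T 1 0 m) (S.T 0 1 n)
    = S.T 1 1 (m + n) + S.T 0 0 (m + n) - ((m : ℂ) * k₁ * kron (m + n)) • 1 := by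
  have := S.T_T 1 0 m 0 1 n
  simp [sg_zero, sg_one] at this
  rw [ac_apply, this]
  module

theorem ac_T01_T10 (m n : ℤ) : ac (S.T 0 1 m) (S.T 1 0 n)
    = S.T 1 1 (m + n) + S.T 0 0 (m + n) + ((m : ℂ) * k₁ * kron (m + n)) • 1 := by
  have := S.T_T 0 1 m 1 0 n
  simp [sg_zero, sg_one] at this
  rw [ac_apply, this]
  module

end FermiModule

namespace FermiModule

variable {c k₁ k₂ : ℂ} {W V : Type*} [AddCommGroup W] [Module ℂ W] [AddCommGroup V] [Module ℂ V]
  (S : FermiModule c k₁ k₂ W V)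

theorem kron_zero : kron 0 = 1 := by simp [kron]

theorem kron_of_ne {m : ℤ} (h : m ≠ 0) : kron m = 0 := by simp [kron, h]

/-! #### Quadratic expressions in the fermions -/

/-- The coefficient `s` of the bilinear expression `∑ f(j) ϑ_j ϑ_{s-j}`. -/
noncomputable def Q (f : ℤ → ℂ) (s : ℤ) : Module.End ℂ W :=
  locSum fun j => f j • (S.ϑ j * S.ϑ (s - j))

theorem absorbs_ϑ_ϑ : OpField.Absorbs S.ϑ S.ϑ :=
  S.smooth_ϑ.absorbs (-1) fun j k => by rw [S.ϑ_mul_ϑ, neg_one_smul]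

theorem locFinite_Q (f : ℤ → ℂ) (s : ℤ) :
    LocFinite fun j => f j • (S.ϑ j * S.ϑ (s - j)) :=
  (S.absorbs_ϑ_ϑ.mulDefined S.smooth_ϑ s).smul f

theorem hasCharge_Q (f : ℤ → ℂ) (s : ℤ) : S.HasCharge 2 (S.Q f s) :=
  .locSum (S.locFinite_Q f s) fun _ => ((S.hasCharge_ϑ _).mul (S.hasCharge_ϑ _)).smul _

/-- An operator that commutes with all `ϑ_j` up to a sign commutes with bilinear expressions. -/
theorem cm_Q_of_semiconj {B : Module.End ℂ W} {r : ℂ} (hr : r * r = 1)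
    (h : ∀ j, B * S.ϑ j = r • (S.ϑ j * B)) (f : ℤ → ℂ) (s : ℤ) : cm B (S.Q f s) = 0 := by
  rw [cm_eq_zero, Q, locSum_semiconj (S.locFinite_Q f s) B 1, one_smul]
  intro i
  have h1 (j k : ℤ) : B * (S.ϑ j * S.ϑ k) = S.ϑ j * S.ϑ k * B := by
    rw [← mul_assoc, h, smul_mul_assoc, mul_assoc, h, mul_smul_comm, smul_smul, hr,
      one_smul, mul_assoc]
  rw [one_smul, mul_smul_comm, smul_mul_assoc, h1]

theorem cm_Q_ϑ (f : ℤ → ℂ) (s k : ℤ) : cm (S.Q f s) (S.ϑ k) = 0 := by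
  rw [cm_swap, S.cm_Q_of_semiconj (r := -1) (by norm_num) fun j => by
    rw [S.ϑ_mul_ϑ, neg_one_smul], neg_zero]

theorem cm_Q_Q (f g : ℤ → ℂ) (s t : ℤ) : cm (S.Q f s) (S.Q g t) = 0 :=
  S.cm_Q_of_semiconj (r := 1) (by norm_num) (fun j => by
    rw [one_smul]; exact cm_eq_zero.mp (S.cm_Q_ϑ f s j)) g t

theorem cm_L_Q (n : ℤ) (f : ℤ → ℂ) (s : ℤ) : cm (S.L n) (S.Q f s) = 0 :=
  S.cm_Q_of_semiconj (r := 1) (by norm_num) (fun j => by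
    rw [one_smul]; exact cm_eq_zero.mp (S.L_ϑ n j)) f s

theorem sg_mul_self (d : ZMod 2) : sg d * sg d = 1 := by
  rcases ZMod.two_cases d with h | h <;> simp [h, sg_zero, sg_one]

theorem cm_T_Q (μ ν : ZMod 2) (n : ℤ) (f : ℤ → ℂ) (s : ℤ) : cm (S.T μ ν n) (S.Q f s) = 0 :=
  S.cm_Q_of_semiconj (sg_mul_self _) (fun j => S.T_ϑ μ ν n j) f s

/-- Contracting ϖ_k with the second or the first factor selects one term of the sum each, with
opposite signs. Only the antisymmetric part of the coefficients survives. -/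
theorem cm_Q_ϖ (f : ℤ → ℂ) (s k : ℤ) :
    cm (S.Q f s) (S.ϖ k) = (f (s + k) - f (-k)) • S.ϑ (s + k) := by
  have h (j : ℤ) : cm (f j • (S.ϑ j * S.ϑ (s - j))) (S.ϖ k)
      = (f j * kron (s - j + k)) • S.ϑ j - (f j * kron (j + k)) • S.ϑ (s - j) := by
    have : cm (S.ϑ j * S.ϑ (s - j)) (S.ϖ k)
        = S.ϑ j * ac (S.ϑ (s - j)) (S.ϖ k) - ac (S.ϑ j) (S.ϖ k) * S.ϑ (s - j) := by
      simp only [cm_apply, ac_apply]; noncomm_ring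
    rw [map_smul, LinearMap.smul_apply, this, S.ϑ_ϖ, S.ϑ_ϖ]
    simp only [mul_smul_comm, smul_mul_assoc, mul_one, one_mul, smul_sub, smul_smul]
  have h1 (j : ℤ) (hj : j ≠ s + k) : (f j * kron (s - j + k)) • S.ϑ j = 0 := by
    rw [kron_of_ne (by omega), mul_zero, zero_smul]
  have h2 (j : ℤ) (hj : j ≠ -k) : (f j * kron (j + k)) • S.ϑ (s - j) = 0 := by
    rw [kron_of_ne (by omega), mul_zero, zero_smul]
  rw [Q, cm_locSum (S.locFinite_Q f s)]
  simp only [h]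
  rw [locSum_sub (.of_single _ h1) (.of_single _ h2), locSum_eq_single _ h1,
    locSum_eq_single _ h2, show s - (s + k) + k = 0 by ring, show -k + k = 0 by ring, kron_zero,
    show s - -k = s + k by ring]
  module

/-- The normal ordered product `:ϑ_j ϖ_k:`. -/
noncomputable def nop (j k : ℤ) : Module.End ℂ W :=
  if k ≤ 0 then S.ϑ j * S.ϖ k else -(S.ϖ k * S.ϑ j)

/-- The coefficient `s` of the bilinear expression `∑ f(j) :ϑ_j ϖ_{s-j}:`. -/
noncomputable def N (f : ℤ → ℂ) (s : ℤ) : Module.End ℂ W :=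
  locSum fun j => f j • S.nop j (s - j)

theorem locFinite_N (f : ℤ → ℂ) (s : ℤ) : LocFinite fun j => f j • S.nop j (s - j) := by
  refine LocFinite.smul (.of_bounds fun w => ?_) f
  obtain ⟨J, hJ⟩ := S.smooth_ϑ w
  obtain ⟨K, hK⟩ := S.smooth_ϖ w
  -- The order changes at j = s. Below it ϑ_j acts first and vanishes for small j; from s on ϖ_{s-j}
  -- acts first and vanishes for large j.
  refine ⟨min J s, max (s - K) s, fun j hj => ?_, fun j hj => ?_⟩
  · rw [nop, if_neg (by omega), LinearMap.neg_apply, Module.End.mul_apply, hJ j (by omega),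
      map_zero, neg_zero]
  · rw [nop, if_pos (by omega), Module.End.mul_apply, hK _ (by omega), map_zero]

theorem hasCharge_nop (j k : ℤ) : S.HasCharge 0 (S.nop j k) := by
  unfold nop
  split_ifs
  · exact (S.hasCharge_ϑ _).mul (S.hasCharge_ϖ _)
  · exact ((S.hasCharge_ϖ _).mul (S.hasCharge_ϑ _)).neg

theorem hasCharge_N (f : ℤ → ℂ) (s : ℤ) : S.HasCharge 0 (S.N f s) :=
  .locSum (S.locFinite_N f s) fun _ => (S.hasCharge_nop _ _).smul _

theorem cm_N_of_semiconj {B : Module.End ℂ W} {r : ℂ} (hr : r * r = 1)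
    (h : ∀ j, B * S.ϑ j = r • (S.ϑ j * B)) (h' : ∀ j, B * S.ϖ j = r • (S.ϖ j * B))
    (f : ℤ → ℂ) (s : ℤ) : cm B (S.N f s) = 0 := by
  rw [cm_eq_zero, N, locSum_semiconj (S.locFinite_N f s) B 1, one_smul]
  intro i
  have h1 (j k : ℤ) : B * (S.ϑ j * S.ϖ k) = S.ϑ j * S.ϖ k * B := by
    rw [← mul_assoc, h, smul_mul_assoc, mul_assoc, h', mul_smul_comm, smul_smul, hr,
      one_smul, mul_assoc]
  have h2 (j k : ℤ) : B * (S.ϖ k * S.ϑ j) = S.ϖ k * S.ϑ j * B := by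
    rw [← mul_assoc, h', smul_mul_assoc, mul_assoc, h, mul_smul_comm, smul_smul, hr,
      one_smul, mul_assoc]
  rw [one_smul, mul_smul_comm, smul_mul_assoc]
  unfold nop
  split_ifs
  · rw [h1]
  · rw [mul_neg, h2, neg_mul]

theorem cm_L_N (n : ℤ) (f : ℤ → ℂ) (s : ℤ) : cm (S.L n) (S.N f s) = 0 :=
  S.cm_N_of_semiconj (r := 1) (by norm_num) (fun j => by
    rw [one_smul]; exact cm_eq_zero.mp (S.L_ϑ n j)) (fun j => by
    rw [one_smul]; exact cm_eq_zero.mp (S.L_ϖ n j)) f s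

theorem cm_T_N (μ ν : ZMod 2) (n : ℤ) (f : ℤ → ℂ) (s : ℤ) : cm (S.T μ ν n) (S.N f s) = 0 :=
  S.cm_N_of_semiconj (sg_mul_self _) (fun j => S.T_ϑ μ ν n j) (fun j => S.T_ϖ μ ν n j) f s

/-- The two orderings differ by a scalar, so the choice is invisible to commutators. It matters only
for vacuum components, where the anomalies originate. -/
theorem cm_nop_ϑ (j k l : ℤ) : cm (S.nop j k) (S.ϑ l) = kron (k + l) • S.ϑ j := by
  have h1 : cm (S.ϑ j * S.ϖ k) (S.ϑ l)
      = S.ϑ j * ac (S.ϖ k) (S.ϑ l) - ac (S.ϑ j) (S.ϑ l) * S.ϖ k := by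
    simp only [cm_apply, ac_apply]; noncomm_ring
  have h2 : cm (-(S.ϖ k * S.ϑ j)) (S.ϑ l)
      = ac (S.ϖ k) (S.ϑ l) * S.ϑ j - S.ϖ k * ac (S.ϑ j) (S.ϑ l) := by
    simp only [cm_apply, ac_apply]; noncomm_ring
  unfold nop
  split_ifs
  · rw [h1, S.ϖ_ϑ, S.ϑ_ϑ]; simp
  · rw [h2, S.ϖ_ϑ, S.ϑ_ϑ]; simp

theorem cm_nop_ϖ (j k l : ℤ) : cm (S.nop j k) (S.ϖ l) = -(kron (j + l) • S.ϖ k) := by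
  have h1 : cm (S.ϑ j * S.ϖ k) (S.ϖ l)
      = S.ϑ j * ac (S.ϖ k) (S.ϖ l) - ac (S.ϑ j) (S.ϖ l) * S.ϖ k := by
    simp only [cm_apply, ac_apply]; noncomm_ring
  have h2 : cm (-(S.ϖ k * S.ϑ j)) (S.ϖ l)
      = ac (S.ϖ k) (S.ϖ l) * S.ϑ j - S.ϖ k * ac (S.ϑ j) (S.ϖ l) := by
    simp only [cm_apply, ac_apply]; noncomm_ring
  unfold nop
  split_ifs
  · rw [h1, S.ϖ_ϖ, S.ϑ_ϖ]; simp
  · rw [h2, S.ϖ_ϖ, S.ϑ_ϖ]; simp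

theorem cm_N_ϑ (f : ℤ → ℂ) (s k : ℤ) :
    cm (S.N f s) (S.ϑ k) = f (s + k) • S.ϑ (s + k) := by
  rw [N, cm_locSum (S.locFinite_N f s)]
  simp only [map_smul, LinearMap.smul_apply, cm_nop_ϑ, smul_smul]
  rw [locSum_eq_single (s + k), show s - (s + k) + k = 0 by ring, kron_zero, mul_one]
  intro j hj
  rw [kron_of_ne (by omega), mul_zero, zero_smul]

theorem cm_N_ϖ (f : ℤ → ℂ) (s k : ℤ) :
    cm (S.N f s) (S.ϖ k) = -(f (-k) • S.ϖ (s + k)) := by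
  rw [N, cm_locSum (S.locFinite_N f s)]
  simp only [map_smul, LinearMap.smul_apply, cm_nop_ϖ, smul_smul, smul_neg]
  rw [locSum_eq_single (-k), neg_add_cancel, kron_zero, mul_one, show s - -k = s + k by ring]
  intro j hj
  rw [kron_of_ne (by omega), mul_zero, zero_smul, neg_zero]

/-! #### Products of `ϑ` with a field -/

/-- The modes of the product of `ϑ` with a field `X`. -/
noncomputable def ϑX (X : OpField W) (s : ℤ) : Module.End ℂ W := locSum fun j => S.ϑ j * X (s - j)

variable {S}

theorem locFinite_ϑX {X : OpField W} (hX : X.Smooth) {r : ℂ}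
    (h : ∀ j k, S.ϑ j * X k = r • (X k * S.ϑ j)) (s : ℤ) :
    LocFinite fun j => S.ϑ j * X (s - j) :=
  (S.smooth_ϑ.absorbs r h).mulDefined hX s

variable (S)

theorem locFinite_ϑL (s : ℤ) : LocFinite fun j => S.ϑ j * S.L (s - j) :=
  locFinite_ϑX S.smooth_field_L (r := 1) (fun j k => by
    rw [one_smul]; exact (cm_eq_zero.mp (S.L_ϑ k j)).symm) s

theorem locFinite_ϑT (μ ν : ZMod 2) (s : ℤ) : LocFinite fun j => S.ϑ j * S.T μ ν (s - j) :=
  locFinite_ϑX (S.smooth_field_T μ ν) (r := sg (μ + ν)) (fun j k => by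
    rw [S.T_ϑ, smul_smul, sg_mul_self, one_smul]) s

theorem hasCharge_ϑL (s : ℤ) : S.HasCharge 1 (S.ϑX S.L s) :=
  .locSum (S.locFinite_ϑL s) fun _ => (S.hasCharge_ϑ _).mul (S.hasCharge_L _)

theorem hasCharge_ϑT (μ ν : ZMod 2) (s : ℤ) : S.HasCharge 1 (S.ϑX (S.T μ ν) s) :=
  .locSum (S.locFinite_ϑT μ ν s) fun _ => (S.hasCharge_ϑ _).mul (S.hasCharge_T _ _ _)

theorem ac_ϑL_ϑ (s k : ℤ) : ac (S.ϑX S.L s) (S.ϑ k) = 0 := by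
  have (j : ℤ) : ac (S.ϑ j * S.L (s - j)) (S.ϑ k)
      = S.ϑ j * cm (S.L (s - j)) (S.ϑ k) + ac (S.ϑ j) (S.ϑ k) * S.L (s - j) := by
    simp only [cm_apply, ac_apply]; noncomm_ring
  rw [ϑX, ac_locSum (S.locFinite_ϑL s)]
  simp only [this, S.L_ϑ, S.ϑ_ϑ, mul_zero, zero_mul, add_zero, locSum_zero]

/-- The mode ϖ_k acts as a derivative with respect to ϑ_{-k}: it strips the fermion and leaves one
mode of the other factor. -/
theorem ac_ϑL_ϖ (s k : ℤ) : ac (S.ϑX S.L s) (S.ϖ k) = S.L (s + k) := by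
  have (j : ℤ) : ac (S.ϑ j * S.L (s - j)) (S.ϖ k)
      = S.ϑ j * cm (S.L (s - j)) (S.ϖ k) + ac (S.ϑ j) (S.ϖ k) * S.L (s - j) := by
    simp only [cm_apply, ac_apply]; noncomm_ring
  rw [ϑX, ac_locSum (S.locFinite_ϑL s)]
  simp only [this, S.L_ϖ, S.ϑ_ϖ, mul_zero, zero_add, smul_mul_assoc, one_mul]
  rw [locSum_eq_single (-k), neg_add_cancel, kron_zero, one_smul, sub_neg_eq_add]
  intro j hj
  rw [kron_of_ne (by omega), zero_smul]

theorem ac_ϑT00_ϑ (s k : ℤ) : ac (S.ϑX (S.T 0 0) s) (S.ϑ k) = 0 := by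
  have (j : ℤ) : ac (S.ϑ j * S.T 0 0 (s - j)) (S.ϑ k)
      = S.ϑ j * cm (S.T 0 0 (s - j)) (S.ϑ k) + ac (S.ϑ j) (S.ϑ k) * S.T 0 0 (s - j) := by
    simp only [cm_apply, ac_apply]; noncomm_ring
  rw [ϑX, ac_locSum (S.locFinite_ϑT 0 0 s)]
  simp only [this, S.T_ϑ_even, S.ϑ_ϑ, mul_zero, zero_mul, add_zero, locSum_zero]

theorem ac_ϑT00_ϖ (s k : ℤ) : ac (S.ϑX (S.T 0 0) s) (S.ϖ k) = S.T 0 0 (s + k) := by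
  have (j : ℤ) : ac (S.ϑ j * S.T 0 0 (s - j)) (S.ϖ k)
      = S.ϑ j * cm (S.T 0 0 (s - j)) (S.ϖ k) + ac (S.ϑ j) (S.ϖ k) * S.T 0 0 (s - j) := by
    simp only [cm_apply, ac_apply]; noncomm_ring
  rw [ϑX, ac_locSum (S.locFinite_ϑT 0 0 s)]
  simp only [this, S.T_ϖ_even, S.ϑ_ϖ, mul_zero, zero_add, smul_mul_assoc, one_mul]
  rw [locSum_eq_single (-k), neg_add_cancel, kron_zero, one_smul, sub_neg_eq_add]
  intro j hj
  rw [kron_of_ne (by omega), zero_smul]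

theorem cm_ϑT01_ϑ (s k : ℤ) : cm (S.ϑX (S.T 0 1) s) (S.ϑ k) = 0 := by
  have (j : ℤ) : cm (S.ϑ j * S.T 0 1 (s - j)) (S.ϑ k)
      = S.ϑ j * ac (S.T 0 1 (s - j)) (S.ϑ k) - ac (S.ϑ j) (S.ϑ k) * S.T 0 1 (s - j) := by
    simp only [cm_apply, ac_apply]; noncomm_ring
  rw [ϑX, cm_locSum (S.locFinite_ϑT 0 1 s)]
  simp only [this, S.T_ϑ_odd (show (0 : ZMod 2) + 1 = 1 from rfl), S.ϑ_ϑ, mul_zero, zero_mul,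
    sub_zero, locSum_zero]

theorem cm_ϑT01_ϖ (s k : ℤ) : cm (S.ϑX (S.T 0 1) s) (S.ϖ k) = -S.T 0 1 (s + k) := by
  have (j : ℤ) : cm (S.ϑ j * S.T 0 1 (s - j)) (S.ϖ k)
      = S.ϑ j * ac (S.T 0 1 (s - j)) (S.ϖ k) - ac (S.ϑ j) (S.ϖ k) * S.T 0 1 (s - j) := by
    simp only [cm_apply, ac_apply]; noncomm_ring
  rw [ϑX, cm_locSum (S.locFinite_ϑT 0 1 s)]
  simp only [this, S.T_ϖ_odd (show (0 : ZMod 2) + 1 = 1 from rfl), S.ϑ_ϖ, mul_zero, zero_sub,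
    smul_mul_assoc, one_mul]
  rw [locSum_eq_single (-k), neg_add_cancel, kron_zero, one_smul, sub_neg_eq_add]
  intro j hj
  rw [kron_of_ne (by omega), zero_smul, neg_zero]

theorem cm_ϑT01_T01 (s k : ℤ) : cm (S.ϑX (S.T 0 1) s) (S.T 0 1 k) = 0 := by
  have (j : ℤ) : cm (S.ϑ j * S.T 0 1 (s - j)) (S.T 0 1 k)
      = S.ϑ j * ac (S.T 0 1 (s - j)) (S.T 0 1 k) - ac (S.T 0 1 k) (S.ϑ j) * S.T 0 1 (s - j) := by
    simp only [cm_apply, ac_apply]; noncomm_ring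
  rw [ϑX, cm_locSum (S.locFinite_ϑT 0 1 s)]
  simp only [this, S.T_ϑ_odd (show (0 : ZMod 2) + 1 = 1 from rfl), S.ac_T01_T01, mul_zero,
    zero_mul, sub_zero, locSum_zero]

/-! #### The expressions `U`, `V`, `W` and the cubic part of `G` -/

/-- `U_s = ∑ j ϑ_j ϑ_{s-j}`. -/
noncomputable def U (s : ℤ) : Module.End ℂ W := S.Q (fun j => j) s

/-- `V_s = -∑ j² (s-j) ϑ_j ϑ_{s-j}`. -/
noncomputable def V' (s : ℤ) : Module.End ℂ W := S.Q (fun j => -((j : ℂ) ^ 2 * (s - j))) s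

theorem cm_U_ϖ (s k : ℤ) : cm (S.U s) (S.ϖ k) = ((s : ℂ) + 2 * k) • S.ϑ (s + k) := by
  rw [U, S.cm_Q_ϖ]
  push_cast
  module

theorem cm_V_ϖ (s k : ℤ) :
    cm (S.V' s) (S.ϖ k) = ((k : ℂ) * (s + k) * (s + 2 * k)) • S.ϑ (s + k) := by
  rw [V', S.cm_Q_ϖ]
  push_cast
  module

/-- `W_m = -∑ V_j ϑ_{m-j}`. -/
noncomputable def Wop (m : ℤ) : Module.End ℂ W := -locSum fun j => S.V' j * S.ϑ (m - j)

/-- The cubic part of `G_m`, the normal ordered sum of `U_j ϖ_{m-j}`. -/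
noncomputable def C (m : ℤ) : Module.End ℂ W :=
  locSum fun j => if m - j ≤ 0 then S.U j * S.ϖ (m - j) else S.ϖ (m - j) * S.U j

theorem smooth_Q (f : ℤ → ℤ → ℂ) : OpField.Smooth fun s => S.Q (f s) s := fun w => by
  obtain ⟨J, hJ⟩ := S.absorbs_ϑ_ϑ w
  obtain ⟨K, hK⟩ := S.smooth_ϑ w
  refine ⟨J + K, fun s hs => ?_⟩
  change S.Q (f s) s w = 0
  rw [Q, locSum_apply (S.locFinite_Q _ _)]
  refine finsum_eq_zero_of_forall_eq_zero fun j => ?_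
  rw [LinearMap.smul_apply, Module.End.mul_apply]
  by_cases hj : j < J
  · rw [hJ j hj, smul_zero]
  · rw [hK _ (by omega), map_zero, smul_zero]

theorem smooth_U : OpField.Smooth S.U := S.smooth_Q fun _ j => j

theorem smooth_V : OpField.Smooth S.V' := S.smooth_Q fun s j => -((j : ℂ) ^ 2 * (s - j))

theorem locFinite_W (m : ℤ) : LocFinite fun j => S.V' j * S.ϑ (m - j) :=
  (S.smooth_V.absorbs 1 fun j k => by
    rw [one_smul]; exact cm_eq_zero.mp (S.cm_Q_ϑ _ _ _)).mulDefined S.smooth_ϑ m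

theorem locFinite_C (m : ℤ) : LocFinite fun j =>
    if m - j ≤ 0 then S.U j * S.ϖ (m - j) else S.ϖ (m - j) * S.U j := by
  refine .of_bounds fun w => ?_
  obtain ⟨J, hJ⟩ := S.smooth_U w
  obtain ⟨K, hK⟩ := S.smooth_ϖ w
  refine ⟨min J m, max (m - K) m, fun j hj => ?_, fun j hj => ?_⟩
  · rw [if_neg (by omega), Module.End.mul_apply, hJ j (by omega), map_zero]
  · rw [if_pos (by omega), Module.End.mul_apply, hK _ (by omega), map_zero]

theorem hasCharge_U (s : ℤ) : S.HasCharge 2 (S.U s) := S.hasCharge_Q _ _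

theorem hasCharge_V (s : ℤ) : S.HasCharge 2 (S.V' s) := S.hasCharge_Q _ _

theorem hasCharge_W (s : ℤ) : S.HasCharge 3 (S.Wop s) :=
  (HasCharge.locSum (S.locFinite_W s) fun _ => (S.hasCharge_V _).mul (S.hasCharge_ϑ _)).neg

theorem hasCharge_C (s : ℤ) : S.HasCharge 1 (S.C s) := by
  refine .locSum (S.locFinite_C s) fun j => ?_
  split_ifs
  · exact (S.hasCharge_U _).mul (S.hasCharge_ϖ _)
  · exact (S.hasCharge_ϖ _).mul (S.hasCharge_U _)

theorem cm_U_ϑ (s k : ℤ) : cm (S.U s) (S.ϑ k) = 0 := S.cm_Q_ϑ _ _ _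

theorem cm_V_ϑ (s k : ℤ) : cm (S.V' s) (S.ϑ k) = 0 := S.cm_Q_ϑ _ _ _

theorem ac_W_ϑ (s k : ℤ) : ac (S.Wop s) (S.ϑ k) = 0 := by
  have (j : ℤ) : ac (S.V' j * S.ϑ (s - j)) (S.ϑ k)
      = S.V' j * ac (S.ϑ (s - j)) (S.ϑ k) - cm (S.V' j) (S.ϑ k) * S.ϑ (s - j) := by
    simp only [cm_apply, ac_apply]; noncomm_ring
  rw [Wop, map_neg, LinearMap.neg_apply, ac_locSum (S.locFinite_W s)]
  simp only [this, S.ϑ_ϑ, S.cm_V_ϑ, mul_zero, zero_mul, sub_zero, locSum_zero, neg_zero]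

/-- The modes ϑ anticommute strictly, so the symmetric part of the coefficients under j ↦ s - j
drops out. Rigidity replaces a resummation: both sides raise the charge by 2 and have the same
commutators with ϑ and ϖ. -/
theorem Q_congr (f g : ℤ → ℂ) (s : ℤ)
    (h : ∀ k, f (s + k) - f (-k) = g (s + k) - g (-k)) : S.Q f s = S.Q g s := by
  refine sub_eq_zero.mp (eq_zero_of_cm_of_raising (S := S) (fun k => ?_) (fun k => ?_) ?_)
  · simp only [map_sub, LinearMap.sub_apply, S.cm_Q_ϑ, sub_zero]
  · simp only [map_sub, LinearMap.sub_apply, S.cm_Q_ϖ, h, sub_self]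
  · exact Submodule.sub_mem _ ((S.hasCharge_Q f s).mem_raising (by norm_num))
      ((S.hasCharge_Q g s).mem_raising (by norm_num))

theorem Q_smul (r : ℂ) (f : ℤ → ℂ) (s : ℤ) : S.Q (fun j => r * f j) s = r • S.Q f s := by
  rw [Q, Q, ← locSum_smul (S.locFinite_Q f s)]
  simp only [smul_smul]

theorem ac_W_ϖ (s k : ℤ) : ac (S.Wop s) (S.ϖ k)
    = -S.V' (s + k) + ((k : ℂ) * (s + 2 * k)) • S.U (s + k) := by
  have h (j : ℤ) : ac (S.V' j * S.ϑ (s - j)) (S.ϖ k) = kron (s - j + k) • S.V' j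
      - ((k : ℂ) * (j + k) * (j + 2 * k)) • (S.ϑ (j + k) * S.ϑ (s - j)) := by
    have : ac (S.V' j * S.ϑ (s - j)) (S.ϖ k)
        = S.V' j * ac (S.ϑ (s - j)) (S.ϖ k) - cm (S.V' j) (S.ϖ k) * S.ϑ (s - j) := by
      simp only [cm_apply, ac_apply]; noncomm_ring
    rw [this, S.ϑ_ϖ, S.cm_V_ϖ, mul_smul_comm, mul_one, smul_mul_assoc]
  -- The terms in which ϖ_k hits V_j form, after the shift i = j + k, a bilinear sum with
  -- coefficients k i (i + k). Antisymmetrized over total index s + k, these agree with k (s + 2k)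
  -- i, which gives a multiple of U.
  have hQ := S.locFinite_Q (fun i => (k : ℂ) * i * (i + k)) (s + k)
  have hQ' := hQ.comp_equiv (Equiv.addRight k)
  have hsum := locSum_shift hQ k
  have e (j : ℤ) : ((k : ℂ) * ((j + k : ℤ) : ℂ) * (((j + k : ℤ) : ℂ) + k)) •
      (S.ϑ (j + k) * S.ϑ (s + k - (j + k)))
      = ((k : ℂ) * (j + k) * (j + 2 * k)) • (S.ϑ (j + k) * S.ϑ (s - j)) := by
    rw [show s + k - (j + k) = s - j by ring]
    congr 1
    push_cast; ring
  simp only [Equiv.coe_addRight, e] at hQ' hsum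
  have hz (j : ℤ) (hj : j ≠ s + k) : kron (s - j + k) • S.V' j = 0 := by
    rw [kron_of_ne (by omega), zero_smul]
  rw [Wop, map_neg, LinearMap.neg_apply, ac_locSum (S.locFinite_W s)]
  simp only [h]
  rw [locSum_sub (.of_single _ hz) hQ', hsum, locSum_eq_single (s + k) hz,
    show s - (s + k) + k = 0 by ring, kron_zero, one_smul, ← Q,
    S.Q_congr _ (fun j => ((k : ℂ) * (s + 2 * k)) * (j : ℂ)), S.Q_smul, U]
  · abel
  · intro l
    push_cast
    ring

theorem ac_C_ϑ (s k : ℤ) : ac (S.C s) (S.ϑ k) = S.U (s + k) := by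
  have (j : ℤ) : ac (if s - j ≤ 0 then S.U j * S.ϖ (s - j) else S.ϖ (s - j) * S.U j) (S.ϑ k)
      = kron (s - j + k) • S.U j := by
    have h1 : ac (S.U j * S.ϖ (s - j)) (S.ϑ k)
        = S.U j * ac (S.ϖ (s - j)) (S.ϑ k) - cm (S.U j) (S.ϑ k) * S.ϖ (s - j) := by
      simp only [cm_apply, ac_apply]; noncomm_ring
    have h2 : ac (S.ϖ (s - j) * S.U j) (S.ϑ k)
        = S.ϖ (s - j) * cm (S.U j) (S.ϑ k) + ac (S.ϖ (s - j)) (S.ϑ k) * S.U j := by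
      simp only [cm_apply, ac_apply]; noncomm_ring
    split_ifs
    · rw [h1, S.ϖ_ϑ, S.cm_U_ϑ]; simp
    · rw [h2, S.ϖ_ϑ, S.cm_U_ϑ]; simp
  rw [C, ac_locSum (S.locFinite_C s)]
  simp only [this]
  rw [locSum_eq_single (s + k), show s - (s + k) + k = 0 by ring, kron_zero, one_smul]
  intro j hj
  rw [kron_of_ne (by omega), zero_smul]

/-- ϖ_k contracts with U_j only, which leaves one ϑ. The cutoff s - j ≤ 0 depends only on the other
ϖ, so the remaining product is already normal ordered and no correction arises. -/
theorem ac_C_ϖ (s k : ℤ) : ac (S.C s) (S.ϖ k) = -S.N (fun j => (j : ℂ) + k) (s + k) := by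
  have h (j : ℤ) : ac (if s - j ≤ 0 then S.U j * S.ϖ (s - j) else S.ϖ (s - j) * S.U j) (S.ϖ k)
      = -(((j : ℂ) + 2 * k) • S.nop (j + k) (s - j)) := by
    have h1 : ac (S.U j * S.ϖ (s - j)) (S.ϖ k)
        = S.U j * ac (S.ϖ (s - j)) (S.ϖ k) - cm (S.U j) (S.ϖ k) * S.ϖ (s - j) := by
      simp only [cm_apply, ac_apply]; noncomm_ring
    have h2 : ac (S.ϖ (s - j) * S.U j) (S.ϖ k)
        = S.ϖ (s - j) * cm (S.U j) (S.ϖ k) + ac (S.ϖ (s - j)) (S.ϖ k) * S.U j := by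
      simp only [cm_apply, ac_apply]; noncomm_ring
    unfold nop
    split_ifs
    · rw [h1, S.ϖ_ϖ, S.cm_U_ϖ]; simp
    · rw [h2, S.ϖ_ϖ, S.cm_U_ϖ]; simp
  have hN := S.locFinite_N (fun j => (j : ℂ) + k) (s + k)
  have hN' := hN.comp_equiv (Equiv.addRight k)
  have hsum := locSum_shift hN k
  have e (j : ℤ) : (((j + k : ℤ) : ℂ) + k) • S.nop (j + k) (s + k - (j + k))
      = ((j : ℂ) + 2 * k) • S.nop (j + k) (s - j) := by
    rw [show s + k - (j + k) = s - j by ring]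
    congr 1
    push_cast; ring
  simp only [Equiv.coe_addRight, e] at hN' hsum
  rw [C, ac_locSum (S.locFinite_C s)]
  simp only [h]
  have := locSum_smul hN' (-1)
  simp only [neg_one_smul] at this
  rw [this, hsum, N]

end FermiModule

namespace FermiModule

variable {c k₁ k₂ : ℂ} {W V : Type*} [AddCommGroup W] [Module ℂ W] [AddCommGroup V] [Module ℂ V]
  (S : FermiModule c k₁ k₂ W V)

/-! #### The algebra of the normal ordered bilinear expressions -/

/-- The right factor creates a pair from the vacuum only if both its modes are creation modes, that
is 0 ≤ j < t. The left factor must annihilate that pair again, which requires s + t = 0. This finite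
sum is the source of the fermionic anomalies. -/
theorem vacuum_N_N (f g : ℤ → ℂ) (s t : ℤ) (v : V) :
    S.vacL ((S.N f s * S.N g t) (S.vac v))
      = (kron (s + t) * ∑ j ∈ Finset.Ico 0 t, g j * f (j - t)) • v := by
  have h (j : ℤ) : S.vacL (S.N f s ((g j • S.nop j (t - j)) (S.vac v)))
      = if j ∈ Finset.Ico 0 t then (kron (s + t) * (g j * f (j - t))) • v else 0 := by
    rw [LinearMap.smul_apply, map_smul, map_smul]
    unfold nop
    by_cases h1 : t - j ≤ 0
    · rw [if_pos h1, if_neg (by simp; omega), Module.End.mul_apply, S.ϖ_vac _ h1, map_zero,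
        map_zero, map_zero, smul_zero]
    by_cases h2 : j < 0
    · rw [if_neg h1, if_neg (by simp; omega), LinearMap.neg_apply, Module.End.mul_apply,
        S.ϑ_vac _ h2, map_zero, neg_zero, map_zero, map_zero, smul_zero]
    rw [if_neg h1, if_pos (by simp; omega)]
    have e : S.N f s * (S.ϖ (t - j) * S.ϑ j)
        = S.ϖ (t - j) * (S.N f s * S.ϑ j) + cm (S.N f s) (S.ϖ (t - j)) * S.ϑ j := by
      simp only [cm_apply]; noncomm_ring
    have e' : S.ϖ (s + (t - j)) * S.ϑ j = kron (s + t) • 1 - S.ϑ j * S.ϖ (s + (t - j)) := by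
      have := S.ϖ_ϑ (s + (t - j)) j
      rw [show s + (t - j) + j = s + t by ring] at this
      rw [← this, ac_apply]; abel
    rw [S.cm_N_ϖ, neg_mul, smul_mul_assoc, e', show -(t - j) = j - t by ring] at e
    have e2 := congrArg (fun A => S.vacL (A (S.vac v))) e
    simp only [Module.End.mul_apply, LinearMap.add_apply, LinearMap.neg_apply,
      LinearMap.smul_apply, LinearMap.sub_apply, Module.End.one_apply, map_add, map_neg, map_smul,
      map_sub, S.vacL_vac] at e2
    rw [S.vacL_ϖ _ (by omega), S.vacL_ϑ _ (by omega)] at e2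
    rw [LinearMap.neg_apply, Module.End.mul_apply, map_neg, map_neg, e2]
    module
  rw [Module.End.mul_apply]
  conv_lhs => rw [N.eq_def S g, locSum_apply (S.locFinite_N g t)]
  rw [map_finsum _ (S.locFinite_N g t _), map_finsum]
  · rw [finsum_congr h, finsum_eq_sum_of_support_subset (s := Finset.Ico 0 t), Finset.mul_sum,
      Finset.sum_smul]
    · exact Finset.sum_congr rfl fun j hj => if_pos hj
    · intro j hj
      by_contra h'
      exact hj (if_neg h')
  · refine (S.locFinite_N g t (S.vac v)).subset fun j hj h0 => hj ?_
    exact (congrArg (S.N f s) h0).trans (map_zero _)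

theorem vacuum_N (f : ℤ → ℂ) (s : ℤ) (v : V) : S.vacL (S.N f s (S.vac v)) = 0 := by
  rw [N, locSum_apply (S.locFinite_N f s), map_finsum _ (S.locFinite_N f s _)]
  refine finsum_eq_zero_of_forall_eq_zero fun j => ?_
  rw [LinearMap.smul_apply, map_smul]
  unfold nop
  split_ifs with h
  · rw [Module.End.mul_apply, S.ϖ_vac _ h, map_zero, map_zero, smul_zero]
  · rw [LinearMap.neg_apply, Module.End.mul_apply, map_neg, S.vacL_ϖ _ (by omega), neg_zero,
      smul_zero]

/-- The action on the modes fixes the commutator up to an operator commuting with all of them.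
Single bilinears have no vacuum component, so the central term is the difference of the vacuum
components of the two products. -/
theorem cm_N_N (f g : ℤ → ℂ) (s t : ℤ) : cm (S.N f s) (S.N g t)
    = S.N (fun j => f j * g (j - s) - g j * f (j - t)) (s + t)
      + (kron (s + t) * (∑ j ∈ Finset.Ico 0 t, g j * f (j - t)
          - ∑ j ∈ Finset.Ico 0 s, f j * g (j - s))) • 1 := by
  rw [← sub_eq_zero]
  refine S.eq_zero_of_cm _ (fun k => ?_) (fun k => ?_) (fun v => ?_)
  · simp only [map_sub, map_add, map_smul, LinearMap.sub_apply, LinearMap.add_apply,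
      LinearMap.smul_apply, cm_cm, cm_N_ϑ, cm_one_left]
    rw [show s + (t + k) = s + t + k by ring, show t + (s + k) = s + t + k by ring,
      show s + t + k - s = t + k by ring, show s + t + k - t = s + k by ring]
    module
  · simp only [map_sub, map_add, map_smul, map_neg, LinearMap.sub_apply, LinearMap.add_apply,
      LinearMap.smul_apply, cm_cm, cm_N_ϖ, cm_one_left]
    rw [show s + (t + k) = s + t + k by ring, show t + (s + k) = s + t + k by ring,
      show -k - s = -(s + k) by ring, show -k - t = -(t + k) by ring]
    module
  · have h1 := S.vacuum_N_N f g s t v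
    have h2 := S.vacuum_N_N g f t s v
    rw [cm_apply]
    simp only [LinearMap.sub_apply, LinearMap.add_apply, LinearMap.smul_apply,
      Module.End.one_apply, map_sub, map_add, map_smul, S.vacuum_N, S.vacL_vac, h1, h2,
      add_comm t s]
    module

/-- Telescoping with a discrete antiderivative G; for the polynomial coefficients below, G is
written down explicitly. -/
theorem sum_Ico_zero (F G : ℤ → ℂ) (h0 : G 0 = 0) (h : ∀ t, G (t + 1) = G t + F t) {t : ℤ}
    (ht : 0 ≤ t) : ∑ j ∈ Finset.Ico 0 t, F j = G t := by
  induction t, ht using Int.leInduction with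
  | base => simp [h0]
  | succ t ht ih =>
    have : Finset.Ico 0 (t + 1) = insert t (Finset.Ico 0 t) := by
      ext j; simp only [Finset.mem_Ico, Finset.mem_insert]; omega
    rw [this, Finset.sum_insert (by simp), ih, h, add_comm]

/-- `∑ :ϑ_j ϖ_{s-j}:`. -/
noncomputable def N0 (s : ℤ) : Module.End ℂ W := S.N (fun _ => 1) s

/-- `∑ j :ϑ_j ϖ_{s-j}:`. -/
noncomputable def N1 (s : ℤ) : Module.End ℂ W := S.N (fun j => j) s

theorem N_add (f g : ℤ → ℂ) (s : ℤ) : S.N (fun j => f j + g j) s = S.N f s + S.N g s := by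
  rw [N, N, N, ← locSum_add (S.locFinite_N f s) (S.locFinite_N g s)]
  simp only [add_smul]

theorem N_smul (r : ℂ) (f : ℤ → ℂ) (s : ℤ) : S.N (fun j => r * f j) s = r • S.N f s := by
  rw [N, N, ← locSum_smul (S.locFinite_N f s)]
  simp only [smul_smul]

theorem N_affine (x y : ℂ) (s : ℤ) :
    S.N (fun j => y * j + x) s = y • S.N1 s + x • S.N0 s := by
  have h := S.N_smul x (fun _ => 1) s
  simp only [mul_one] at h
  rw [S.N_add (fun j => y * j), S.N_smul y (fun j => j), h, N0, N1]

theorem kron_mul_eq {s t : ℤ} {x y : ℂ} (h : s + t = 0 → x = y) :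
    kron (s + t) * x = kron (s + t) * y := by
  by_cases h0 : s + t = 0
  · rw [h h0]
  · rw [kron_of_ne h0, zero_mul, zero_mul]

theorem cm_N0_N0 (s t : ℤ) : cm (S.N0 s) (S.N0 t) = (kron (s + t) * t) • 1 := by
  rw [N0, N0, S.cm_N_N, kron_mul_eq (y := (t : ℂ))]
  · have := S.N_affine 0 0 (s + t)
    simp only [zero_mul, add_zero, zero_smul] at this
    simp only [mul_one, sub_self, this, zero_add]
  · intro h
    obtain rfl : s = -t := by omega
    -- As s = -t, at most one of the two summation ranges is nonempty, and both signs give the same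
    -- polynomial.
    rcases le_total 0 t with ht | ht
    · rw [Finset.Ico_eq_empty (a := 0) (b := -t) (by omega), Finset.sum_empty,
        sum_Ico_zero _ (fun t => (t : ℂ)) (by simp) (fun t => by push_cast; ring) ht, sub_zero]
    · rw [Finset.Ico_eq_empty (a := 0) (b := t) (by omega), Finset.sum_empty,
        sum_Ico_zero _ (fun t => (t : ℂ)) (by simp) (fun t => by push_cast; ring)
          (show 0 ≤ -t by omega)]
      push_cast; ring

/-- The charge current is not primary for `N1`: ordering relative to a vacuum annihilated by ϖ_0 but
not by ϑ_0 produces the anomaly t(t + 1)/2. -/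
theorem cm_N1_N0 (s t : ℤ) : cm (S.N1 s) (S.N0 t)
    = (t : ℂ) • S.N0 (s + t) - (kron (s + t) * ((t : ℂ) * (t + 1) / 2)) • 1 := by
  rw [N0, N1, S.cm_N_N, kron_mul_eq (y := -((t : ℂ) * (t + 1) / 2))]
  · have := S.N_affine t 0 (s + t)
    simp only [zero_mul, zero_add, zero_smul] at this
    rw [← this]
    have e : (fun j : ℤ => (j : ℂ) * 1 - 1 * ((j - t : ℤ) : ℂ)) = fun _ => (t : ℂ) := by
      ext j; push_cast; ring
    rw [e]
    module
  · intro h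
    obtain rfl : s = -t := by omega
    rcases le_total 0 t with ht | ht
    · rw [Finset.Ico_eq_empty (a := 0) (b := -t) (by omega), Finset.sum_empty,
        sum_Ico_zero _ (fun x => (x : ℂ) * (x - 1) / 2 - t * x) (by simp)
          (fun t => by push_cast; ring) ht, sub_zero]
      ring
    · rw [Finset.Ico_eq_empty (a := 0) (b := t) (by omega), Finset.sum_empty,
        sum_Ico_zero _ (fun x => (x : ℂ) * (x - 1) / 2) (by simp)
          (fun t => by push_cast; ring) (show 0 ≤ -t by omega)]
      push_cast; ring

/-- A Virasoro algebra with central charge -2, as for a fermionic pair of weights 0 and 1. This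
accounts for c - 2 in the realized parameters. -/
theorem cm_N1_N1 (s t : ℤ) : cm (S.N1 s) (S.N1 t)
    = ((t : ℂ) - s) • S.N1 (s + t) - (kron (s + t) * (((t : ℂ) ^ 3 - t) / 6)) • 1 := by
  rw [N1, N1, S.cm_N_N, kron_mul_eq (y := -(((t : ℂ) ^ 3 - t) / 6))]
  · have := S.N_affine 0 ((t : ℂ) - s) (s + t)
    simp only [add_zero, zero_smul] at this
    rw [← this]
    have e : (fun j : ℤ => (j : ℂ) * ((j - s : ℤ) : ℂ) - j * ((j - t : ℤ) : ℂ))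
        = fun j : ℤ => ((t : ℂ) - s) * j := by
      ext j; push_cast; ring
    rw [e]
    module
  · intro h
    obtain rfl : s = -t := by omega
    rcases le_total 0 t with ht | ht
    · rw [Finset.Ico_eq_empty (a := 0) (b := -t) (by omega), Finset.sum_empty,
        sum_Ico_zero _ (fun x => (x : ℂ) * (x - 1) * (2 * x - 1) / 6 - t * (x * (x - 1) / 2))
          (by simp) (fun t => by push_cast; ring) ht, sub_zero]
      ring
    · rw [Finset.Ico_eq_empty (a := 0) (b := t) (by omega), Finset.sum_empty,
        sum_Ico_zero _ (fun x => (x : ℂ) * (x - 1) * (2 * x - 1) / 6 + t * (x * (x - 1) / 2))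
          (by simp) (fun t => by push_cast; ring) (show 0 ≤ -t by omega)]
      push_cast; ring

theorem cm_N0_ϑ (s k : ℤ) : cm (S.N0 s) (S.ϑ k) = S.ϑ (s + k) := by
  rw [N0, S.cm_N_ϑ, one_smul]

theorem cm_N0_ϖ (s k : ℤ) : cm (S.N0 s) (S.ϖ k) = -S.ϖ (s + k) := by
  rw [N0, S.cm_N_ϖ, one_smul]

theorem cm_N1_ϑ (s k : ℤ) : cm (S.N1 s) (S.ϑ k) = ((s : ℂ) + k) • S.ϑ (s + k) := by
  rw [N1, S.cm_N_ϑ]; push_cast; rfl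

theorem cm_N1_ϖ (s k : ℤ) : cm (S.N1 s) (S.ϖ k) = (k : ℂ) • S.ϖ (s + k) := by
  rw [N1, S.cm_N_ϖ]; push_cast; module

/-! #### Action of the bilinear expressions on `U`, `V`, `W` -/

theorem hasCharge_N0 (s : ℤ) : S.HasCharge 0 (S.N0 s) := S.hasCharge_N _ _

theorem hasCharge_N1 (s : ℤ) : S.HasCharge 0 (S.N1 s) := S.hasCharge_N _ _

theorem U_mem (s : ℤ) : S.U s ∈ S.raising 2 := (S.hasCharge_U s).mem_raising le_rfl

theorem V_mem (s : ℤ) : S.V' s ∈ S.raising 2 := (S.hasCharge_V s).mem_raising le_rfl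

theorem W_mem (s : ℤ) : S.Wop s ∈ S.raising 3 := (S.hasCharge_W s).mem_raising le_rfl

theorem N0_mem (s : ℤ) : S.N0 s ∈ S.raising 0 := (S.hasCharge_N0 s).mem_raising le_rfl

theorem N1_mem (s : ℤ) : S.N1 s ∈ S.raising 0 := (S.hasCharge_N1 s).mem_raising le_rfl

theorem cm_N0_U (s t : ℤ) : cm (S.N0 s) (S.U t) = (2 : ℂ) • S.U (s + t) := by
  rw [← sub_eq_zero]
  refine eq_zero_of_cm_of_raising (S := S) (fun k => ?_) (fun k => ?_) ?_
  · simp only [map_sub, map_smul, LinearMap.sub_apply, LinearMap.smul_apply, cm_cm, cm_N0_ϑ,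
      cm_U_ϑ, map_zero, smul_zero, sub_self]
  · simp only [map_sub, map_smul, map_neg, LinearMap.sub_apply, LinearMap.smul_apply, cm_cm,
      cm_N0_ϖ, cm_U_ϖ, cm_N0_ϑ]
    rw [show s + (t + k) = s + t + k by ring, show t + (s + k) = s + t + k by ring]
    push_cast
    module
  · exact Submodule.sub_mem _ (cm_mem_raising (S.N0_mem s) (S.U_mem t) (by norm_num))
      (Submodule.smul_mem _ _ (raising_anti (by norm_num) (S.U_mem _)))

theorem cm_N1_U (s t : ℤ) : cm (S.N1 s) (S.U t) = (t : ℂ) • S.U (s + t) := by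
  rw [← sub_eq_zero]
  refine eq_zero_of_cm_of_raising (S := S) (fun k => ?_) (fun k => ?_) ?_
  · simp only [map_sub, map_smul, LinearMap.sub_apply, LinearMap.smul_apply, cm_cm, cm_N1_ϑ,
      cm_U_ϑ, map_zero, smul_zero, sub_self]
  · simp only [map_sub, map_smul, map_neg, LinearMap.sub_apply, LinearMap.smul_apply, cm_cm,
      cm_N1_ϖ, cm_U_ϖ, cm_N1_ϑ]
    rw [show s + (t + k) = s + t + k by ring, show t + (s + k) = s + t + k by ring]
    push_cast
    module
  · exact Submodule.sub_mem _ (cm_mem_raising (S.N1_mem s) (S.U_mem t) (by norm_num))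
      (Submodule.smul_mem _ _ (raising_anti (by norm_num) (S.U_mem _)))
-- The factor 2 is the charge of V. The U-term appears because V contains derivatives of θ, which do
-- not commute with multiplication by the function whose mode `N0` represents.
theorem cm_N0_V (s t : ℤ) : cm (S.N0 s) (S.V' t)
    = (2 : ℂ) • S.V' (s + t) + (2 * (s : ℂ) ^ 2 + s * t) • S.U (s + t) := by
  rw [← sub_eq_zero]
  refine eq_zero_of_cm_of_raising (S := S) (fun k => ?_) (fun k => ?_) ?_
  · simp only [map_sub, map_add, map_smul, LinearMap.sub_apply, LinearMap.add_apply,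
      LinearMap.smul_apply, cm_cm, cm_N0_ϑ, cm_U_ϑ, cm_V_ϑ, map_zero, smul_zero, sub_self,
      add_zero]
  · simp only [map_sub, map_add, map_smul, map_neg, LinearMap.sub_apply, LinearMap.add_apply,
      LinearMap.smul_apply, cm_cm, cm_N0_ϖ, cm_U_ϖ, cm_V_ϖ, cm_N0_ϑ]
    rw [show s + (t + k) = s + t + k by ring, show t + (s + k) = s + t + k by ring]
    push_cast
    module
  · exact Submodule.sub_mem _ (cm_mem_raising (S.N0_mem s) (S.V_mem t) (by norm_num))
      (raising_anti (by norm_num) (Submodule.add_mem _ (Submodule.smul_mem _ _ (S.V_mem _))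
        (Submodule.smul_mem _ _ (S.U_mem _))))

theorem cm_N1_V (s t : ℤ) : cm (S.N1 s) (S.V' t) = ((t : ℂ) - 2 * s) • S.V' (s + t) := by
  rw [← sub_eq_zero]
  refine eq_zero_of_cm_of_raising (S := S) (fun k => ?_) (fun k => ?_) ?_
  · simp only [map_sub, map_smul, LinearMap.sub_apply, LinearMap.smul_apply, cm_cm, cm_N1_ϑ,
      cm_V_ϑ, map_zero, smul_zero, sub_self]
  · simp only [map_sub, map_smul, map_neg, LinearMap.sub_apply, LinearMap.smul_apply, cm_cm,
      cm_N1_ϖ, cm_V_ϖ, cm_N1_ϑ]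
    rw [show s + (t + k) = s + t + k by ring, show t + (s + k) = s + t + k by ring]
    push_cast
    module
  · exact Submodule.sub_mem _ (cm_mem_raising (S.N1_mem s) (S.V_mem t) (by norm_num))
      (Submodule.smul_mem _ _ (raising_anti (by norm_num) (S.V_mem _)))

theorem cm_N0_W (s t : ℤ) : cm (S.N0 s) (S.Wop t) = (3 : ℂ) • S.Wop (s + t) := by
  rw [← sub_eq_zero]
  refine eq_zero_of_ac_of_raising (S := S) (fun k => ?_) (fun k => ?_) ?_
  · simp only [map_sub, map_smul, LinearMap.sub_apply, LinearMap.smul_apply, ac_cm_even_odd,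
      cm_N0_ϑ, ac_W_ϑ, map_zero, smul_zero, sub_self]
  · simp only [map_sub, map_add, map_smul, map_neg, LinearMap.sub_apply, LinearMap.smul_apply,
      ac_cm_even_odd, cm_N0_ϖ, ac_W_ϖ, cm_N0_V, cm_N0_U]
    rw [show s + (t + k) = s + t + k by ring, show t + (s + k) = s + t + k by ring]
    push_cast
    module
  · exact Submodule.sub_mem _ (cm_mem_raising (S.N0_mem s) (S.W_mem t) (by norm_num))
      (Submodule.smul_mem _ _ (raising_anti (by norm_num) (S.W_mem _)))

theorem cm_N1_W (s t : ℤ) : cm (S.N1 s) (S.Wop t) = ((t : ℂ) - 2 * s) • S.Wop (s + t) := by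
  rw [← sub_eq_zero]
  refine eq_zero_of_ac_of_raising (S := S) (fun k => ?_) (fun k => ?_) ?_
  · simp only [map_sub, map_smul, LinearMap.sub_apply, LinearMap.smul_apply, ac_cm_even_odd,
      cm_N1_ϑ, ac_W_ϑ, map_zero, smul_zero, sub_self]
  · simp only [map_sub, map_add, map_smul, map_neg, LinearMap.sub_apply, LinearMap.smul_apply,
      ac_cm_even_odd, cm_N1_ϖ, ac_W_ϖ, cm_N1_V, cm_N1_U]
    rw [show s + (t + k) = s + t + k by ring, show t + (s + k) = s + t + k by ring]
    push_cast
    module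
  · exact Submodule.sub_mem _ (cm_mem_raising (S.N1_mem s) (S.W_mem t) (by norm_num))
      (Submodule.smul_mem _ _ (raising_anti (by norm_num) (S.W_mem _)))

/-- An even operator that supercommutes with all `ϑ_j` commutes with `W`. -/
theorem cm_W_of_semiconj {B : Module.End ℂ W} (h : ∀ j, B * S.ϑ j = S.ϑ j * B) (s : ℤ) :
    cm B (S.Wop s) = 0 := by
  rw [cm_eq_zero, Wop, mul_neg, neg_mul, locSum_semiconj (S.locFinite_W s) B 1, one_smul]
  intro i
  have := cm_eq_zero.mp (S.cm_Q_of_semiconj (r := 1) (by norm_num) (fun j => by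
    rw [one_smul, h]) (fun j : ℤ => -((j : ℂ) ^ 2 * (i - j))) i)
  rw [one_smul, ← mul_assoc, V', this, mul_assoc, h, mul_assoc]

/-- An operator that anticommutes with all `ϑ_j` anticommutes with `W`. -/
theorem ac_W_of_semiconj {B : Module.End ℂ W} (h : ∀ j, B * S.ϑ j = -(S.ϑ j * B)) (s : ℤ) :
    ac B (S.Wop s) = 0 := by
  rw [ac_eq_zero, Wop, mul_neg, neg_mul, locSum_semiconj (S.locFinite_W s) B (-1), neg_one_smul]
  intro i
  have := cm_eq_zero.mp (S.cm_Q_of_semiconj (r := -1) (by norm_num) (fun j => by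
    rw [neg_one_smul, h]) (fun j : ℤ => -((j : ℂ) ^ 2 * (i - j))) i)
  rw [neg_one_smul, ← mul_assoc, V', this, mul_assoc, h, mul_neg, mul_assoc]

end FermiModule

namespace FermiModule

variable {c k₁ k₂ : ℂ} {W V : Type*} [AddCommGroup W] [Module ℂ W] [AddCommGroup V] [Module ℂ V]
  (S : FermiModule c k₁ k₂ W V)

/-! #### The generators `L` and `G` -/

/-- The generator `L_m`. -/
noncomputable def Lop (m : ℤ) : Module.End ℂ W :=
  S.N1 m + ((m : ℂ) / 2) • S.N0 m + S.L m + (m : ℂ) • S.T 0 0 m + ((m : ℂ) / 2) • S.T 1 1 m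
    + ((m : ℂ) ^ 2 / 2) • S.ϑX (S.T 0 1) m

/-- The generator `G_m`. -/
noncomputable def Gop (m : ℤ) : Module.End ℂ W :=
  S.C m - S.ϖ m - S.ϑX S.L m - (m : ℂ) • S.ϑX (S.T 0 0) m - (m : ℂ) • S.T 0 1 m - S.T 1 0 m

/-- The anticommutator of `G_m` and `ϖ_k`. -/
noncomputable def Y (m k : ℤ) : Module.End ℂ W :=
  -(S.N1 (m + k) + (k : ℂ) • S.N0 (m + k) + S.L (m + k) + (m : ℂ) • S.T 0 0 (m + k))

theorem cm_Lop_ϑ (m k : ℤ) : cm (S.Lop m) (S.ϑ k) = ((k : ℂ) + 3 * m / 2) • S.ϑ (m + k) := by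
  simp only [Lop, map_add, map_smul, LinearMap.add_apply, LinearMap.smul_apply, cm_N1_ϑ,
    cm_N0_ϑ, S.L_ϑ, T_ϑ_even, cm_ϑT01_ϑ]
  module

theorem cm_Lop_ϖ (m k : ℤ) : cm (S.Lop m) (S.ϖ k)
    = ((k : ℂ) - m / 2) • S.ϖ (m + k) - ((m : ℂ) ^ 2 / 2) • S.T 0 1 (m + k) := by
  simp only [Lop, map_add, map_smul, LinearMap.add_apply, LinearMap.smul_apply, cm_N1_ϖ,
    cm_N0_ϖ, S.L_ϖ, T_ϖ_even, cm_ϑT01_ϖ]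
  module

theorem ac_Gop_ϑ (m k : ℤ) : ac (S.Gop m) (S.ϑ k) = -(kron (m + k) • 1) + S.U (m + k) := by
  simp only [Gop, map_sub, map_smul, LinearMap.sub_apply, LinearMap.smul_apply, ac_C_ϑ, S.ϖ_ϑ,
    ac_ϑL_ϑ, ac_ϑT00_ϑ, S.T_ϑ_odd (show (0 : ZMod 2) + 1 = 1 from rfl),
    S.T_ϑ_odd (show (1 : ZMod 2) + 0 = 1 from rfl)]
  module

/-- The cubic term becomes bilinear and all terms have charge zero. From here on brackets with G can
be reduced to brackets of bilinears and currents. -/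
theorem ac_Gop_ϖ (m k : ℤ) : ac (S.Gop m) (S.ϖ k) = S.Y m k := by
  have h := S.N_affine k 1 (m + k)
  simp only [one_mul, one_smul] at h
  simp only [Gop, map_sub, map_smul, LinearMap.sub_apply, LinearMap.smul_apply, ac_C_ϖ, S.ϖ_ϖ,
    ac_ϑL_ϖ, ac_ϑT00_ϖ, S.T_ϖ_odd (show (0 : ZMod 2) + 1 = 1 from rfl),
    S.T_ϖ_odd (show (1 : ZMod 2) + 0 = 1 from rfl), Y, h]
  module

theorem cm_Y_ϑ (m k l : ℤ) :
    cm (S.Y m k) (S.ϑ l) = -(((m : ℂ) + 2 * k + l) • S.ϑ (m + k + l)) := by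
  simp only [Y, map_add, map_neg, map_smul, LinearMap.add_apply, LinearMap.neg_apply,
    LinearMap.smul_apply, cm_N1_ϑ, cm_N0_ϑ, S.L_ϑ, T_ϑ_even]
  push_cast
  module

theorem cm_Y_ϖ (m k l : ℤ) : cm (S.Y m k) (S.ϖ l) = ((k : ℂ) - l) • S.ϖ (m + k + l) := by
  simp only [Y, map_add, map_neg, map_smul, LinearMap.add_apply, LinearMap.neg_apply,
    LinearMap.smul_apply, cm_N1_ϖ, cm_N0_ϖ, S.L_ϖ, T_ϖ_even]
  module

theorem cm_N_T01 (f : ℤ → ℂ) (s k : ℤ) : cm (S.N f s) (S.T 0 1 k) = 0 := by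
  rw [cm_swap, cm_T_N, neg_zero]

theorem cm_Lop_T01 (m k : ℤ) :
    cm (S.Lop m) (S.T 0 1 k) = ((k : ℂ) + m / 2) • S.T 0 1 (m + k) := by
  simp only [Lop, map_add, map_smul, LinearMap.add_apply, LinearMap.smul_apply, N0, N1, cm_N_T01,
    cm_L_T, cm_T00_T01, cm_T11_T01, cm_ϑT01_T01]
  module

theorem cm_Y_T01 (m k l : ℤ) :
    cm (S.Y m k) (S.T 0 1 l) = -(((m : ℂ) + l) • S.T 0 1 (m + k + l)) := by
  simp only [Y, map_add, map_neg, map_smul, LinearMap.add_apply, LinearMap.neg_apply,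
    LinearMap.smul_apply, N0, N1, cm_N_T01, cm_L_T, cm_T00_T01]
  module

/-! #### Charges -/

theorem ϑ_mem (k : ℤ) : S.ϑ k ∈ S.raising 1 := (S.hasCharge_ϑ k).mem_raising le_rfl

theorem ϖ_mem (k : ℤ) : S.ϖ k ∈ S.raising (-1) := (S.hasCharge_ϖ k).mem_raising le_rfl

theorem L_mem (k : ℤ) : S.L k ∈ S.raising 0 := (S.hasCharge_L k).mem_raising le_rfl

theorem T_mem (μ ν : ZMod 2) (k : ℤ) : S.T μ ν k ∈ S.raising 0 :=
  (S.hasCharge_T μ ν k).mem_raising le_rfl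

/-- The part of `L_m` that raises the charge. -/
noncomputable def LopR (m : ℤ) : Module.End ℂ W := ((m : ℂ) ^ 2 / 2) • S.ϑX (S.T 0 1) m

/-- The part of `G_m` that raises the charge. -/
noncomputable def GopR (m : ℤ) : Module.End ℂ W :=
  S.C m - S.ϑX S.L m - (m : ℂ) • S.ϑX (S.T 0 0) m

/-- The part of `L_m` of charge zero. -/
noncomputable def LopZ (m : ℤ) : Module.End ℂ W :=
  S.N1 m + ((m : ℂ) / 2) • S.N0 m + S.L m + (m : ℂ) • S.T 0 0 m + ((m : ℂ) / 2) • S.T 1 1 m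

/-- The part of `G_m` of charge zero, up to a sign. -/
noncomputable def GopZ (m : ℤ) : Module.End ℂ W := (m : ℂ) • S.T 0 1 m + S.T 1 0 m

theorem Lop_eq (m : ℤ) : S.Lop m = S.LopZ m + S.LopR m := rfl

theorem Gop_eq (m : ℤ) : S.Gop m = S.GopR m - S.ϖ m - S.GopZ m := by
  rw [Gop, GopR, GopZ]; abel

theorem LopR_mem (m : ℤ) : S.LopR m ∈ S.raising 1 :=
  Submodule.smul_mem _ _ ((S.hasCharge_ϑT _ _ m).mem_raising le_rfl)

theorem LopZ_mem (m : ℤ) : S.LopZ m ∈ S.raising 0 :=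
  Submodule.add_mem _ (Submodule.add_mem _ (Submodule.add_mem _ (Submodule.add_mem _ (S.N1_mem m)
    (Submodule.smul_mem _ _ (S.N0_mem m))) (S.L_mem m)) (Submodule.smul_mem _ _ (S.T_mem 0 0 m)))
    (Submodule.smul_mem _ _ (S.T_mem 1 1 m))

theorem GopR_mem (m : ℤ) : S.GopR m ∈ S.raising 1 :=
  Submodule.sub_mem _ (Submodule.sub_mem _ ((S.hasCharge_C m).mem_raising le_rfl)
    ((S.hasCharge_ϑL m).mem_raising le_rfl))
    (Submodule.smul_mem _ _ ((S.hasCharge_ϑT _ _ m).mem_raising le_rfl))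

theorem GopZ_mem (m : ℤ) : S.GopZ m ∈ S.raising 0 :=
  Submodule.add_mem _ (Submodule.smul_mem _ _ (S.T_mem 0 1 m)) (S.T_mem 1 0 m)

theorem Lop_mem (m : ℤ) : S.Lop m ∈ S.raising 0 :=
  Submodule.add_mem _ (S.LopZ_mem m) (raising_anti (by norm_num) (S.LopR_mem m))

theorem Gop_mem (m : ℤ) : S.Gop m ∈ S.raising (-1) := by
  rw [Gop_eq]
  exact Submodule.sub_mem _ (Submodule.sub_mem _ (raising_anti (by norm_num) (S.GopR_mem m))
    (S.ϖ_mem m)) (raising_anti (by norm_num) (S.GopZ_mem m))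

theorem Y_mem (m k : ℤ) : S.Y m k ∈ S.raising 0 :=
  Submodule.neg_mem _ (Submodule.add_mem _ (Submodule.add_mem _ (Submodule.add_mem _ (S.N1_mem _)
    (Submodule.smul_mem _ _ (S.N0_mem _))) (S.L_mem _)) (Submodule.smul_mem _ _ (S.T_mem 0 0 _)))

/-! #### The brackets with `U`, `V`, `W` -/

theorem cm_ϑT01_Q (s : ℤ) (f : ℤ → ℂ) (t : ℤ) : cm (S.ϑX (S.T 0 1) s) (S.Q f t) = 0 :=
  S.cm_Q_of_semiconj (r := 1) (by norm_num) (fun j => by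
    rw [one_smul]; exact cm_eq_zero.mp (S.cm_ϑT01_ϑ s j)) f t

theorem cm_Lop_U (m n : ℤ) : cm (S.Lop m) (S.U n) = ((n : ℂ) + m) • S.U (m + n) := by
  simp only [Lop, map_add, map_smul, LinearMap.add_apply, LinearMap.smul_apply, cm_N0_U, cm_N1_U]
  simp only [U, cm_L_Q, cm_T_Q, cm_ϑT01_Q]
  module

theorem cm_Lop_V (m n : ℤ) : cm (S.Lop m) (S.V' n) = ((n : ℂ) - m) • S.V' (m + n)
    + ((m : ℂ) ^ 3 + (m : ℂ) ^ 2 * n / 2) • S.U (m + n) := by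
  simp only [Lop, map_add, map_smul, LinearMap.add_apply, LinearMap.smul_apply, cm_N0_V, cm_N1_V]
  simp only [V', cm_L_Q, cm_T_Q, cm_ϑT01_Q]
  module

theorem cm_L_W (m n : ℤ) : cm (S.L m) (S.Wop n) = 0 :=
  S.cm_W_of_semiconj (fun j => cm_eq_zero.mp (S.L_ϑ m j)) n

theorem cm_Tμμ_W (μ : ZMod 2) (m n : ℤ) : cm (S.T μ μ m) (S.Wop n) = 0 :=
  S.cm_W_of_semiconj (fun j => cm_eq_zero.mp (S.T_ϑ_even μ m j)) n

theorem cm_ϑT01_W (m n : ℤ) : cm (S.ϑX (S.T 0 1) m) (S.Wop n) = 0 :=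
  S.cm_W_of_semiconj (fun j => cm_eq_zero.mp (S.cm_ϑT01_ϑ m j)) n

theorem cm_Lop_W (m n : ℤ) : cm (S.Lop m) (S.Wop n) = ((n : ℂ) - m / 2) • S.Wop (m + n) := by
  simp only [Lop, map_add, map_smul, LinearMap.add_apply, LinearMap.smul_apply, cm_N0_W, cm_N1_W,
    cm_L_W, cm_Tμμ_W, cm_ϑT01_W]
  module

theorem cm_Y_U (m k t : ℤ) :
    cm (S.Y m k) (S.U t) = -(((t : ℂ) + 2 * k) • S.U (m + k + t)) := by
  simp only [Y, map_add, map_neg, map_smul, LinearMap.add_apply, LinearMap.neg_apply,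
    LinearMap.smul_apply, cm_N0_U, cm_N1_U]
  simp only [U, cm_L_Q, cm_T_Q]
  module

theorem cm_Y_V (m k t : ℤ) : cm (S.Y m k) (S.V' t)
    = -(((t : ℂ) - 2 * m) • S.V' (m + k + t)
      + ((k : ℂ) * (2 * (m + k) ^ 2 + (m + k) * t)) • S.U (m + k + t)) := by
  simp only [Y, map_add, map_neg, map_smul, LinearMap.add_apply, LinearMap.neg_apply,
    LinearMap.smul_apply, cm_N0_V, cm_N1_V]
  simp only [V', cm_L_Q, cm_T_Q]
  push_cast
  module

theorem cm_Y_W (m k t : ℤ) :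
    cm (S.Y m k) (S.Wop t) = -(((t : ℂ) - 2 * m + k) • S.Wop (m + k + t)) := by
  simp only [Y, map_add, map_neg, map_smul, LinearMap.add_apply, LinearMap.neg_apply,
    LinearMap.smul_apply, cm_N0_W, cm_N1_W, cm_L_W, cm_Tμμ_W]
  push_cast
  module

theorem cm_U_U (s t : ℤ) : cm (S.U s) (S.U t) = 0 := S.cm_Q_Q _ _ _ _

theorem cm_U_V (s t : ℤ) : cm (S.U s) (S.V' t) = 0 := S.cm_Q_Q _ _ _ _

theorem cm_V_V (s t : ℤ) : cm (S.V' s) (S.V' t) = 0 := S.cm_Q_Q _ _ _ _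

theorem cm_U_W (s t : ℤ) : cm (S.U s) (S.Wop t) = 0 :=
  S.cm_W_of_semiconj (fun j => cm_eq_zero.mp (S.cm_U_ϑ s j)) t

theorem cm_V_W (s t : ℤ) : cm (S.V' s) (S.Wop t) = 0 :=
  S.cm_W_of_semiconj (fun j => cm_eq_zero.mp (S.cm_V_ϑ s j)) t

theorem ac_W_W (s t : ℤ) : ac (S.Wop s) (S.Wop t) = 0 :=
  S.ac_W_of_semiconj (fun j => ac_eq_zero.mp (S.ac_W_ϑ s j)) t

/-- Central contributions with different polynomial coefficients need to agree only on the support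
of the Kronecker symbol. -/
theorem kron_smul_congr {M : Type*} [AddCommGroup M] [Module ℂ M] {s : ℤ} {x y : ℂ} (z : M)
    (h : s = 0 → x = y) : (x * kron s) • z = (y * kron s) • z := by
  by_cases h0 : s = 0
  · rw [h h0]
  · rw [kron_of_ne h0, mul_zero, mul_zero]

theorem cm_Gop_U (m n : ℤ) : cm (S.Gop m) (S.U n) = (2 * (m : ℂ) + n) • S.ϑ (m + n) := by
  rw [← sub_eq_zero]
  refine eq_zero_of_ac_of_raising (S := S) (fun k => ?_) (fun k => ?_) ?_
  · simp only [map_sub, map_add, map_neg, map_smul, LinearMap.sub_apply, LinearMap.add_apply,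
      LinearMap.neg_apply, LinearMap.smul_apply, ac_cm_odd_even, cm_U_ϑ, ac_Gop_ϑ, cm_one_left,
      cm_U_U, S.ϑ_ϑ, map_zero, smul_zero, neg_zero, add_zero, sub_zero]
  · simp only [map_sub, map_add, map_neg, map_smul, LinearMap.sub_apply, LinearMap.add_apply,
      LinearMap.neg_apply, LinearMap.smul_apply, ac_cm_odd_even, cm_U_ϖ, ac_Gop_ϑ, ac_Gop_ϖ,
      cm_Y_U, ϑ_ϖ, smul_smul, smul_add, smul_neg]
    rw [show m + k + n = m + n + k by ring, show m + (n + k) = m + n + k by ring]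
    -- One side comes from the scalar in {G, ϑ}, the other from {ϑ_{m+n}, ϖ_k}; they coincide for k
    -- = -m - n.
    have := kron_smul_congr (s := m + n + k) (x := -((n : ℂ) + 2 * k)) (y := 2 * (m : ℂ) + n)
      (1 : Module.End ℂ W) fun h => by
        have : (k : ℂ) = -m - n := by
          have : k = -m - n := by omega
          simp [this]
        rw [this]; ring
    rw [← this]
    module
  · exact Submodule.sub_mem _ (cm_mem_raising (S.Gop_mem m) (S.U_mem n) (by norm_num))
      (Submodule.smul_mem _ _ (S.ϑ_mem _))

theorem cm_Gop_V (m n : ℤ) : cm (S.Gop m) (S.V' n) = ((n : ℂ) - 2 * m) • S.Wop (m + n)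
    + (2 * (m : ℂ) ^ 3 + 3 * (m : ℂ) ^ 2 * n + (m : ℂ) * (n : ℂ) ^ 2) • S.ϑ (m + n) := by
  rw [← sub_eq_zero]
  refine eq_zero_of_ac_of_raising (S := S) (fun k => ?_) (fun k => ?_) ?_
  · simp only [map_sub, map_add, map_neg, map_smul, LinearMap.sub_apply, LinearMap.add_apply,
      LinearMap.neg_apply, LinearMap.smul_apply, ac_cm_odd_even, cm_V_ϑ, ac_Gop_ϑ, cm_one_left,
      cm_U_V, S.ϑ_ϑ, ac_W_ϑ, map_zero, smul_zero, neg_zero, add_zero, sub_zero]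
  · simp only [map_sub, map_add, map_neg, map_smul, LinearMap.sub_apply, LinearMap.add_apply,
      LinearMap.neg_apply, LinearMap.smul_apply, ac_cm_odd_even, cm_V_ϖ, ac_Gop_ϑ, ac_Gop_ϖ,
      cm_Y_V, ϑ_ϖ, ac_W_ϖ, smul_smul, smul_add, smul_neg]
    rw [show m + k + n = m + n + k by ring, show m + (n + k) = m + n + k by ring]
    have := kron_smul_congr (s := m + n + k) (x := -((k : ℂ) * (n + k) * (n + 2 * k)))
      (y := 2 * (m : ℂ) ^ 3 + 3 * (m : ℂ) ^ 2 * n + (m : ℂ) * (n : ℂ) ^ 2)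
      (1 : Module.End ℂ W) fun h => by
        have : (k : ℂ) = -m - n := by
          have : k = -m - n := by omega
          simp [this]
        rw [this]; ring
    rw [← this]
    push_cast
    module
  · exact Submodule.sub_mem _ (cm_mem_raising (S.Gop_mem m) (S.V_mem n) (by norm_num))
      (Submodule.add_mem _ (Submodule.smul_mem _ _ (raising_anti (by norm_num) (S.W_mem _)))
        (Submodule.smul_mem _ _ (S.ϑ_mem _)))

theorem ac_Gop_W (m n : ℤ) : ac (S.Gop m) (S.Wop n)
    = S.V' (m + n) - (2 * (m : ℂ) ^ 2 + (m : ℂ) * n) • S.U (m + n) := by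
  rw [← sub_eq_zero]
  refine eq_zero_of_cm_of_raising (S := S) (fun k => ?_) (fun k => ?_) ?_
  · simp only [map_sub, map_add, map_neg, map_smul, LinearMap.sub_apply, LinearMap.add_apply,
      LinearMap.neg_apply, LinearMap.smul_apply, cm_ac, cm_V_ϑ, cm_U_ϑ, ac_Gop_ϑ, cm_one_right,
      cm_swap (S.Wop n) (S.U _), cm_U_W, ac_W_ϑ, map_zero, smul_zero, neg_zero, add_zero,
      sub_zero]
  · simp only [map_sub, map_add, map_neg, map_smul, LinearMap.sub_apply, LinearMap.add_apply,
      LinearMap.neg_apply, LinearMap.smul_apply, cm_ac, cm_V_ϖ, cm_U_ϖ, ac_Gop_ϖ, ac_W_ϖ,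
      cm_swap (S.Wop n) (S.Y _ _), cm_Y_W, cm_Gop_V, cm_Gop_U, smul_smul, smul_add, smul_neg]
    rw [show m + k + n = m + n + k by ring, show m + (n + k) = m + n + k by ring]
    push_cast
    module
  · exact Submodule.sub_mem _ (ac_mem_raising (S.Gop_mem m) (S.W_mem n) (by norm_num))
      (Submodule.sub_mem _ (raising_anti (by norm_num) (S.V_mem _))
        (Submodule.smul_mem _ _ (raising_anti (by norm_num) (S.U_mem _))))

end FermiModule

namespace FermiModule

variable {c k₁ k₂ : ℂ} {W V : Type*} [AddCommGroup W] [Module ℂ W] [AddCommGroup V] [Module ℂ V]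
  (S : FermiModule c k₁ k₂ W V)

/-! #### The brackets of `L` and `G` -/

theorem cm_N0_N1 (s t : ℤ) : cm (S.N0 s) (S.N1 t)
    = -(s : ℂ) • S.N0 (s + t) + (kron (s + t) * ((s : ℂ) * (s + 1) / 2)) • 1 := by
  rw [cm_swap, cm_N1_N0, add_comm t s]
  module

theorem cm_L_N' (n : ℤ) (s : ℤ) : cm (S.L n) (S.N0 s) = 0 ∧ cm (S.L n) (S.N1 s) = 0 ∧
    cm (S.N0 s) (S.L n) = 0 ∧ cm (S.N1 s) (S.L n) = 0 := by
  simp only [N0, N1, cm_swap (S.N _ _) (S.L _), cm_L_N, neg_zero, and_self]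

theorem cm_T_N' (μ ν : ZMod 2) (n : ℤ) (s : ℤ) :
    cm (S.T μ ν n) (S.N0 s) = 0 ∧ cm (S.T μ ν n) (S.N1 s) = 0 ∧
    cm (S.N0 s) (S.T μ ν n) = 0 ∧ cm (S.N1 s) (S.T μ ν n) = 0 := by
  simp only [N0, N1, cm_swap (S.N _ _) (S.T _ _ _), cm_T_N, neg_zero, and_self]

theorem cm_T_L (μ ν : ZMod 2) (m n : ℤ) :
    cm (S.T μ ν m) (S.L n) = -((m : ℂ) • S.T μ ν (m + n)) := by
  rw [cm_swap, cm_L_T, add_comm]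

theorem cm_T11_T00 (m n : ℤ) : cm (S.T 1 1 m) (S.T 0 0 n)
    = ((n : ℂ) * k₂ * kron (m + n)) • 1 := by
  rw [cm_swap, cm_T00_T11, add_comm]
  module

theorem cm_T01_T00 (m n : ℤ) : cm (S.T 0 1 m) (S.T 0 0 n) = -S.T 0 1 (m + n) := by
  rw [cm_swap, cm_T00_T01, add_comm]

theorem cm_T10_T00 (m n : ℤ) : cm (S.T 1 0 m) (S.T 0 0 n) = S.T 1 0 (m + n) := by
  rw [cm_swap, cm_T00_T10, add_comm, neg_neg]

/-- In the coefficient a, the part (c - 2)/12 comes from `N1` and the Virasoro modes on V, the part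
-3/4 from the terms with `N0`, and 3k₁/4 + k₂/4 from the currents m T⁰₀ + (m/2) T¹₁. The first
source alone gives the linear term. -/
theorem cm_LopZ_LopZ (m n : ℤ) : cm (S.LopZ m) (S.LopZ n) = ((n : ℂ) - m) • S.LopZ (m + n)
    + ((-(-(3 / 4) + 3 / 4 * k₁ + 1 / 4 * k₂ + (c - 2) / 12) * (m : ℂ) ^ 3
        + (c - 2) / 12 * m) * kron (m + n)) • 1 := by
  simp only [LopZ, map_add, map_smul, LinearMap.add_apply, LinearMap.smul_apply, cm_N1_N1,
    cm_N1_N0, cm_N0_N1, cm_N0_N0, (S.cm_L_N' _ _).1, (S.cm_L_N' _ _).2.1, (S.cm_L_N' _ _).2.2.1,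
    (S.cm_L_N' _ _).2.2.2, (S.cm_T_N' _ _ _ _).1, (S.cm_T_N' _ _ _ _).2.1,
    (S.cm_T_N' _ _ _ _).2.2.1, (S.cm_T_N' _ _ _ _).2.2.2, cm_L_L, cm_L_T, cm_T_L, cm_T00_T00,
    cm_T00_T11, cm_T11_T00, cm_T11_T11]
  rcases Xsc.kron_eq_zero_or (s := m + n) with h | ⟨h, h'⟩
  · simp only [h]
    push_cast
    module
  · simp only [h, Int.cast_add, Xsc.cast_eq_neg_of_add_eq_zero h']
    module

theorem cm_Lop_Lop (m n : ℤ) : cm (S.Lop m) (S.Lop n) = ((n : ℂ) - m) • S.Lop (m + n)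
    + ((-(-(3 / 4) + 3 / 4 * k₁ + 1 / 4 * k₂ + (c - 2) / 12) * (m : ℂ) ^ 3
        + (c - 2) / 12 * m) * kron (m + n)) • 1 := by
  rw [← sub_eq_zero]
  refine eq_zero_of_cm_of_raising (S := S) (fun k => ?_) (fun k => ?_) ?_
  · simp only [map_sub, map_add, map_smul, LinearMap.sub_apply, LinearMap.add_apply,
      LinearMap.smul_apply, cm_cm, cm_Lop_ϑ, cm_one_left]
    rw [show m + (n + k) = m + n + k by ring, show n + (m + k) = m + n + k by ring]
    push_cast
    module
  · simp only [map_sub, map_add, map_smul, LinearMap.sub_apply, LinearMap.add_apply,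
      LinearMap.smul_apply, cm_cm, cm_Lop_ϖ, cm_Lop_T01, cm_one_left]
    rw [show m + (n + k) = m + n + k by ring, show n + (m + k) = m + n + k by ring]
    push_cast
    module
  -- The charge-zero part of the difference cancels by the previous computation; every remaining
  -- term contains a charge-raising factor and no lowering one.
  · have e : cm (S.Lop m) (S.Lop n) - (((n : ℂ) - m) • S.Lop (m + n)
        + ((-(-(3 / 4) + 3 / 4 * k₁ + 1 / 4 * k₂ + (c - 2) / 12) * (m : ℂ) ^ 3
          + (c - 2) / 12 * m) * kron (m + n)) • 1)
        = cm (S.LopR m) (S.LopZ n) + cm (S.Lop m) (S.LopR n)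
          - ((n : ℂ) - m) • S.LopR (m + n) := by
      simp only [Lop_eq, map_add, LinearMap.add_apply, cm_LopZ_LopZ]
      module
    rw [e]
    exact Submodule.sub_mem _ (Submodule.add_mem _
      (cm_mem_raising (S.LopR_mem _) (S.LopZ_mem _) (by norm_num))
      (cm_mem_raising (S.Lop_mem _) (S.LopR_mem _) (by norm_num)))
      (Submodule.smul_mem _ _ (S.LopR_mem _))

theorem ac_T_ϖ_odd (k l : ℤ) : ac (S.T 0 1 k) (S.ϖ l) = 0 ∧ ac (S.T 1 0 k) (S.ϖ l) = 0 ∧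
    ac (S.ϖ l) (S.T 0 1 k) = 0 ∧ ac (S.ϖ l) (S.T 1 0 k) = 0 := by
  rw [ac_swap (S.ϖ l), ac_swap (S.ϖ l), S.T_ϖ_odd rfl, S.T_ϖ_odd rfl]
  simp

theorem ac_GopZ_T01 (n l : ℤ) : ac (S.GopZ n) (S.T 0 1 l)
    = S.T 1 1 (n + l) + S.T 0 0 (n + l) - ((n : ℂ) * k₁ * kron (n + l)) • 1 := by
  simp only [GopZ, map_add, map_smul, LinearMap.add_apply, LinearMap.smul_apply, ac_T01_T01,
    ac_T10_T01]
  module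

/-- The coefficient of `θ_{m+n}` in the bracket of `L_m` and `G_n`. -/
noncomputable def thetaCoeff (P : XscParams) (m n : ℂ) : ℂ :=
  P.α * m ^ 3 + P.β * m ^ 2 * n - P.γ * (m * n + m ^ 2 / 2) - 2 * P.γ' * m

/-- All entries are bilinears and currents, so the anomaly can be read off directly. On m + n + l =
0 it is a polynomial in m and n, and its coefficients are what fixes α, β, γ, γ' in `fockParams`. -/
theorem cm_LopZ_Y (m n l : ℤ) : cm (S.LopZ m) (S.Y n l)
    = ((l : ℂ) - m / 2) • S.Y n (m + l) + ((n : ℂ) - m / 2) • S.Y (m + n) l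
      + ((m : ℂ) ^ 2 / 2) • ac (S.GopZ n) (S.T 0 1 (m + l))
      + (thetaCoeff (fockParams c k₁ k₂) m n * kron (m + n + l)) • 1 := by
  simp only [LopZ, Y, map_add, map_neg, map_smul, LinearMap.add_apply, LinearMap.smul_apply,
    cm_N1_N1, ac_GopZ_T01,
    cm_N1_N0, cm_N0_N1, cm_N0_N0, (S.cm_L_N' _ _).1, (S.cm_L_N' _ _).2.1, (S.cm_L_N' _ _).2.2.1,
    (S.cm_L_N' _ _).2.2.2, (S.cm_T_N' _ _ _ _).1, (S.cm_T_N' _ _ _ _).2.1,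
    (S.cm_T_N' _ _ _ _).2.2.1, (S.cm_T_N' _ _ _ _).2.2.2, cm_L_L, cm_L_T, cm_T_L, cm_T00_T00,
    cm_T00_T11, cm_T11_T00, cm_T11_T11]
  rw [show m + (n + l) = m + n + l by ring, show n + (m + l) = m + n + l by ring]
  rcases Xsc.kron_eq_zero_or (s := m + n + l) with h | ⟨h, h'⟩
  · simp only [h]
    push_cast
    module
  · have hl : (l : ℂ) = -m - n := by
      have : l = -m - n := by omega
      simp [this]
    simp only [h, Int.cast_add, hl, thetaCoeff, fockParams]
    module

/-- This is the bracket of L with {G, ϖ}, needed as an input for [L, G] and hence proved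
independently of it by rigidity. The term {G, T⁰₁} is forced because [L, ϖ] contains T⁰₁. -/
theorem cm_Lop_Y (m n l : ℤ) : cm (S.Lop m) (S.Y n l)
    = ((l : ℂ) - m / 2) • S.Y n (m + l) + ((n : ℂ) - m / 2) • S.Y (m + n) l
      - ((m : ℂ) ^ 2 / 2) • ac (S.Gop n) (S.T 0 1 (m + l))
      + (thetaCoeff (fockParams c k₁ k₂) m n * kron (m + n + l)) • 1 := by
  rw [← sub_eq_zero]
  refine eq_zero_of_cm_of_raising (S := S) (fun k => ?_) (fun k => ?_) ?_
  · simp only [map_sub, map_add, map_neg, map_smul, LinearMap.sub_apply, LinearMap.add_apply,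
      LinearMap.neg_apply, LinearMap.smul_apply, cm_cm, cm_ac, cm_Y_ϑ, cm_Lop_ϑ, ac_Gop_ϑ,
      cm_one_left, cm_one_right, S.T_ϑ_odd (show (0 : ZMod 2) + 1 = 1 from rfl), map_zero]
    simp only [U, cm_T_Q]
    rw [show m + (n + l + k) = m + n + l + k by ring, show n + l + (m + k) = m + n + l + k by ring,
      show n + (m + l) + k = m + n + l + k by ring]
    push_cast
    module
  · simp only [map_sub, map_add, map_neg, map_smul, LinearMap.sub_apply, LinearMap.add_apply,
      LinearMap.neg_apply, LinearMap.smul_apply, cm_cm, cm_ac, cm_Y_ϖ, cm_Lop_ϖ, ac_Gop_ϖ,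
      cm_one_left, (S.ac_T_ϖ_odd _ _).1, cm_swap (S.T 0 1 _) (S.Y _ _), cm_Y_T01, map_zero]
    rw [show m + (n + l + k) = m + n + l + k by ring, show n + l + (m + k) = m + n + l + k by ring,
      show n + (m + l) + k = m + n + l + k by ring, show n + k + (m + l) = m + n + l + k by ring]
    push_cast
    module
  · have e : cm (S.Lop m) (S.Y n l)
        - (((l : ℂ) - m / 2) • S.Y n (m + l) + ((n : ℂ) - m / 2) • S.Y (m + n) l
          - ((m : ℂ) ^ 2 / 2) • ac (S.Gop n) (S.T 0 1 (m + l))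
          + (thetaCoeff (fockParams c k₁ k₂) m n * kron (m + n + l)) • 1)
        = cm (S.LopR m) (S.Y n l) + ((m : ℂ) ^ 2 / 2) • ac (S.GopR n) (S.T 0 1 (m + l)) := by
      simp only [Lop_eq, Gop_eq, map_add, map_sub, LinearMap.add_apply, LinearMap.sub_apply,
        cm_LopZ_Y, (S.ac_T_ϖ_odd _ _).2.2.1]
      module
    rw [e]
    exact Submodule.add_mem _ (cm_mem_raising (S.LopR_mem _) (S.Y_mem _ _) (by norm_num))
      (Submodule.smul_mem _ _ (ac_mem_raising (S.GopR_mem _) (S.T_mem _ _ _) (by norm_num)))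

theorem cm_LopZ_ϖ (m k : ℤ) : cm (S.LopZ m) (S.ϖ k) = ((k : ℂ) - m / 2) • S.ϖ (m + k) := by
  simp only [LopZ, map_add, map_smul, LinearMap.add_apply, LinearMap.smul_apply, cm_N1_ϖ,
    cm_N0_ϖ, S.L_ϖ, T_ϖ_even]
  module

theorem cm_LopR_ϖ (m k : ℤ) : cm (S.LopR m) (S.ϖ k)
    = -(((m : ℂ) ^ 2 / 2) • S.T 0 1 (m + k)) := by
  simp only [LopR, map_smul, LinearMap.smul_apply, cm_ϑT01_ϖ, smul_neg]

theorem cm_LopZ_GopZ (m n : ℤ) : cm (S.LopZ m) (S.GopZ n)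
    = ((n : ℂ) - m / 2) • S.GopZ (m + n) + ((m : ℂ) ^ 2 / 2) • S.T 0 1 (m + n) := by
  simp only [LopZ, GopZ, map_add, map_smul, LinearMap.add_apply, LinearMap.smul_apply,
    (S.cm_T_N' _ _ _ _).2.2.1, (S.cm_T_N' _ _ _ _).2.2.2, cm_L_T, cm_T00_T01, cm_T00_T10,
    cm_T11_T01, cm_T11_T10]
  push_cast
  module

/-- The θ-term is recognized by its anticommutator with ϖ_k, a scalar supported on m + n + k = 0,
which matches the anomaly of `cm_Lop_Y`. Being of charge 1 it does not affect the vacuum component.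
-/
theorem cm_Lop_Gop (m n : ℤ) : cm (S.Lop m) (S.Gop n) = ((n : ℂ) - m / 2) • S.Gop (m + n)
    + thetaCoeff (fockParams c k₁ k₂) m n • S.ϑ (m + n) := by
  rw [← sub_eq_zero]
  refine eq_zero_of_ac_of_raising (S := S) (fun k => ?_) (fun k => ?_) ?_
  · simp only [map_sub, map_add, map_neg, map_smul, LinearMap.sub_apply, LinearMap.add_apply,
      LinearMap.neg_apply, LinearMap.smul_apply, ac_cm_even_odd, cm_Lop_ϑ, ac_Gop_ϑ,
      cm_one_right, cm_Lop_U, S.ϑ_ϑ]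
    rw [show m + (n + k) = m + n + k by ring, show n + (m + k) = m + n + k by ring]
    rcases Xsc.kron_eq_zero_or (s := m + n + k) with h | ⟨h, h'⟩
    · simp only [h]
      push_cast
      module
    · have hk : (k : ℂ) = -m - n := by
        have : k = -m - n := by omega
        simp [this]
      simp only [h, Int.cast_add, hk]
      module
  · simp only [map_sub, map_add, map_neg, map_smul, LinearMap.sub_apply, LinearMap.add_apply,
      LinearMap.neg_apply, LinearMap.smul_apply, ac_cm_even_odd, cm_Lop_ϖ, ac_Gop_ϖ,
      cm_Lop_Y, ϑ_ϖ]
    module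
  · have e : cm (S.Lop m) (S.Gop n) - (((n : ℂ) - m / 2) • S.Gop (m + n)
        + thetaCoeff (fockParams c k₁ k₂) m n • S.ϑ (m + n))
        = cm (S.Lop m) (S.GopR n) - cm (S.LopR m) (S.GopZ n)
          - ((n : ℂ) - m / 2) • S.GopR (m + n)
          - thetaCoeff (fockParams c k₁ k₂) m n • S.ϑ (m + n) := by
      simp only [Lop_eq, Gop_eq, map_add, map_sub, LinearMap.add_apply, LinearMap.sub_apply,
        cm_LopZ_ϖ, cm_LopR_ϖ, cm_LopZ_GopZ]
      module
    rw [e]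
    exact Submodule.sub_mem _ (Submodule.sub_mem _ (Submodule.sub_mem _
      (cm_mem_raising (S.Lop_mem _) (S.GopR_mem _) (by norm_num))
      (cm_mem_raising (S.LopR_mem _) (S.GopZ_mem _) (by norm_num)))
      (Submodule.smul_mem _ _ (S.GopR_mem _))) (Submodule.smul_mem _ _ (S.ϑ_mem _))

theorem cm_GopZ_Y (m n k : ℤ) : cm (S.GopZ m) (S.Y n k)
    = ((m : ℂ) - n) • S.T 1 0 (m + n + k) + ((m : ℂ) * (m + n)) • S.T 0 1 (m + n + k) := by
  simp only [GopZ, Y, map_add, map_neg, map_smul, LinearMap.add_apply, LinearMap.smul_apply,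
    LinearMap.neg_apply, (S.cm_T_N' _ _ _ _).1, (S.cm_T_N' _ _ _ _).2.1, cm_T_L, cm_T01_T00,
    cm_T10_T00]
  rw [show m + (n + k) = m + n + k by ring]
  module

/-- The coefficient of `U_{m+n}` in the bracket of `G_m` and `G_n`. -/
noncomputable def uCoeff (P : XscParams) (m n : ℂ) : ℂ :=
  (2 * P.α - P.e) * (m ^ 2 + n ^ 2) + (2 * P.β - P.e) * (m * n) - P.γ * (m + n) - 2 * P.γ'

/-- The symmetrization in m and n reflects the anticommutator of G_m and G_n bracketed twice with ϖ.
On the support of the Kronecker symbol the anomaly is split into m+n+2k and k(m+n+k)(m+n+2k), the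
factors with which ϖ_k contracts U_{m+n} and V_{m+n}; this determines the U-coefficient and e. -/
theorem cm_Y_Y_add (m l n k : ℤ) : cm (S.Y m l) (S.Y n k) + cm (S.Y n l) (S.Y m k)
    = ((l : ℂ) - k) • (S.Y m (n + k + l) + S.Y n (m + k + l))
      + ((uCoeff (fockParams c k₁ k₂) m n * (m + n + 2 * k)
          + (fockParams c k₁ k₂).e * (k * (m + n + k) * (m + n + 2 * k)))
            * kron (m + n + k + l)) • 1 := by
  simp only [Y, map_add, map_neg, map_smul, LinearMap.add_apply, LinearMap.smul_apply,
    LinearMap.neg_apply, cm_N1_N1,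
    cm_N1_N0, cm_N0_N1, cm_N0_N0, (S.cm_L_N' _ _).1, (S.cm_L_N' _ _).2.1, (S.cm_L_N' _ _).2.2.1,
    (S.cm_L_N' _ _).2.2.2, (S.cm_T_N' _ _ _ _).1, (S.cm_T_N' _ _ _ _).2.1,
    (S.cm_T_N' _ _ _ _).2.2.1, (S.cm_T_N' _ _ _ _).2.2.2, cm_L_L, cm_L_T, cm_T_L, cm_T00_T00]
  rw [show m + l + (n + k) = m + n + k + l by ring, show n + l + (m + k) = m + n + k + l by ring,
    show m + (n + k + l) = m + n + k + l by ring, show n + (m + k + l) = m + n + k + l by ring]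
  rcases Xsc.kron_eq_zero_or (s := m + n + k + l) with h | ⟨h, h'⟩
  · simp only [h]
    push_cast
    module
  · have hl : (l : ℂ) = -m - n - k := by
      have : l = -m - n - k := by omega
      simp [this]
    simp only [h, Int.cast_add, hl, uCoeff, fockParams]
    module

/-- The left side is the bracket of {G_m, G_n} with ϖ_k by the Jacobi identity for three odd
operators. A further bracket with ϖ_l reduces it to Y with Y, which is where the recursion ends. -/
theorem cm_Gop_Y_add (m n k : ℤ) : cm (S.Gop m) (S.Y n k) + cm (S.Gop n) (S.Y m k)
    = (2 * (k : ℂ) - m - n) • S.ϖ (m + n + k) - ((m : ℂ) + n) ^ 2 • S.T 0 1 (m + n + k)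
      + (uCoeff (fockParams c k₁ k₂) m n * (m + n + 2 * k)
          + (fockParams c k₁ k₂).e * (k * (m + n + k) * (m + n + 2 * k))) •
        S.ϑ (m + n + k) := by
  rw [← sub_eq_zero]
  refine eq_zero_of_ac_of_raising (S := S) (fun l => ?_) (fun l => ?_) ?_
  · simp only [map_sub, map_add, map_neg, map_smul, LinearMap.sub_apply, LinearMap.add_apply,
      LinearMap.neg_apply, LinearMap.smul_apply, ac_cm_odd_even, cm_Y_ϑ, ac_Gop_ϑ, S.ϖ_ϑ, S.ϑ_ϑ,
      cm_one_left, cm_swap (S.U _) (S.Y _ _), cm_Y_U,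
      S.T_ϑ_odd (show (0 : ZMod 2) + 1 = 1 from rfl)]
    rw [show m + (n + k + l) = m + n + k + l by ring,
      show n + (m + k + l) = m + n + k + l by ring,
      show n + k + (m + l) = m + n + k + l by ring,
      show m + k + (n + l) = m + n + k + l by ring]
    rcases Xsc.kron_eq_zero_or (s := m + n + k + l) with h | ⟨h, h'⟩
    · simp only [h]
      push_cast
      module
    · have hl : (l : ℂ) = -m - n - k := by
        have : l = -m - n - k := by omega
        simp [this]
      simp only [h, Int.cast_add, hl]
      module
  · have := S.cm_Y_Y_add m l n k
    simp only [map_sub, map_add, map_neg, map_smul, LinearMap.sub_apply, LinearMap.add_apply,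
      LinearMap.neg_apply, LinearMap.smul_apply, ac_cm_odd_even, cm_Y_ϖ, ac_Gop_ϖ, S.ϖ_ϖ, ϑ_ϖ,
      (S.ac_T_ϖ_odd _ _).1]
    refine Eq.trans ?_ (sub_eq_zero.mpr this)
    module
  · have e : cm (S.Gop m) (S.Y n k) + cm (S.Gop n) (S.Y m k)
        - ((2 * (k : ℂ) - m - n) • S.ϖ (m + n + k) - ((m : ℂ) + n) ^ 2 • S.T 0 1 (m + n + k)
          + (uCoeff (fockParams c k₁ k₂) m n * (m + n + 2 * k)
            + (fockParams c k₁ k₂).e * (k * (m + n + k) * (m + n + 2 * k))) • S.ϑ (m + n + k))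
        = cm (S.GopR m) (S.Y n k) + cm (S.GopR n) (S.Y m k)
          - (uCoeff (fockParams c k₁ k₂) m n * (m + n + 2 * k)
            + (fockParams c k₁ k₂).e * (k * (m + n + k) * (m + n + 2 * k))) •
            S.ϑ (m + n + k) := by
      simp only [Gop_eq, map_sub, LinearMap.sub_apply, cm_swap (S.ϖ _) (S.Y _ _), cm_Y_ϖ,
        cm_GopZ_Y]
      rw [show n + m + k = m + n + k by ring, show n + k + m = m + n + k by ring,
        show m + k + n = m + n + k by ring]
      module
    rw [e]
    exact Submodule.sub_mem _ (Submodule.add_mem _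
      (cm_mem_raising (S.GopR_mem _) (S.Y_mem _ _) (by norm_num))
      (cm_mem_raising (S.GopR_mem _) (S.Y_mem _ _) (by norm_num)))
      (Submodule.smul_mem _ _ (S.ϑ_mem _))

theorem ac_GopZ_ϖ (m k : ℤ) : ac (S.GopZ m) (S.ϖ k) = 0 ∧ ac (S.ϖ k) (S.GopZ m) = 0 := by
  rw [ac_swap (S.ϖ k)]
  simp [GopZ, (S.ac_T_ϖ_odd _ _).1, (S.ac_T_ϖ_odd _ _).2.1]

theorem ac_GopR_ϖ (m k : ℤ) : ac (S.GopR m) (S.ϖ k) = S.Y m k := by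
  have : S.GopR m = S.Gop m + S.ϖ m + S.GopZ m := by rw [Gop_eq]; abel
  rw [this]
  simp only [map_add, LinearMap.add_apply, ac_Gop_ϖ, S.ϖ_ϖ, (S.ac_GopZ_ϖ _ _).1, add_zero]

theorem ac_GopZ_GopZ (m n : ℤ) : ac (S.GopZ m) (S.GopZ n)
    = ((m : ℂ) + n) • (S.T 0 0 (m + n) + S.T 1 1 (m + n))
      + ((2 * k₁ * (m : ℂ) ^ 2) * kron (m + n)) • 1 := by
  simp only [GopZ, map_add, map_smul, LinearMap.add_apply, LinearMap.smul_apply, ac_T01_T01,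
    ac_T10_T01, ac_T01_T10, ac_T10_T10]
  rcases Xsc.kron_eq_zero_or (s := m + n) with h | ⟨h, h'⟩
  · simp only [h]
    module
  · simp only [h, Xsc.cast_eq_neg_of_add_eq_zero h']
    module

/-- U and V have charge 2 and are invisible on the vacuum; they are determined by the brackets with
ϖ. The central term, in contrast, is invisible to the modes and comes from the anticommutator of the
current parts. -/
theorem ac_Gop_Gop (m n : ℤ) : ac (S.Gop m) (S.Gop n) = (2 : ℂ) • S.Lop (m + n)
    + ((2 * k₁ * (m : ℂ) ^ 2) * kron (m + n)) • 1
    + uCoeff (fockParams c k₁ k₂) m n • S.U (m + n)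
    + (fockParams c k₁ k₂).e • S.V' (m + n) := by
  rw [← sub_eq_zero]
  refine eq_zero_of_cm_of_raising (S := S) (fun k => ?_) (fun k => ?_) ?_
  · simp only [map_sub, map_add, map_neg, map_smul, LinearMap.sub_apply, LinearMap.add_apply,
      LinearMap.neg_apply, LinearMap.smul_apply, cm_ac, ac_Gop_ϑ, cm_one_left, cm_one_right,
      cm_Gop_U, cm_Lop_ϑ, cm_U_ϑ, cm_V_ϑ]
    rw [show m + (n + k) = m + n + k by ring, show n + (m + k) = m + n + k by ring]
    push_cast
    module
  · simp only [map_sub, map_add, map_neg, map_smul, LinearMap.sub_apply, LinearMap.add_apply,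
      LinearMap.neg_apply, LinearMap.smul_apply, cm_ac, ac_Gop_ϖ, cm_one_left,
      cm_Gop_Y_add, cm_Lop_ϖ, cm_U_ϖ, cm_V_ϖ]
    push_cast
    module
  -- The terms of negative charge vanish, since ϖ anticommutes with itself and with the odd
  -- currents. The charge-zero terms, two Y and {T, T}, combine to twice `LopZ` and the central
  -- term.
  · have e : ac (S.Gop m) (S.Gop n) - ((2 : ℂ) • S.Lop (m + n)
          + ((2 * k₁ * (m : ℂ) ^ 2) * kron (m + n)) • 1
          + uCoeff (fockParams c k₁ k₂) m n • S.U (m + n)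
          + (fockParams c k₁ k₂).e • S.V' (m + n))
        = ac (S.GopR m) (S.GopR n) - ac (S.GopR m) (S.GopZ n) - ac (S.GopZ m) (S.GopR n)
          - (2 : ℂ) • S.LopR (m + n) - uCoeff (fockParams c k₁ k₂) m n • S.U (m + n)
          - (fockParams c k₁ k₂).e • S.V' (m + n) := by
      simp only [Gop_eq, Lop_eq, map_sub, LinearMap.sub_apply, ac_swap (S.ϖ _) (S.GopR _),
        ac_GopR_ϖ, S.ϖ_ϖ, (S.ac_GopZ_ϖ _ _).1, (S.ac_GopZ_ϖ _ _).2, ac_GopZ_GopZ, Y, LopZ,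
        add_comm n m]
      push_cast
      module
    rw [e]
    exact Submodule.sub_mem _ (Submodule.sub_mem _ (Submodule.sub_mem _ (Submodule.sub_mem _
      (Submodule.sub_mem _ (ac_mem_raising (S.GopR_mem _) (S.GopR_mem _) (by norm_num))
      (ac_mem_raising (S.GopR_mem _) (S.GopZ_mem _) (by norm_num)))
      (ac_mem_raising (S.GopZ_mem _) (S.GopR_mem _) (by norm_num)))
      (Submodule.smul_mem _ _ (S.LopR_mem _)))
      (Submodule.smul_mem _ _ (raising_anti (by norm_num) (S.U_mem _))))
      (Submodule.smul_mem _ _ (raising_anti (by norm_num) (S.V_mem _)))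

end FermiModule

/-! ### The tensor product of the Fock module and a module of positive energy -/

theorem kron_neg (n : ℤ) : kron (-n) = kron n := by simp [kron]

theorem apply_eq_of_ac_eq_zero {W : Type*} [AddCommGroup W] [Module ℂ W] {A B : Module.End ℂ W}
    (h : ac A B = 0) (w : W) : A (B w) = (-1 : ℂ) • B (A w) := by
  rw [neg_one_smul]
  exact congrArg (fun f => f w) (ac_eq_zero.mp h)

namespace Fock

theorem create_create (j k : ℤ) (x : Fock) :
    create j (create k x) + create k (create j x) = 0 := by
  have := congrArg (fun f => f x) (create_mul_create j k)
  simp only [Module.End.mul_apply, LinearMap.neg_apply] at this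
  rw [this, neg_add_cancel]

theorem annihilate_annihilate (j k : ℤ) (x : Fock) :
    annihilate j (annihilate k x) + annihilate k (annihilate j x) = 0 := by
  have := congrArg (fun f => f x) (annihilate_mul_annihilate j k)
  simp only [Module.End.mul_apply, LinearMap.neg_apply] at this
  rw [this, neg_add_cancel]

theorem annihilate_create (j k : ℤ) (x : Fock) :
    annihilate j (create k x) + create k (annihilate j x) = kron (j - k) • x := by
  have := congrArg (fun f => f x) (annihilate_mul_create j k)
  simp only [Module.End.mul_apply, LinearMap.sub_apply] at this
  rw [this, sub_add_cancel, kron]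
  by_cases h : j = k
  · simp [h]
  · simp [h, sub_eq_zero]

theorem thetaMode_thetaMode (j k : ℤ) (x : Fock) :
    thetaMode j (thetaMode k x) + thetaMode k (thetaMode j x) = 0 := by
  unfold thetaMode
  split_ifs
  · exact create_create j k x
  · rw [add_comm, annihilate_create, kron, if_neg (by omega), zero_smul]
  · rw [annihilate_create, kron, if_neg (by omega), zero_smul]
  · exact annihilate_annihilate j k x

theorem pMode_pMode (j k : ℤ) (x : Fock) :
    pMode j (pMode k x) + pMode k (pMode j x) = 0 := by
  unfold pMode
  split_ifs
  · exact annihilate_annihilate _ _ x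
  · rw [annihilate_create, kron, if_neg (by omega), zero_smul]
  · rw [add_comm, annihilate_create, kron, if_neg (by omega), zero_smul]
  · exact create_create _ _ x

theorem pMode_thetaMode (j k : ℤ) (x : Fock) :
    pMode j (thetaMode k x) + thetaMode k (pMode j x) = kron (j + k) • x := by
  unfold pMode thetaMode
  split_ifs
  · rw [annihilate_create, show -j - k = -(j + k) by ring, kron_neg]
  · rw [annihilate_annihilate, kron, if_neg (by omega), zero_smul]
  · rw [create_create, kron, if_neg (by omega), zero_smul]
  · rw [add_comm, annihilate_create, sub_neg_eq_add, add_comm]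

theorem create_eq (k : ℤ) : create k = if 0 ≤ k then thetaMode k else pMode (-k) := by
  unfold pMode thetaMode
  split_ifs <;> first | omega | simp

theorem annihilate_eq (k : ℤ) : annihilate k = if 0 ≤ k then pMode (-k) else thetaMode k := by
  unfold pMode thetaMode
  split_ifs <;> first | omega | simp

theorem parity_thetaMode (k : ℤ) (x : Fock) :
    parity (thetaMode k x) + thetaMode k (parity x) = 0 := by
  have h1 := congrArg (fun f => f x) (parity_mul_create k)
  have h2 := congrArg (fun f => f x) (parity_mul_annihilate k)
  simp only [Module.End.mul_apply, LinearMap.neg_apply] at h1 h2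
  unfold thetaMode
  split_ifs
  · rw [h1, neg_add_cancel]
  · rw [h2, neg_add_cancel]

theorem parity_pMode (k : ℤ) (x : Fock) :
    parity (pMode k x) + pMode k (parity x) = 0 := by
  have h1 := congrArg (fun f => f x) (parity_mul_create (-k))
  have h2 := congrArg (fun f => f x) (parity_mul_annihilate (-k))
  simp only [Module.End.mul_apply, LinearMap.neg_apply] at h1 h2
  unfold pMode
  split_ifs
  · rw [h2, neg_add_cancel]
  · rw [h1, neg_add_cancel]

theorem smooth_thetaMode (x : Fock) : ∃ N : ℤ, ∀ n < N, thetaMode n x = 0 := by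
  obtain ⟨N, hN⟩ := annihilate_finite x
  refine ⟨min 0 (-N), fun n hn => ?_⟩
  rw [thetaMode, if_neg (by omega), hN n (by rw [lt_abs]; omega)]

theorem smooth_pMode (x : Fock) : ∃ N : ℤ, ∀ n < N, pMode n x = 0 := by
  obtain ⟨N, hN⟩ := annihilate_finite x
  refine ⟨min 0 (-N), fun n hn => ?_⟩
  rw [pMode, if_pos (by omega), hN (-n) (by rw [lt_abs]; omega)]

/-- The factor of `2 ^ charge` for the creation mode `k`. -/
noncomputable def scaleFactor (k : ℤ) : ℂ := if 0 ≤ k then 2 else 1 / 2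

theorem scaleFactor_of_nonneg {k : ℤ} (h : 0 ≤ k) : scaleFactor k = 2 := if_pos h

theorem scaleFactor_of_neg {k : ℤ} (h : k < 0) : scaleFactor k = 1 / 2 := if_neg (by omega)

/-- The operator `2 ^ charge`, where `θ_n` has charge `1` and `p_n` has charge `-1`. -/
noncomputable def scale : Module.End ℂ Fock :=
  (ExteriorAlgebra.map (Finsupp.linearCombination ℂ fun k : ℤ =>
    Finsupp.single k (scaleFactor k))).toLinearMap

theorem scale_one : scale 1 = 1 := map_one (ExteriorAlgebra.map _)

theorem scale_create (k : ℤ) (x : Fock) :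
    scale (create k x) = scaleFactor k • create k (scale x) := by
  simp only [scale, create_apply, AlgHom.toLinearMap_apply, map_mul, ExteriorAlgebra.map_apply_ι,
    Finsupp.linearCombination_single, one_smul]
  have : Finsupp.single k (scaleFactor k) = scaleFactor k • Finsupp.single k (1 : ℂ) := by simp
  rw [this, map_smul, smul_mul_assoc]

theorem scale_annihilate (k : ℤ) (x : Fock) :
    scaleFactor k • scale (annihilate k x) = annihilate k (scale x) := by
  have h (l : ℤ) (y : Fock) : annihilate k (create l y)
      = kron (k - l) • y - create l (annihilate k y) :=
    eq_sub_of_add_eq (annihilate_create k l y)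
  induction x using create_induction with
  | one => rw [annihilate_one, map_zero, smul_zero, scale_one, annihilate_one]
  | add x y hx hy => simp only [map_add, smul_add, hx, hy]
  | smul r x hx => simp only [map_smul, ← hx, smul_comm r]
  | create l x hx =>
    rw [h, map_sub, map_smul, scale_create, scale_create, map_smul, h, ← hx, map_smul, smul_sub,
      smul_sub]
    by_cases hl : k = l
    · subst hl; rw [smul_smul, smul_smul, mul_comm]
    · rw [kron, if_neg (by omega), smul_comm (scaleFactor k) (scaleFactor l)]
      simp

theorem vacuum_scale (x : Fock) : vacuum (scale x) = vacuum x := by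
  induction x using create_induction with
  | one => rw [scale_one]
  | add x y hx hy => simp only [map_add, hx, hy]
  | smul r x hx => simp only [map_smul, hx]
  | create l x hx => rw [scale_create, map_smul, vacuum_create, vacuum_create, smul_zero]

/-- The action of the fermions on an odd operator of the other tensor factor. -/
noncomputable def twist (d : ZMod 2) : Module.End ℂ Fock := if d = 0 then LinearMap.id else parity

theorem twist_one (x : Fock) : twist 1 x = parity x := rfl

theorem parity_parity (x : Fock) : parity (parity x) = x :=
  congrArg (fun f => f x) parity_mul_parity

theorem twist_twist (d e : ZMod 2) (x : Fock) : twist d (twist e x) = twist (d + e) x := by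
  rcases ZMod.two_cases d with rfl | rfl <;> rcases ZMod.two_cases e with rfl | rfl
  · rfl
  · rfl
  · rfl
  · exact parity_parity x

theorem parity_twist (d : ZMod 2) (x : Fock) : parity (twist d x) = twist d (parity x) := by
  rcases ZMod.two_cases d with rfl | rfl <;> rfl

theorem scale_twist (d : ZMod 2) (x : Fock) : scale (twist d x) = twist d (scale x) := by
  rcases ZMod.two_cases d with rfl | rfl
  · rfl
  · rw [twist_one, twist_one]
    have h (l : ℤ) (y : Fock) : parity (create l y) = -create l (parity y) :=
      congrArg (fun f => f y) (parity_mul_create l)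
    induction x using create_induction with
    | one => rw [parity_one, scale_one, parity_one]
    | add x y hx hy => simp only [map_add, hx, hy]
    | smul r x hx => simp only [map_smul, hx]
    | create l x hx => rw [h, map_neg, scale_create, scale_create, map_smul, h, hx, smul_neg]

theorem twist_thetaMode (d : ZMod 2) (k : ℤ) (x : Fock) :
    twist d (thetaMode k x) = sg d • thetaMode k (twist d x) := by
  rcases ZMod.two_cases d with rfl | rfl
  · rw [sg_zero, one_smul]; rfl
  · rw [sg_one, neg_one_smul]
    exact eq_neg_of_add_eq_zero_left (parity_thetaMode k x)

theorem twist_pMode (d : ZMod 2) (k : ℤ) (x : Fock) :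
    twist d (pMode k x) = sg d • pMode k (twist d x) := by
  rcases ZMod.two_cases d with rfl | rfl
  · rw [sg_zero, one_smul]; rfl
  · rw [sg_one, neg_one_smul]
    exact eq_neg_of_add_eq_zero_left (parity_pMode k x)

end Fock

/-! ### Vacuum vectors and rigidity on Fock ⊗ V -/

section FockTensor

variable {V : Type*} [AddCommGroup V] [Module ℂ V]

/-- Operators on `Fock ⊗ V` that agree on pure tensors are equal. -/
theorem fock_ext {A B : Module.End ℂ (Fock ⊗[ℂ] V)} (h : ∀ x v, A (x ⊗ₜ v) = B (x ⊗ₜ v)) :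
    A = B := TensorProduct.ext' h

theorem exists_bound {κ : Type*} {X : κ → ℤ → Module.End ℂ (Fock ⊗[ℂ] V)}
    (h : ∀ x v, ∃ N : ℤ, ∀ i, ∀ n < N, X i n (x ⊗ₜ v) = 0) (w : Fock ⊗[ℂ] V) :
    ∃ N : ℤ, ∀ i, ∀ n < N, X i n w = 0 := by
  induction w using TensorProduct.induction_on with
  | zero => exact ⟨0, fun i n _ => map_zero _⟩
  | tmul x v => exact h x v
  | add x y hx hy =>
    obtain ⟨M, hM⟩ := hx
    obtain ⟨N, hN⟩ := hy
    exact ⟨min M N, fun i n hn => by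
      rw [map_add, hM i n (by omega), hN i n (by omega), add_zero]⟩

theorem smooth_of_tmul {X : OpField (Fock ⊗[ℂ] V)}
    (h : ∀ x v, ∃ N : ℤ, ∀ n < N, X n (x ⊗ₜ v) = 0) : OpField.Smooth X := fun w => by
  obtain ⟨N, hN⟩ := exists_bound (κ := Unit) (X := fun _ => X)
    (fun x v => (h x v).imp fun N hN _ => hN) w
  exact ⟨N, hN ()⟩

/-- The vacuum component. -/
noncomputable def fockVacL (V : Type*) [AddCommGroup V] [Module ℂ V] : Fock ⊗[ℂ] V →ₗ[ℂ] V :=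
  (TensorProduct.lid ℂ V).toLinearMap ∘ₗ Fock.vacuum.rTensor V

theorem fockVacL_tmul (x : Fock) (v : V) : fockVacL V (x ⊗ₜ v) = Fock.vacuum x • v := rfl

/-- Expanding w along a basis of V reduces the claim to the Fock component of each basis vector,
where the number operator argument applies. V may be infinite-dimensional. -/
theorem eq_vacuum_of_annihilate_tensor (w : Fock ⊗[ℂ] V)
    (h : ∀ k, (Fock.annihilate k).rTensor V w = 0) : w = 1 ⊗ₜ fockVacL V w := by
  obtain ⟨b, rfl⟩ := TensorProduct.eq_repr_basis_right (Module.Basis.ofVectorSpace ℂ V) w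
  have hb (i) : b i = Fock.vacuum (b i) • 1 := by
    refine Fock.eq_vacuum_of_annihilate_eq_zero _ fun k => ?_
    have := TensorProduct.sum_tmul_basis_right_eq_zero (Module.Basis.ofVectorSpace ℂ V)
      (b.mapRange (Fock.annihilate k) (map_zero _)) (by
        rw [← h k, map_finsuppSum]
        exact Finsupp.sum_mapRange_index fun i => TensorProduct.zero_tmul Fock
          (Module.Basis.ofVectorSpace ℂ V i))
    simpa using congrArg (fun f => f i) this
  rw [map_finsuppSum, Finsupp.sum, Finsupp.sum, TensorProduct.tmul_sum]
  refine Finset.sum_congr rfl fun i _ => ?_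
  rw [fockVacL_tmul, TensorProduct.tmul_smul, TensorProduct.smul_tmul', ← hb]

/-- D maps 1 ⊗ v to a vector killed by all annihilation modes, hence to 1 ⊗ its own vacuum
component, which is zero; intertwining with the creation modes then gives zero everywhere. The
scalar r covers the commuting and the anticommuting case at once. -/
theorem eq_zero_of_fock {D : Module.End ℂ (Fock ⊗[ℂ] V)} {r : ℂ} (hr : r ≠ 0)
    (h1 : ∀ k w, D ((Fock.thetaMode k).rTensor V w) = r • (Fock.thetaMode k).rTensor V (D w))
    (h2 : ∀ k w, D ((Fock.pMode k).rTensor V w) = r • (Fock.pMode k).rTensor V (D w))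
    (h : ∀ v, fockVacL V (D (1 ⊗ₜ v)) = 0) : D = 0 := by
  have hc (k w) : D ((Fock.create k).rTensor V w) = r • (Fock.create k).rTensor V (D w) := by
    rw [Fock.create_eq]
    split_ifs
    exacts [h1 _ _, h2 _ _]
  have ha (k w) : D ((Fock.annihilate k).rTensor V w)
      = r • (Fock.annihilate k).rTensor V (D w) := by
    rw [Fock.annihilate_eq]
    split_ifs
    exacts [h2 _ _, h1 _ _]
  have h0 (v : V) : D (1 ⊗ₜ v) = 0 := by
    rw [eq_vacuum_of_annihilate_tensor (D (1 ⊗ₜ v)), h, TensorProduct.tmul_zero]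
    intro k
    have := ha k (1 ⊗ₜ v)
    rw [LinearMap.rTensor_tmul, Fock.annihilate_one, TensorProduct.zero_tmul, map_zero] at this
    exact (smul_eq_zero.mp this.symm).resolve_left hr
  refine fock_ext fun x v => ?_
  rw [LinearMap.zero_apply]
  induction x using Fock.create_induction with
  | one => exact h0 v
  | add x y hx hy => rw [TensorProduct.add_tmul, map_add, hx, hy, add_zero]
  | smul r x hx => rw [← TensorProduct.smul_tmul', map_smul, hx, smul_zero]
  | create k x hx =>
    have := hc k (x ⊗ₜ v)
    rwa [LinearMap.rTensor_tmul, hx, map_zero, smul_zero] at this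

end FockTensor

/-! ### The combined action on Fock ⊗ V -/

namespace VirGlModule

variable {c k₁ k₂ : ℂ} {V : Type*} [AddCommGroup V] [Module ℂ V] (M : VirGlModule c k₁ k₂ V)

/-- The parity twists on the Fock factor commute with each other and multiply by adding degrees, so
a graded commutator on V transfers with the total twist. -/
theorem sub_smul_map (d : ZMod 2) (A B : Module.End ℂ V) (r : ℂ) (e : ZMod 2) :
    TensorProduct.map (Fock.twist d) A * TensorProduct.map (Fock.twist e) B
      - r • (TensorProduct.map (Fock.twist e) B * TensorProduct.map (Fock.twist d) A)
    = TensorProduct.map (Fock.twist (d + e)) (A * B - r • (B * A)) := by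
  refine fock_ext fun x v => ?_
  simp only [LinearMap.sub_apply, LinearMap.smul_apply, Module.End.mul_apply,
    TensorProduct.map_tmul, Fock.twist_twist, add_comm e d, TensorProduct.tmul_sub,
    TensorProduct.tmul_smul]

/-- The modes of the current algebra on `Fock ⊗ V`. -/
noncomputable def tensorT (μ ν : ZMod 2) (n : ℤ) : Module.End ℂ (Fock ⊗[ℂ] V) :=
  TensorProduct.map (Fock.twist (μ + ν)) (M.T μ ν n)

theorem tensorT_tmul (μ ν : ZMod 2) (n : ℤ) (x : Fock) (v : V) :
    M.tensorT μ ν n (x ⊗ₜ v) = Fock.twist (μ + ν) x ⊗ₜ M.T μ ν n v := rfl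

theorem tensorT_tensorT (μ ν : ZMod 2) (m : ℤ) (σ τ : ZMod 2) (n : ℤ) :
    M.tensorT μ ν m * M.tensorT σ τ n
      - sg ((μ + ν) * (σ + τ)) • (M.tensorT σ τ n * M.tensorT μ ν m) =
      (if σ = ν then M.tensorT μ τ (m + n) else 0)
      - sg ((μ + ν) * (σ + τ)) • (if μ = τ then M.tensorT σ ν (m + n) else 0)
      + ((m : ℂ) * ((if μ = τ ∧ σ = ν then k₁ * sg μ else 0)
          + (if μ = ν ∧ σ = τ then k₂ * sg (μ + σ) else 0)) * kron (m + n)) •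
        (1 : Module.End ℂ (Fock ⊗[ℂ] V)) := by
  -- When an index is contracted it occurs twice and drops out of the total degree, so the twist is
  -- the one belonging to the resulting current. A central term occurs only in total degree zero,
  -- where the twist is trivial.
  have h2 : (2 : ZMod 2) = 0 := rfl
  have e1 : TensorProduct.map (Fock.twist (μ + ν + (σ + τ)))
      (if σ = ν then M.T μ τ (m + n) else 0) = if σ = ν then M.tensorT μ τ (m + n) else 0 := by
    split_ifs with h
    · rw [tensorT, h, show μ + ν + (ν + τ) = μ + τ by linear_combination ν * h2]
    · exact TensorProduct.map_zero_right _
  have e2 : TensorProduct.map (Fock.twist (μ + ν + (σ + τ)))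
      (if μ = τ then M.T σ ν (m + n) else 0) = if μ = τ then M.tensorT σ ν (m + n) else 0 := by
    split_ifs with h
    · rw [tensorT, h, show τ + ν + (σ + τ) = σ + ν by linear_combination τ * h2]
    · exact TensorProduct.map_zero_right _
  have e3 (r s t u : ℂ) : TensorProduct.map (Fock.twist (μ + ν + (σ + τ)))
      ((r * ((if μ = τ ∧ σ = ν then s else 0) + (if μ = ν ∧ σ = τ then t else 0)) * u) •
        (1 : Module.End ℂ V))
      = (r * ((if μ = τ ∧ σ = ν then s else 0) + (if μ = ν ∧ σ = τ then t else 0)) * u) •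
        (1 : Module.End ℂ (Fock ⊗[ℂ] V)) := by
    rw [TensorProduct.map_smul_right]
    by_cases h : μ + ν + (σ + τ) = 0
    · rw [h]
      congr 1
      exact TensorProduct.map_one
    · have h3 : ¬(μ = τ ∧ σ = ν) := fun h' => h (by
        rw [h'.1, h'.2]; linear_combination (τ + ν) * h2)
      have h4 : ¬(μ = ν ∧ σ = τ) := fun h' => h (by
        rw [h'.1, h'.2]; linear_combination (τ + ν) * h2)
      simp [h3, h4]
  have e4 (A B C : Module.End ℂ V) (d : ZMod 2) (r : ℂ) : TensorProduct.map (Fock.twist d)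
      (A - r • B + C) = TensorProduct.map (Fock.twist d) A - r • TensorProduct.map (Fock.twist d) B
        + TensorProduct.map (Fock.twist d) C := by
    refine fock_ext fun x v => ?_
    simp only [LinearMap.sub_apply, LinearMap.smul_apply, LinearMap.add_apply,
      TensorProduct.map_tmul, TensorProduct.tmul_sub, TensorProduct.tmul_smul,
      TensorProduct.tmul_add]
  rw [← e1, ← e2, ← e3, ← e4, ← M.T_T, ← sub_smul_map]
  rfl

/-- The fermionic modes, with the commuting action of the Virasoro and Kac-Moody algebras, on
`Fock ⊗ V`. -/
noncomputable def fermi : FermiModule c k₁ k₂ (Fock ⊗[ℂ] V) V where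
  par := M.parity
  L n := (M.L n).lTensor Fock
  T := M.tensorT
  -- The factor 1/i is that of the normalization of θ_m. The inverse factor on p preserves the
  -- canonical anticommutator and removes i from the mode formulas.
  ϑ n := (-Complex.I) • (Fock.thetaMode n).rTensor V
  ϖ n := Complex.I • (Fock.pMode n).rTensor V
  vac := TensorProduct.mk ℂ Fock V 1
  vacL := fockVacL V
  scale := Fock.scale.rTensor V
  par_par := by
    rw [parity, ← TensorProduct.map_mul, Fock.parity_mul_parity, M.par_par,
      TensorProduct.map_one]
  par_L n := fock_ext fun x v => by
    have := congrArg (fun f => f v) (M.par_L n)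
    simp only [Module.End.mul_apply] at this
    simp [parity, this]
  par_T μ ν n := fock_ext fun x v => by
    have := congrArg (fun f => f v) (M.par_T μ ν n)
    simp only [Module.End.mul_apply, LinearMap.smul_apply] at this
    simp [parity, tensorT_tmul, this, Fock.parity_twist]
  L_L m n := fock_ext fun x v => by
    have := congrArg (fun f => f v) (M.L_L m n)
    simp only [Module.End.mul_apply, LinearMap.smul_apply, LinearMap.sub_apply,
      Module.End.one_apply] at this
    simp only [Module.End.mul_apply, LinearMap.smul_apply, LinearMap.sub_apply,
      Module.End.one_apply, LinearMap.lTensor_tmul, ← TensorProduct.tmul_smul,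
      ← TensorProduct.tmul_sub, this]
  L_T m μ ν n := fock_ext fun x v => by
    have := congrArg (fun f => f v) (M.L_T m μ ν n)
    simp only [Module.End.mul_apply, LinearMap.smul_apply, LinearMap.sub_apply] at this
    simp only [Module.End.mul_apply, LinearMap.smul_apply, LinearMap.sub_apply,
      LinearMap.lTensor_tmul, tensorT_tmul, ← TensorProduct.tmul_smul,
      ← TensorProduct.tmul_sub, this]
  T_T := M.tensorT_tensorT
  smooth_L := smooth_of_tmul fun x v => (M.smooth_L v).imp fun N hN n hn => by
    rw [LinearMap.lTensor_tmul, hN n hn, TensorProduct.tmul_zero]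
  smooth_T w := by
    obtain ⟨N, hN⟩ := exists_bound (κ := ZMod 2 × ZMod 2) (X := fun i => M.tensorT i.1 i.2)
      (fun x v => (M.smooth_T v).imp fun N hN i n hn => by
        rw [tensorT_tmul, hN i.1 i.2 n hn, TensorProduct.tmul_zero]) w
    exact ⟨N, fun μ ν => hN (μ, ν)⟩
  ϑ_ϑ j k := fock_ext fun x v => by
    simp only [ac_apply, LinearMap.add_apply, Module.End.mul_apply, LinearMap.smul_apply, map_smul,
      LinearMap.rTensor_tmul, ← smul_add, ← TensorProduct.add_tmul, Fock.thetaMode_thetaMode,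
      TensorProduct.zero_tmul, smul_zero, LinearMap.zero_apply]
  ϖ_ϖ j k := fock_ext fun x v => by
    simp only [ac_apply, LinearMap.add_apply, Module.End.mul_apply, LinearMap.smul_apply, map_smul,
      LinearMap.rTensor_tmul, ← smul_add, ← TensorProduct.add_tmul, Fock.pMode_pMode,
      TensorProduct.zero_tmul, smul_zero, LinearMap.zero_apply]
  ϖ_ϑ j k := fock_ext fun x v => by
    simp only [ac_apply, LinearMap.add_apply, Module.End.mul_apply, LinearMap.smul_apply, map_smul,
      LinearMap.rTensor_tmul, smul_comm (-Complex.I) Complex.I, ← smul_add,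
      ← TensorProduct.add_tmul, Fock.pMode_thetaMode, smul_smul]
    simp [TensorProduct.smul_tmul']
  L_ϑ n k := cm_eq_zero.mpr <| fock_ext fun x v => by simp
  L_ϖ n k := cm_eq_zero.mpr <| fock_ext fun x v => by simp
  T_ϑ μ ν n k := fock_ext fun x v => by
    simp [tensorT_tmul, Fock.twist_thetaMode, TensorProduct.smul_tmul', smul_comm Complex.I]
  T_ϖ μ ν n k := fock_ext fun x v => by
    simp [tensorT_tmul, Fock.twist_pMode, TensorProduct.smul_tmul', smul_comm Complex.I]
  par_ϑ k := fock_ext fun x v => by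
    have := eq_neg_of_add_eq_zero_left (Fock.parity_thetaMode k x)
    simp [parity, this, TensorProduct.neg_tmul]
  par_ϖ k := fock_ext fun x v => by
    have := eq_neg_of_add_eq_zero_left (Fock.parity_pMode k x)
    simp [parity, this, TensorProduct.neg_tmul]
  smooth_ϑ := smooth_of_tmul fun x v => (Fock.smooth_thetaMode x).imp fun N hN n hn => by
    rw [LinearMap.smul_apply, LinearMap.rTensor_tmul, hN n hn, TensorProduct.zero_tmul, smul_zero]
  smooth_ϖ := smooth_of_tmul fun x v => (Fock.smooth_pMode x).imp fun N hN n hn => by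
    rw [LinearMap.smul_apply, LinearMap.rTensor_tmul, hN n hn, TensorProduct.zero_tmul, smul_zero]
  vacL_vac v := by
    rw [TensorProduct.mk_apply, fockVacL_tmul, Fock.vacuum_one, one_smul]
  ϑ_vac k hk v := by
    rw [TensorProduct.mk_apply, LinearMap.smul_apply, LinearMap.rTensor_tmul, Fock.thetaMode,
      if_neg (by omega), Fock.annihilate_one, TensorProduct.zero_tmul, smul_zero]
  ϖ_vac k hk v := by
    rw [TensorProduct.mk_apply, LinearMap.smul_apply, LinearMap.rTensor_tmul, Fock.pMode,
      if_pos hk, Fock.annihilate_one, TensorProduct.zero_tmul, smul_zero]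
  vacL_ϑ k hk w := by
    induction w using TensorProduct.induction_on with
    | zero => simp
    | tmul x v =>
      rw [LinearMap.smul_apply, LinearMap.rTensor_tmul, map_smul, fockVacL_tmul, Fock.thetaMode,
        if_pos hk, Fock.vacuum_create, zero_smul, smul_zero]
    | add x y hx hy => rw [map_add, map_add, hx, hy, add_zero]
  vacL_ϖ k hk w := by
    induction w using TensorProduct.induction_on with
    | zero => simp
    | tmul x v =>
      rw [LinearMap.smul_apply, LinearMap.rTensor_tmul, map_smul, fockVacL_tmul, Fock.pMode,
        if_neg (by omega), Fock.vacuum_create, zero_smul, smul_zero]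
    | add x y hx hy => rw [map_add, map_add, hx, hy, add_zero]
  scale_vac v := by
    rw [TensorProduct.mk_apply, LinearMap.rTensor_tmul, Fock.scale_one]
  vacL_scale w := by
    induction w using TensorProduct.induction_on with
    | zero => simp
    | tmul x v => rw [LinearMap.rTensor_tmul, fockVacL_tmul, fockVacL_tmul, Fock.vacuum_scale]
    | add x y hx hy => rw [map_add, map_add, map_add, hx, hy]
  scale_ϑ k := fock_ext fun x v => by
    have : Fock.scale (Fock.thetaMode k x) = (2 : ℂ) • Fock.thetaMode k (Fock.scale x) := by
      unfold Fock.thetaMode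
      split_ifs with h
      · rw [Fock.scale_create, Fock.scaleFactor_of_nonneg h]
      · rw [← Fock.scale_annihilate, Fock.scaleFactor_of_neg (by omega), smul_smul]
        norm_num
    simp only [Module.End.mul_apply, LinearMap.smul_apply, map_smul, LinearMap.rTensor_tmul, this,
      ← TensorProduct.smul_tmul', smul_comm (-Complex.I)]
  scale_ϖ k := fock_ext fun x v => by
    have : (2 : ℂ) • Fock.scale (Fock.pMode k x) = Fock.pMode k (Fock.scale x) := by
      unfold Fock.pMode
      split_ifs with h
      · rw [← Fock.scale_annihilate, Fock.scaleFactor_of_nonneg (by omega)]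
      · rw [Fock.scale_create, Fock.scaleFactor_of_neg (by omega), smul_smul]
        norm_num
    simp only [Module.End.mul_apply, LinearMap.smul_apply, map_smul, LinearMap.rTensor_tmul,
      ← this, ← TensorProduct.smul_tmul', smul_comm (Complex.I)]
  scale_L k := fock_ext fun x v => by simp
  scale_T μ ν k := fock_ext fun x v => by simp [tensorT_tmul, Fock.scale_twist]
  eq_zero_of_cm D h1 h2 h := by
    refine eq_zero_of_fock one_ne_zero (fun k w => ?_) (fun k w => ?_) h
    · have := congrArg (fun f => f w) (cm_eq_zero.mp (h1 k))
      simpa using this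
    · have := congrArg (fun f => f w) (cm_eq_zero.mp (h2 k))
      simpa using this
  eq_zero_of_ac D h1 h2 h := by
    refine eq_zero_of_fock (neg_ne_zero.mpr one_ne_zero) (fun k w => ?_) (fun k w => ?_) h
    · have := apply_eq_of_ac_eq_zero (h1 k) w
      rw [LinearMap.smul_apply, LinearMap.smul_apply, map_smul, smul_comm (-1 : ℂ)] at this
      exact smul_right_injective _ (neg_ne_zero.mpr Complex.I_ne_zero) this
    · have := apply_eq_of_ac_eq_zero (h2 k) w
      rw [LinearMap.smul_apply, LinearMap.smul_apply, map_smul, smul_comm (-1 : ℂ)] at this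
      exact smul_right_injective _ Complex.I_ne_zero this

end VirGlModule

namespace FermiModule

variable {c k₁ k₂ : ℂ} {W V : Type*} [AddCommGroup W] [Module ℂ W] [AddCommGroup V] [Module ℂ V]
  (S : FermiModule c k₁ k₂ W V)

/-! #### Parity -/

/-- The operator `A` is of degree `d`. -/
def HasParity (d : ZMod 2) (A : Module.End ℂ W) : Prop := S.par * A = sg d • (A * S.par)

variable {S}

theorem HasParity.mul {d e f : ZMod 2} {A B : Module.End ℂ W} (hA : S.HasParity d A)
    (hB : S.HasParity e B) (hf : d + e = f) : S.HasParity f (A * B) := by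
  unfold HasParity at *
  rw [← mul_assoc, hA, smul_mul_assoc, mul_assoc, hB, mul_smul_comm, smul_smul, ← mul_assoc, ← hf]
  congr 1
  rcases ZMod.two_cases d with rfl | rfl <;> rcases ZMod.two_cases e with rfl | rfl <;>
    simp [sg, show (1 : ZMod 2) + 1 = 0 from rfl]

theorem HasParity.smul {d : ZMod 2} {A : Module.End ℂ W} (hA : S.HasParity d A) (r : ℂ) :
    S.HasParity d (r • A) := by
  unfold HasParity at *
  rw [mul_smul_comm, hA, smul_mul_assoc, smul_comm]

theorem HasParity.add {d : ZMod 2} {A B : Module.End ℂ W} (hA : S.HasParity d A)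
    (hB : S.HasParity d B) : S.HasParity d (A + B) := by
  unfold HasParity at *
  rw [mul_add, hA, hB, add_mul, smul_add]

theorem HasParity.neg {d : ZMod 2} {A : Module.End ℂ W} (hA : S.HasParity d A) :
    S.HasParity d (-A) := by
  simpa using hA.smul (-1)

theorem HasParity.sub {d : ZMod 2} {A B : Module.End ℂ W} (hA : S.HasParity d A)
    (hB : S.HasParity d B) : S.HasParity d (A - B) := by
  rw [sub_eq_add_neg]
  exact hA.add hB.neg

theorem HasParity.locSum {ι : Type*} {d : ZMod 2} {A : ι → Module.End ℂ W} (hA : LocFinite A)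
    (h : ∀ i, S.HasParity d (A i)) : S.HasParity d (_root_.locSum A) :=
  locSum_semiconj hA _ _ h

variable (S)

theorem hasParity_one : S.HasParity 0 1 := by simp [HasParity, sg_zero]

theorem hasParity_ϑ (k : ℤ) : S.HasParity 1 (S.ϑ k) := by
  rw [HasParity, S.par_ϑ, sg_one, neg_one_smul]

theorem hasParity_ϖ (k : ℤ) : S.HasParity 1 (S.ϖ k) := by
  rw [HasParity, S.par_ϖ, sg_one, neg_one_smul]

theorem hasParity_L (k : ℤ) : S.HasParity 0 (S.L k) := by
  rw [HasParity, S.par_L, sg_zero, one_smul]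

theorem hasParity_T (μ ν : ZMod 2) (k : ℤ) : S.HasParity (μ + ν) (S.T μ ν k) := S.par_T μ ν k

theorem hasParity_Q (f : ℤ → ℂ) (s : ℤ) : S.HasParity 0 (S.Q f s) :=
  .locSum (S.locFinite_Q f s) fun _ => ((S.hasParity_ϑ _).mul (S.hasParity_ϑ _) rfl).smul _

theorem hasParity_U (s : ℤ) : S.HasParity 0 (S.U s) := S.hasParity_Q _ s

theorem hasParity_V (s : ℤ) : S.HasParity 0 (S.V' s) := S.hasParity_Q _ s

theorem hasParity_W (m : ℤ) : S.HasParity 1 (S.Wop m) :=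
  (HasParity.locSum (S.locFinite_W m) fun _ =>
    (S.hasParity_V _).mul (S.hasParity_ϑ _) (zero_add 1)).neg

theorem hasParity_C (m : ℤ) : S.HasParity 1 (S.C m) :=
  .locSum (S.locFinite_C m) fun j => by
    split_ifs
    · exact (S.hasParity_U _).mul (S.hasParity_ϖ _) (zero_add 1)
    · exact (S.hasParity_ϖ _).mul (S.hasParity_U _) (add_zero 1)

theorem hasParity_N (f : ℤ → ℂ) (s : ℤ) : S.HasParity 0 (S.N f s) :=
  .locSum (S.locFinite_N f s) fun j => by
    refine HasParity.smul ?_ _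
    unfold nop
    split_ifs
    · exact (S.hasParity_ϑ _).mul (S.hasParity_ϖ _) rfl
    · exact ((S.hasParity_ϖ _).mul (S.hasParity_ϑ _) rfl).neg

theorem hasParity_ϑL (s : ℤ) : S.HasParity 1 (S.ϑX S.L s) :=
  .locSum (S.locFinite_ϑL s) fun _ => (S.hasParity_ϑ _).mul (S.hasParity_L _) (add_zero 1)

theorem hasParity_ϑT (μ ν : ZMod 2) (s : ℤ) : S.HasParity (1 + (μ + ν)) (S.ϑX (S.T μ ν) s) :=
  .locSum (S.locFinite_ϑT μ ν s) fun _ => (S.hasParity_ϑ _).mul (S.hasParity_T μ ν _) rfl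

theorem hasParity_Lop (m : ℤ) : S.HasParity 0 (S.Lop m) :=
  (((((S.hasParity_N _ m).add ((S.hasParity_N _ m).smul _)).add (S.hasParity_L m)).add
    ((S.hasParity_T 0 0 m).smul _)).add ((S.hasParity_T 1 1 m).smul _)).add
    ((S.hasParity_ϑT 0 1 m).smul _)

theorem hasParity_Gop (m : ℤ) : S.HasParity 1 (S.Gop m) :=
  (((((S.hasParity_C m).sub (S.hasParity_ϖ m)).sub (S.hasParity_ϑL m)).sub
    ((S.hasParity_ϑT 0 0 m).smul _)).sub ((S.hasParity_T 0 1 m).smul _)).sub (S.hasParity_T 1 0 m)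

/-! #### The representation -/

/-- The operators that represent the basis vectors. -/
noncomputable def genOp : XscIdx → Module.End ℂ W
  | .L m => S.Lop m
  | .G m => S.Gop m
  | .θ m => S.ϑ m
  | .U m => S.U m
  | .V m => S.V' m
  | .W m => S.Wop m
  | .one => 1

theorem hasParity_genOp (k : XscIdx) : S.HasParity k.deg (S.genOp k) := by
  cases k with
  | L m => exact S.hasParity_Lop m
  | G m => exact S.hasParity_Gop m
  | θ m => exact S.hasParity_ϑ m
  | U m => exact S.hasParity_U m
  | V m => exact S.hasParity_V m
  | W m => exact S.hasParity_W m
  | one => exact S.hasParity_one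

/-- The linear map with these values on the basis vectors. -/
noncomputable def genRep : Xsc →ₗ[ℂ] Module.End ℂ W := Finsupp.linearCombination ℂ S.genOp

theorem genRep_el (k : XscIdx) : S.genRep (Xsc.el k) = S.genOp k := by
  simp [genRep, Xsc.el]

/-- The graded commutator of the operators for `j` and `k` is given by the bracket table. -/
def Respects (j k : XscIdx) : Prop :=
  S.genRep (Xsc.table (fockParams c k₁ k₂) j k)
    = S.genOp j * S.genOp k - sg (j.deg * k.deg) • (S.genOp k * S.genOp j)

variable {S}

theorem Respects.symm {j k : XscIdx} (h : S.Respects j k) : S.Respects k j := by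
  unfold Respects at *
  rw [Xsc.table_skew, map_neg, map_smul, h, smul_sub, smul_smul, mul_comm k.deg, sg_mul_self,
    one_smul, neg_sub]

theorem respects_of_cm {j k : XscIdx} (h0 : j.deg * k.deg = 0)
    (h : S.genRep (Xsc.table (fockParams c k₁ k₂) j k) = cm (S.genOp j) (S.genOp k)) :
    S.Respects j k := by
  rw [Respects, h, h0, sg_zero, one_smul, cm_apply]

theorem respects_of_ac {j k : XscIdx} (h1 : j.deg * k.deg = 1)
    (h : S.genRep (Xsc.table (fockParams c k₁ k₂) j k) = ac (S.genOp j) (S.genOp k)) :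
    S.Respects j k := by
  rw [Respects, h, h1, sg_one, neg_one_smul, ac_apply, sub_neg_eq_add]

variable (S)

theorem respects_L (m : ℤ) (k : XscIdx) : S.Respects (.L m) k := by
  refine respects_of_cm (zero_mul _) ?_
  cases k with
  | L n =>
    simp only [Xsc.table_L_L, map_add, map_smul, genRep_el, genOp, cm_Lop_Lop, fockParams]
  | G n =>
    simp only [Xsc.table_L_G, map_add, map_smul, genRep_el, genOp, cm_Lop_Gop, thetaCoeff]
  | θ n => simp only [Xsc.table_L_θ, map_smul, genRep_el, genOp, cm_Lop_ϑ]
  | U n => simp only [Xsc.table_L_U, map_smul, genRep_el, genOp, cm_Lop_U]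
  | V n => simp only [Xsc.table_L_V, map_add, map_smul, genRep_el, genOp, cm_Lop_V]
  | W n => simp only [Xsc.table_L_W, map_smul, genRep_el, genOp, cm_Lop_W]
  | one => rw [Xsc.table_one_right, map_zero, genOp, genOp, cm_one_right]

theorem respects_G (m : ℤ) (k : XscIdx) : S.Respects (.G m) k := by
  cases k with
  | L n => exact (S.respects_L n _).symm
  | G n =>
    refine respects_of_ac rfl ?_
    -- In the realization 2γ' = a', so the constant part of the central term cancels and only 2k₁m²
    -- remains.
    have e : (fockParams c k₁ k₂).b * (m : ℂ) ^ 2 + 2 * (fockParams c k₁ k₂).γ'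
        - (fockParams c k₁ k₂).a' = 2 * k₁ * (m : ℂ) ^ 2 := by
      simp only [fockParams]; ring
    simp only [Xsc.table_G_G, map_add, map_smul, genRep_el, genOp, ac_Gop_Gop, uCoeff, e]
  | θ n =>
    exact respects_of_ac rfl (by
      simp only [Xsc.table_G_θ, map_add, map_neg, map_smul, genRep_el, genOp, ac_Gop_ϑ])
  | U n =>
    exact respects_of_cm rfl (by
      simp only [Xsc.table_G_U, map_smul, genRep_el, genOp, cm_Gop_U])
  | V n =>
    exact respects_of_cm rfl (by
      simp only [Xsc.table_G_V, map_add, map_smul, genRep_el, genOp, cm_Gop_V])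
  | W n =>
    exact respects_of_ac rfl (by
      simp only [Xsc.table_G_W, map_sub, map_smul, genRep_el, genOp, ac_Gop_W])
  | one =>
    exact respects_of_cm rfl (by rw [Xsc.table_one_right, map_zero, genOp, genOp, cm_one_right])

theorem respects_one (k : XscIdx) : S.Respects .one k :=
  respects_of_cm (zero_mul _) (by rw [Xsc.table_one_left, map_zero, genOp, cm_one_left])

theorem respects_tail {j k : XscIdx} (hj : Xsc.IsTail j) (hk : Xsc.IsTail k)
    (h : S.genOp j * S.genOp k = sg (j.deg * k.deg) • (S.genOp k * S.genOp j)) :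
    S.Respects j k := by
  rw [Respects, Xsc.table_tail _ hj hk, map_zero, h, sub_self]

theorem respects_tail_cm {j k : XscIdx} (hj : Xsc.IsTail j) (hk : Xsc.IsTail k)
    (hd : j.deg * k.deg = 0) (h : cm (S.genOp j) (S.genOp k) = 0) : S.Respects j k :=
  S.respects_tail hj hk (by rw [hd, sg_zero, one_smul, cm_eq_zero.mp h])

theorem respects_tail_ac {j k : XscIdx} (hj : Xsc.IsTail j) (hk : Xsc.IsTail k)
    (hd : j.deg * k.deg = 1) (h : ac (S.genOp j) (S.genOp k) = 0) : S.Respects j k :=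
  S.respects_tail hj hk (by rw [hd, sg_one, neg_one_smul, ac_eq_zero.mp h])

theorem respects_U (m : ℤ) (k : XscIdx) : S.Respects (.U m) k := by
  cases k with
  | L n => exact (S.respects_L n _).symm
  | G n => exact (S.respects_G n _).symm
  | θ n => exact S.respects_tail_cm trivial trivial rfl (S.cm_U_ϑ m n)
  | U n => exact S.respects_tail_cm trivial trivial rfl (S.cm_U_U m n)
  | V n => exact S.respects_tail_cm trivial trivial rfl (S.cm_U_V m n)
  | W n => exact S.respects_tail_cm trivial trivial rfl (S.cm_U_W m n)
  | one => exact (S.respects_one _).symm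

theorem respects_V (m : ℤ) (k : XscIdx) : S.Respects (.V m) k := by
  cases k with
  | L n => exact (S.respects_L n _).symm
  | G n => exact (S.respects_G n _).symm
  | θ n => exact S.respects_tail_cm trivial trivial rfl (S.cm_V_ϑ m n)
  | U n => exact (S.respects_U n _).symm
  | V n => exact S.respects_tail_cm trivial trivial rfl (S.cm_V_V m n)
  | W n => exact S.respects_tail_cm trivial trivial rfl (S.cm_V_W m n)
  | one => exact (S.respects_one _).symm

theorem respects_W (m : ℤ) (k : XscIdx) : S.Respects (.W m) k := by
  cases k with
  | L n => exact (S.respects_L n _).symm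
  | G n => exact (S.respects_G n _).symm
  | θ n => exact S.respects_tail_ac trivial trivial rfl (S.ac_W_ϑ m n)
  | U n => exact (S.respects_U n _).symm
  | V n => exact (S.respects_V n _).symm
  | W n => exact S.respects_tail_ac trivial trivial rfl (S.ac_W_W m n)
  | one => exact (S.respects_one _).symm

theorem respects_θ (m : ℤ) (k : XscIdx) : S.Respects (.θ m) k := by
  cases k with
  | L n => exact (S.respects_L n _).symm
  | G n => exact (S.respects_G n _).symm
  | θ n => exact S.respects_tail_ac trivial trivial rfl (S.ϑ_ϑ m n)
  | U n => exact (S.respects_U n _).symm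
  | V n => exact (S.respects_V n _).symm
  | W n => exact (S.respects_W n _).symm
  | one => exact (S.respects_one _).symm

theorem respects (j k : XscIdx) : S.Respects j k := by
  cases j with
  | L m => exact S.respects_L m k
  | G m => exact S.respects_G m k
  | θ m => exact S.respects_θ m k
  | U m => exact S.respects_U m k
  | V m => exact S.respects_V m k
  | W m => exact S.respects_W m k
  | one => exact S.respects_one k

theorem genRep_isSuperRep :
    IsSuperRep Xsc.part (Xsc.bracket (fockParams c k₁ k₂)) S.par S.genRep :=
  isSuperRep_of_basis XscIdx.deg (Xsc.table (fockParams c k₁ k₂)) S.par S.genRep S.par_par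
    (fun k => by
      have := S.genRep_el k
      unfold Xsc.el at this
      rw [this]
      exact S.hasParity_genOp k)
    (fun j k => by
      have hj := S.genRep_el j
      have hk := S.genRep_el k
      unfold Xsc.el at hj hk
      rw [hj, hk]
      exact S.respects j k)

end FermiModule

/-! ### Fields -/

section FieldAlgebra

variable {W : Type*} [AddCommGroup W] [Module ℂ W]

namespace OpField

theorem fourier_apply (X : OpField W) (m : ℤ) : X.fourier m = (2 * (Real.pi : ℂ)) • X m := rfl

/-- The field `e^{imt} X(t)`. -/
def shift (m : ℤ) (X : OpField W) : OpField W := fun n => X (n + m)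

/-- The constant field. -/
def unit (W : Type*) [AddCommGroup W] [Module ℂ W] : OpField W := fun n => kron n • 1

theorem fourier_shift (m : ℤ) (X : OpField W) : (shift m X).fourier 0 = X.fourier m := by
  simp only [fourier_apply, shift, zero_add]

theorem MulDefined.shift_left {X Y : OpField W} (h : MulDefined X Y) (m : ℤ) :
    MulDefined (shift m X) Y := fun n => by
  have := (h (n + m)).comp_equiv (Equiv.addRight m)
  simpa only [shift, Equiv.coe_addRight, show ∀ j, n + m - (j + m) = n - j by intro j; ring]
    using this

theorem mul_shift_left {X Y : OpField W} (h : MulDefined X Y) (m : ℤ) :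
    mul (shift m X) Y = shift m (mul X Y) := by
  funext n
  simp only [shift, mul]
  rw [← locSum_shift (h (n + m)) m]
  simp only [show ∀ j, n + m - (j + m) = n - j by intro j; ring]

theorem mul_shift_right (X Y : OpField W) (m : ℤ) :
    mul X (shift m Y) = shift m (mul X Y) := by
  funext n
  simp only [shift, mul, show ∀ j, n + m - j = n - j + m by intro j; ring]

theorem MulDefined.add {X X' Y : OpField W} (h : MulDefined X Y) (h' : MulDefined X' Y) :
    MulDefined (X + X') Y := fun n => by
  simpa only [Pi.add_apply, add_mul] using (h n).add (h' n)

theorem MulDefined.smul {X Y : OpField W} (h : MulDefined X Y) (r : ℂ) :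
    MulDefined (r • X) Y := fun n => by
  simpa only [Pi.smul_apply, smul_mul_assoc] using (h n).smul fun _ => r

theorem MulDefined.add_right {X Y Y' : OpField W} (h : MulDefined X Y) (h' : MulDefined X Y') :
    MulDefined X (Y + Y') := fun n => by
  simpa only [Pi.add_apply, mul_add] using (h n).add (h' n)

theorem MulDefined.smul_right {X Y : OpField W} (h : MulDefined X Y) (r : ℂ) :
    MulDefined X (r • Y) := fun n => by
  simpa only [Pi.smul_apply, mul_smul_comm] using (h n).smul fun _ => r

theorem add_mul {X X' Y : OpField W} (h : MulDefined X Y) (h' : MulDefined X' Y) :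
    mul (X + X') Y = mul X Y + mul X' Y := by
  funext n
  simp only [mul, Pi.add_apply, _root_.add_mul]
  exact locSum_add (h n) (h' n)

theorem smul_mul {X Y : OpField W} (h : MulDefined X Y) (r : ℂ) :
    mul (r • X) Y = r • mul X Y := by
  funext n
  simp only [mul, Pi.smul_apply, smul_mul_assoc]
  exact locSum_smul (h n) r

theorem mul_add {X Y Y' : OpField W} (h : MulDefined X Y) (h' : MulDefined X Y') :
    mul X (Y + Y') = mul X Y + mul X Y' := by
  funext n
  simp only [mul, Pi.add_apply, _root_.mul_add]
  exact locSum_add (h n) (h' n)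

theorem mul_smul {X Y : OpField W} (h : MulDefined X Y) (r : ℂ) :
    mul X (r • Y) = r • mul X Y := by
  funext n
  simp only [mul, Pi.smul_apply, mul_smul_comm]
  exact locSum_smul (h n) r

theorem mulDefined_unit_left (X : OpField W) : MulDefined (unit W) X := fun n =>
  .of_single 0 fun j hj => by simp [unit, FermiModule.kron_of_ne hj]

theorem unit_mul (X : OpField W) : mul (unit W) X = X := by
  funext n
  rw [mul, locSum_eq_single 0 fun j hj => by simp [unit, FermiModule.kron_of_ne hj]]
  simp [unit, FermiModule.kron_zero]

theorem mulDefined_unit_right (X : OpField W) : MulDefined X (unit W) := fun n =>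
  .of_single n fun j hj => by simp [unit, FermiModule.kron_of_ne (sub_ne_zero.mpr hj.symm)]

theorem mul_unit (X : OpField W) : mul X (unit W) = X := by
  funext n
  rw [mul, locSum_eq_single n fun j hj => by
    simp [unit, FermiModule.kron_of_ne (sub_ne_zero.mpr hj.symm)]]
  simp [unit, FermiModule.kron_zero]

theorem neg_add_pos (p : OpField W) : p.neg + p.pos = p := by
  funext n
  simp only [Pi.add_apply, neg, pos]
  by_cases h : n ≤ 0
  · simp [h, not_lt.mpr h]
  · simp [h, not_le.mp h]

theorem smul_neg_part (r : ℂ) (p : OpField W) : neg (r • p) = r • neg p := by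
  funext n
  simp only [neg, Pi.smul_apply]
  split_ifs <;> simp

theorem smul_pos_part (r : ℂ) (p : OpField W) : pos (r • p) = r • pos p := by
  funext n
  simp only [pos, Pi.smul_apply]
  split_ifs <;> simp

/-- The two products in a normal ordered product with `p` are locally finite. -/
def NormalDefined (X p : OpField W) : Prop := MulDefined X p.neg ∧ MulDefined p.pos X

theorem Smooth.normalDefined {X p : OpField W} (hX : Smooth X) (hp : Smooth p) :
    NormalDefined X p :=
  ⟨(hX.absorbs_neg hp).mulDefined hp.neg_part, (absorbs_pos p X).mulDefined hX⟩

theorem normal_shift {X p : OpField W} (h : NormalDefined X p) (d : ZMod 2) (m : ℤ) :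
    normal d (shift m X) p = shift m (normal d X p) := by
  rw [normal, mul_shift_left h.1, mul_shift_right]
  rfl

theorem normal_add {X Y p : OpField W} (hX : NormalDefined X p) (hY : NormalDefined Y p)
    (d : ZMod 2) : normal d (X + Y) p = normal d X p + normal d Y p := by
  simp only [normal, add_mul hX.1 hY.1, mul_add hX.2 hY.2]
  module

theorem normal_smul {X p : OpField W} (h : NormalDefined X p) (d : ZMod 2) (r : ℂ) :
    normal d (r • X) p = r • normal d X p := by
  simp only [normal, smul_mul h.1, mul_smul h.2]
  module

theorem normal_smul_right {X p : OpField W} (h : NormalDefined X p) (d : ZMod 2) (r : ℂ) :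
    normal d X (r • p) = r • normal d X p := by
  simp only [normal, smul_neg_part, smul_pos_part, smul_mul h.2, mul_smul h.1]
  module

theorem normal_unit (p : OpField W) : normal 0 (unit W) p = p := by
  rw [normal, unit_mul, mul_unit, sg_zero, one_smul, neg_add_pos]

theorem normalDefined_unit (p : OpField W) : NormalDefined (unit W) p :=
  ⟨mulDefined_unit_left _, mulDefined_unit_right _⟩

theorem NormalDefined.add {X Y p : OpField W} (hX : NormalDefined X p)
    (hY : NormalDefined Y p) : NormalDefined (X + Y) p :=
  ⟨hX.1.add hY.1, hX.2.add_right hY.2⟩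

theorem NormalDefined.smul {X p : OpField W} (h : NormalDefined X p) (r : ℂ) :
    NormalDefined (r • X) p :=
  ⟨h.1.smul r, h.2.smul_right r⟩

/-- Reflecting the index in the second product labels both by the mode of X. The supports of the two
parts of p are complementary, so a single sum with a case distinction results, as in `nop` and `C`.
-/
theorem normal_apply {X p : OpField W} (h : NormalDefined X p) (d : ZMod 2) (n : ℤ) :
    normal d X p n = locSum fun j =>
      if n - j ≤ 0 then X j * p (n - j) else sg d • (p (n - j) * X j) := by
  have e1 (j : ℤ) : n - (n - j) = j := by ring
  have h2 : LocFinite fun j => p.pos (n - j) * X j := by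
    have := (h.2 n).comp_equiv (Equiv.subLeft n)
    simpa only [Equiv.subLeft_apply, e1] using this
  have e2 : p.pos.mul X n = locSum fun j => p.pos (n - j) * X j := by
    rw [mul, ← locSum_reflect (h.2 n) n]
    simp only [e1]
  rw [normal, Pi.add_apply, Pi.smul_apply, e2, ← locSum_smul h2, mul, ← locSum_add (h.1 n)
    (h2.smul _)]
  congr 1
  funext j
  by_cases h : n - j ≤ 0
  · rw [neg, pos, if_pos h, if_neg (not_lt.mpr h), if_pos h, zero_mul, smul_zero, add_zero]
  · rw [neg, pos, if_neg h, if_pos (not_le.mp h), if_neg h, mul_zero, zero_add]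

theorem Absorbs.coeff_left {X Y : OpField W} (h : Absorbs X Y) (f : ℤ → ℂ) :
    Absorbs (fun n => f n • X n) Y := fun w => (h w).imp fun N hN n hn k => by
  rw [LinearMap.smul_apply, hN n hn k, smul_zero]

theorem Absorbs.coeff_right {X Y : OpField W} (h : Absorbs X Y) (f : ℤ → ℂ) :
    Absorbs X (fun n => f n • Y n) := fun w => (h w).imp fun N hN n hn k => by
  rw [LinearMap.smul_apply, map_smul, hN n hn k, smul_zero]

theorem Absorbs.add {X X' Y : OpField W} (h : Absorbs X Y) (h' : Absorbs X' Y) :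
    Absorbs (X + X') Y := fun w => by
  obtain ⟨M, hM⟩ := h w
  obtain ⟨N, hN⟩ := h' w
  refine ⟨min M N, fun n hn k => ?_⟩
  rw [Pi.add_apply, LinearMap.add_apply, hM n (by omega) k, hN n (by omega) k, add_zero]

theorem Absorbs.shift {X Y : OpField W} (h : Absorbs X Y) (m : ℤ) : Absorbs (shift m X) Y :=
  fun w => by
    obtain ⟨M, hM⟩ := h w
    exact ⟨M - m, fun n hn k => hM (n + m) (by omega) k⟩

theorem absorbs_one_iff {X : OpField W} : Absorbs X (fun _ => 1) ↔ Smooth X :=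
  ⟨fun h w => (h w).imp fun _ hN n hn => hN n hn 0, fun h w => (h w).imp fun _ hN n hn _ => hN n hn⟩

theorem absorbs_unit (Y : OpField W) : Absorbs (unit W) Y := fun _ =>
  ⟨0, fun n hn k => by simp [unit, FermiModule.kron_of_ne hn.ne]⟩

end OpField

end FieldAlgebra

namespace FermiModule

variable {c k₁ k₂ : ℂ} {W V : Type*} [AddCommGroup W] [Module ℂ W] [AddCommGroup V] [Module ℂ V]
  (S : FermiModule c k₁ k₂ W V)

theorem mulDefined_ϑL : OpField.MulDefined S.ϑ S.L := S.locFinite_ϑL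

theorem mulDefined_ϑT (μ ν : ZMod 2) : OpField.MulDefined S.ϑ (S.T μ ν) := S.locFinite_ϑT μ ν

theorem normal_ϑ (f : ℤ → ℂ) (n : ℤ) :
    OpField.normal 1 (fun j => f j • S.ϑ j) S.ϖ n = S.N f n := by
  rw [OpField.normal_apply ((S.smooth_ϑ.smul f).normalDefined S.smooth_ϖ), N]
  congr 1
  funext j
  rw [nop, sg_one]
  split_ifs
  · rw [smul_mul_assoc]
  · rw [mul_smul_comm, neg_one_smul, smul_neg]

theorem normal_U (n : ℤ) : OpField.normal 0 S.U S.ϖ n = S.C n := by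
  rw [OpField.normal_apply (S.smooth_U.normalDefined S.smooth_ϖ), C]
  simp only [sg_zero, one_smul]

theorem mul_V_ϑ : OpField.mul (Complex.I • S.V') (Complex.I • S.ϑ) = S.Wop := by
  funext n
  rw [OpField.mul, Wop, ← neg_one_smul ℂ, ← locSum_smul (S.locFinite_W n)]
  simp only [Pi.smul_apply, smul_mul_assoc, mul_smul_comm, smul_smul, Complex.I_mul_I]

theorem mul_dot_ϑ_ϑ :
    OpField.mul (fun j : ℤ => (j : ℂ) • S.ϑ j) (Complex.I • S.ϑ) = Complex.I • S.U := by
  funext n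
  rw [OpField.mul, Pi.smul_apply, U, Q, ← locSum_smul (S.locFinite_Q _ n)]
  simp only [Pi.smul_apply, smul_mul_assoc, mul_smul_comm, smul_comm Complex.I]

/-- The modes of θ anticommute without a scalar, so reversing the product costs only a sign after
reflecting the summation index; no ordering correction appears. -/
theorem mul_ϑ_dot_ϑ :
    OpField.mul (Complex.I • S.ϑ) (fun j : ℤ => (j : ℂ) • S.ϑ j) = -(Complex.I • S.U) := by
  rw [← mul_dot_ϑ_ϑ]
  funext n
  have h : OpField.MulDefined (fun j : ℤ => (j : ℂ) • S.ϑ j) (Complex.I • S.ϑ) :=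
    ((S.absorbs_ϑ_ϑ.coeff_left _).coeff_right _).mulDefined (S.smooth_ϑ.smul _)
  have h' : LocFinite fun i => (fun j : ℤ => (j : ℂ) • S.ϑ j) (n - i)
      * (Complex.I • S.ϑ) (n - (n - i)) := (h n).comp_equiv (Equiv.subLeft n)
  rw [Pi.neg_apply, OpField.mul, OpField.mul, ← locSum_reflect (h n) n, ← neg_one_smul ℂ,
    ← locSum_smul h']
  congr 1
  funext j
  have e : n - (n - j) = j := by ring
  rw [e]
  simp only [Pi.smul_apply, smul_mul_assoc, mul_smul_comm]
  rw [S.ϑ_mul_ϑ]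
  module

theorem mul_ddot_ϑ_dot_ϑ : OpField.mul (fun j : ℤ => (-(Complex.I * (j : ℂ) ^ 2)) • S.ϑ j)
    (fun j : ℤ => (j : ℂ) • S.ϑ j) = Complex.I • S.V' := by
  funext n
  rw [OpField.mul, Pi.smul_apply, V', Q, ← locSum_smul (S.locFinite_Q _ n)]
  simp only [smul_mul_assoc, mul_smul_comm, smul_smul]
  congr 1
  funext j
  push_cast
  congr 1
  ring

theorem _root_.two_pi_ne_zero : (2 * (Real.pi : ℂ)) ≠ 0 := by
  simp [Real.pi_ne_zero]

/-- The explicit form of `L_m` in terms of fields. -/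
theorem fourier_Lop (m : ℤ) : OpField.fourier
    (Complex.I • OpField.normal 1 (fun j : ℤ => (j : ℂ) • S.ϑ j)
        ((-Complex.I / (2 * (Real.pi : ℂ))) • S.ϖ)
      + ((m : ℂ) / 2) • OpField.normal 1 (Complex.I • S.ϑ)
        ((-Complex.I / (2 * (Real.pi : ℂ))) • S.ϖ)
      - Complex.I • ((Complex.I / (2 * (Real.pi : ℂ))) • S.L)
      + (m : ℂ) • ((1 / (2 * (Real.pi : ℂ))) • S.T 0 0)
      - (Complex.I * (m : ℂ) ^ 2 / 2) •
        OpField.mul (Complex.I • S.ϑ) ((1 / (2 * (Real.pi : ℂ))) • S.T 0 1)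
      + ((m : ℂ) / 2) • ((1 / (2 * (Real.pi : ℂ))) • S.T 1 1)) m = S.Lop m := by
  have h1 : OpField.NormalDefined (fun j : ℤ => (j : ℂ) • S.ϑ j) S.ϖ :=
    (S.smooth_ϑ.smul _).normalDefined S.smooth_ϖ
  have h2 := S.smooth_ϑ.normalDefined S.smooth_ϖ
  have e2 : OpField.normal 1 S.ϑ S.ϖ = S.N0 := by
    funext n
    rw [N0, ← S.normal_ϑ]
    simp only [one_smul]
  have e1 : OpField.normal 1 (fun j : ℤ => (j : ℂ) • S.ϑ j) S.ϖ = S.N1 := by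
    funext n
    rw [N1, ← S.normal_ϑ]
  have e3 : OpField.mul S.ϑ (S.T 0 1) = S.ϑX (S.T 0 1) := rfl
  rw [OpField.normal_smul_right h1, OpField.normal_smul_right (h2.smul _), OpField.normal_smul h2,
    OpField.smul_mul ((S.mulDefined_ϑT 0 1).smul_right _), OpField.mul_smul (S.mulDefined_ϑT 0 1),
    e1, e2, e3, OpField.fourier_apply, Lop]
  -- Only the nonvanishing of 2π is used: the factor from the integral cancels those in the momentum
  -- and the currents.
  have hpi := two_pi_ne_zero
  simp only [Pi.add_apply, Pi.sub_apply, Pi.smul_apply]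
  generalize (2 * (Real.pi : ℂ)) = r at *
  match_scalars <;> field_simp <;> (try simp only [Complex.I_sq]) <;> (try ring)

/-- The explicit form of `G_m` in terms of fields. -/
theorem fourier_Gop (m : ℤ) : OpField.fourier
    (OpField.normal 0 (Complex.I • S.U) ((-Complex.I / (2 * (Real.pi : ℂ))) • S.ϖ)
      - Complex.I • ((-Complex.I / (2 * (Real.pi : ℂ))) • S.ϖ)
      + OpField.mul (Complex.I • S.ϑ) ((Complex.I / (2 * (Real.pi : ℂ))) • S.L)
      + (Complex.I * m) •
        OpField.mul (Complex.I • S.ϑ) ((1 / (2 * (Real.pi : ℂ))) • S.T 0 0)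
      - (m : ℂ) • ((1 / (2 * (Real.pi : ℂ))) • S.T 0 1)
      - (1 / (2 * (Real.pi : ℂ))) • S.T 1 0) m = S.Gop m := by
  have h1 := S.smooth_U.normalDefined S.smooth_ϖ
  have e1 : OpField.normal 0 S.U S.ϖ = S.C := funext S.normal_U
  have e2 : OpField.mul S.ϑ S.L = S.ϑX S.L := rfl
  have e3 : OpField.mul S.ϑ (S.T 0 0) = S.ϑX (S.T 0 0) := rfl
  rw [OpField.normal_smul_right (h1.smul _), OpField.normal_smul h1,
    OpField.smul_mul (S.mulDefined_ϑL.smul_right _), OpField.mul_smul S.mulDefined_ϑL,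
    OpField.smul_mul ((S.mulDefined_ϑT 0 0).smul_right _), OpField.mul_smul (S.mulDefined_ϑT 0 0),
    e1, e2, e3, OpField.fourier_apply, Gop]
  have hpi := two_pi_ne_zero
  simp only [Pi.add_apply, Pi.sub_apply, Pi.smul_apply]
  generalize (2 * (Real.pi : ℂ)) = r at *
  match_scalars <;> field_simp <;> (try simp only [Complex.I_sq]) <;> (try ring)

end FermiModule

/-! ### The realization -/

section Realization

variable (V : Type*) [AddCommGroup V] [Module ℂ V]

theorem evalTraj_even (m : ℤ) (r : ℂ) :
    evalTraj V (Finsupp.single m r, 0) = r • OpField.shift m (OpField.unit _) := by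
  funext n
  simp only [evalTraj, Finsupp.sum_zero_index, add_zero, Pi.smul_apply, OpField.shift,
    OpField.unit, smul_smul]
  congr 1
  by_cases h : m = -n
  · simp [h, kron]
  · rw [Finsupp.single_eq_of_ne (Ne.symm h), kron, if_neg (by omega), mul_zero]

theorem evalTraj_odd (m : ℤ) (r : ℂ) :
    evalTraj V (0, Finsupp.single m r) = r • OpField.shift m (thetaField V) := by
  funext n
  simp [evalTraj, OpField.shift]

theorem evalTraj_zero : evalTraj V 0 = 0 := by
  funext n
  simp [evalTraj]

/-- As θ² = 0 and the components are Fourier polynomials, the field is a finite combination of index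
shifts of the constant field and of θ, each of which absorbs Y. -/
theorem absorbs_evalTraj {Y : OpField (Fock ⊗[ℂ] V)} (h : OpField.Absorbs (thetaField V) Y)
    (f : SFun) : OpField.Absorbs (evalTraj V f) Y := by
  obtain ⟨f₀, f₁⟩ := f
  have e : evalTraj V (f₀, f₁) = evalTraj V (f₀, 0) + evalTraj V (0, f₁) := by
    funext n
    simp [evalTraj]
  rw [e]
  clear e
  refine OpField.Absorbs.add ?_ ?_
  · induction f₀ using Finsupp.induction_linear with
    | zero =>
      have : evalTraj V (0, 0) = 0 := evalTraj_zero V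
      rw [this]
      exact fun w => ⟨0, fun _ _ _ => rfl⟩
    | add f g hf hg =>
      have : evalTraj V (f + g, 0) = evalTraj V (f, 0) + evalTraj V (g, 0) := by
        funext n
        simp [evalTraj, add_smul]
      rw [this]
      exact hf.add hg
    | single m r =>
      rw [evalTraj_even]
      exact ((OpField.absorbs_unit Y).shift m).coeff_left fun _ => r
  · induction f₁ using Finsupp.induction_linear with
    | zero =>
      have : evalTraj V (0, 0) = 0 := evalTraj_zero V
      rw [this]
      exact fun w => ⟨0, fun _ _ _ => rfl⟩
    | add f g hf hg =>
      have : evalTraj V (0, f + g) = evalTraj V (0, f) + evalTraj V (0, g) := by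
        funext n
        have := Finsupp.sum_add_index' (f := f) (g := g)
          (h := fun k b => b • thetaField V (n + k)) (by simp) (fun _ _ _ => add_smul _ _ _)
        simp [evalTraj, this]
      rw [this]
      exact hf.add hg
    | single m r =>
      rw [evalTraj_odd]
      exact (h.shift m).coeff_left fun _ => r

end Realization

/-! #### The components of the contact fields -/

namespace SFun

theorem ddt_single (m : ℤ) (r : ℂ) :
    ddt (Finsupp.single m r) = Finsupp.single m (Complex.I * m * r) := by
  rw [ddt, Finsupp.linearCombination_single, Finsupp.smul_single, smul_eq_mul, mul_comm]

theorem pd_zero_even (m : ℤ) (r : ℂ) : pd 0 (Finsupp.single m r, 0)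
    = (Finsupp.single m (Complex.I * m * r), 0) := by
  rw [pd, if_pos rfl, ddt_single, map_zero]

theorem pd_zero_odd (m : ℤ) (r : ℂ) : pd 0 (0, Finsupp.single m r)
    = (0, Finsupp.single m (Complex.I * m * r)) := by
  rw [pd, if_pos rfl, ddt_single, map_zero]

theorem contact_ell_zero (m : ℤ) : contact 0 (ell m) 0 = (Finsupp.single m (-Complex.I), 0) := by
  have h : (2 : ℂ) * (1 / (2 * Complex.I)) = -Complex.I := by
    rw [mul_one_div, div_eq_iff (by simp)]
    linear_combination (2 : ℂ) * Complex.I_mul_I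
  have e : euler (ell m) = 0 := rfl
  rw [contact, if_pos rfl, Del, e, sub_zero, ell, Prod.smul_mk, Finsupp.smul_single, smul_eq_mul,
    h, smul_zero]

theorem contact_ell_one (m : ℤ) : contact 0 (ell m) 1 = (0, Finsupp.single m ((m : ℂ) / 2)) := by
  have h : hamComp 0 (ell m) = 0 := by
    rw [hamComp, ell, pd, if_neg one_ne_zero]
    exact smul_zero _
  have h2 : Complex.I * m * (1 / (2 * Complex.I)) = (m : ℂ) / 2 := by
    field_simp
  rw [contact, if_neg one_ne_zero, h, neg_zero, zero_add, ell, pd_zero_even, thetaMul, h2]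

theorem contact_gee_zero (m : ℤ) : contact 1 (gee m) 0 = (0, Finsupp.single m 1) := by
  have e : euler (gee m) = gee m := rfl
  rw [contact, if_pos rfl, Del, e, gee]
  refine Prod.ext ?_ ?_
  · change (2 : ℂ) • (0 : ℤ →₀ ℂ) - 0 = 0
    rw [smul_zero, sub_zero]
  · change (2 : ℂ) • Finsupp.single m (1 : ℂ) - Finsupp.single m 1 = Finsupp.single m 1
    rw [two_smul, add_sub_cancel_right]

theorem contact_gee_one (m : ℤ) : contact 1 (gee m) 1 = (Finsupp.single m (-Complex.I), 0) := by
  have h : sg (1 + 1) = 1 := rfl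
  have h' : thetaMul (pd 0 (gee m)) = 0 := by
    rw [gee, pd_zero_odd]
    rfl
  rw [contact, if_neg one_ne_zero, h', add_zero, hamComp, gee, pd, if_neg one_ne_zero, h, one_mul,
    Prod.smul_mk, smul_zero, Finsupp.smul_single, smul_eq_mul, mul_one, Prod.neg_mk, neg_zero,
    Finsupp.single_neg]

theorem pd_one_even (f : ℤ →₀ ℂ) : pd 1 (f, 0) = 0 := rfl

theorem pd_one_odd (f : ℤ →₀ ℂ) : pd 1 (0, f) = (f, 0) := rfl

end SFun

namespace VirGlModule

variable {c k₁ k₂ : ℂ} {V : Type*} [AddCommGroup V] [Module ℂ V] (M : VirGlModule c k₁ k₂ V)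

/-! #### The fields in terms of the modes -/

theorem thetaField_eq : thetaField V = Complex.I • M.fermi.ϑ := by
  funext n
  simp only [Pi.smul_apply, fermi, smul_smul]
  simp [thetaField]

theorem thetaField_dot_eq : (thetaField V).dot = fun j : ℤ => (j : ℂ) • M.fermi.ϑ j := by
  funext n
  rw [OpField.dot, M.thetaField_eq, Pi.smul_apply, smul_smul]
  congr 1
  linear_combination -(n : ℂ) * Complex.I_mul_I

theorem thetaField_dot_dot_eq :
    (thetaField V).dot.dot = fun j : ℤ => (-(Complex.I * (j : ℂ) ^ 2)) • M.fermi.ϑ j := by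
  funext n
  rw [OpField.dot, M.thetaField_dot_eq, smul_smul]
  congr 1
  ring

theorem pField_eq : pField V = (-Complex.I / (2 * (Real.pi : ℂ))) • M.fermi.ϖ := by
  funext n
  simp only [Pi.smul_apply, fermi, smul_smul, pField]
  congr 1
  rw [div_mul_eq_mul_div, neg_mul, Complex.I_mul_I, neg_neg]

theorem LField_eq : M.LField = (Complex.I / (2 * (Real.pi : ℂ))) • M.fermi.L := rfl

theorem TField_eq (μ ν : ZMod 2) :
    M.TField μ ν = (1 / (2 * (Real.pi : ℂ))) • M.fermi.T μ ν := by
  funext n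
  have : (μ + ν = 0) = (μ = ν) := by
    rw [add_eq_zero_iff_eq_neg, CharTwo.neg_eq]
  simp only [TField, Pi.smul_apply, fermi, tensorT, Fock.twist, this]

theorem smooth_theta (M : VirGlModule c k₁ k₂ V) : OpField.Smooth (thetaField V) := by
  rw [M.thetaField_eq]
  exact M.fermi.smooth_ϑ.smul _

theorem smooth_p (M : VirGlModule c k₁ k₂ V) : OpField.Smooth (pField V) := by
  rw [M.pField_eq]
  exact M.fermi.smooth_ϖ.smul _

theorem smooth_LField : OpField.Smooth M.LField := M.fermi.smooth_field_L.smul _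

theorem smooth_TField (μ ν : ZMod 2) : OpField.Smooth (M.TField μ ν) := by
  rw [M.TField_eq]
  exact (M.fermi.smooth_field_T μ ν).smul _

theorem absorbs_theta_dot (M : VirGlModule c k₁ k₂ V) :
    OpField.Absorbs (thetaField V) (thetaField V).dot := by
  rw [M.thetaField_dot_eq, M.thetaField_eq]
  exact (M.fermi.absorbs_ϑ_ϑ.coeff_left _).coeff_right _

theorem absorbs_theta_LField : OpField.Absorbs (thetaField V) M.LField := by
  rw [M.thetaField_eq, M.LField_eq]
  refine OpField.Absorbs.coeff_right (OpField.Absorbs.coeff_left ?_ _) _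
  exact M.fermi.smooth_ϑ.absorbs 1 fun j k => by
    rw [one_smul, cm_eq_zero.mp (M.fermi.L_ϑ k j)]

theorem absorbs_theta_TField (μ ν : ZMod 2) : OpField.Absorbs (thetaField V) (M.TField μ ν) := by
  rw [M.thetaField_eq, M.TField_eq]
  refine OpField.Absorbs.coeff_right (OpField.Absorbs.coeff_left ?_ _) _
  exact M.fermi.smooth_ϑ.absorbs (sg (μ + ν)) fun j k => by
    rw [M.fermi.T_ϑ, smul_smul, FermiModule.sg_mul_self, one_smul]

theorem smooth_evalTraj (M : VirGlModule c k₁ k₂ V) (f : SFun) : OpField.Smooth (evalTraj V f) :=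
  OpField.absorbs_one_iff.mp
    (absorbs_evalTraj V (OpField.absorbs_one_iff.mpr M.smooth_theta) f)

theorem mulDefined_evalTraj_dot (M : VirGlModule c k₁ k₂ V) (f : SFun) :
    (evalTraj V f).MulDefined (thetaField V).dot :=
  (absorbs_evalTraj V M.absorbs_theta_dot f).mulDefined M.smooth_theta.dot

theorem smooth_xiTilde (M : VirGlModule c k₁ k₂ V) (ξ : VField) : OpField.Smooth (xiTilde V ξ) :=
  (M.smooth_evalTraj _).sub
    ((absorbs_evalTraj V M.absorbs_theta_dot _).smooth_mul M.smooth_theta.dot)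

theorem mulDefined_evalTraj_LField (f : SFun) : (evalTraj V f).MulDefined M.LField :=
  (absorbs_evalTraj V M.absorbs_theta_LField f).mulDefined M.smooth_LField

theorem mulDefined_evalTraj_TField (f : SFun) (μ ν : ZMod 2) :
    (evalTraj V f).MulDefined (M.TField μ ν) :=
  (absorbs_evalTraj V (M.absorbs_theta_TField μ ν) f).mulDefined (M.smooth_TField μ ν)

theorem normalDefined_xiTilde (M : VirGlModule c k₁ k₂ V) (ξ : VField) :
    OpField.NormalDefined (xiTilde V ξ) (pField V) :=
  (M.smooth_xiTilde ξ).normalDefined M.smooth_p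

/-! #### The auxiliary fields -/

theorem mulDefined_dot_theta (M : VirGlModule c k₁ k₂ V) :
    (thetaField V).dot.MulDefined (thetaField V) := by
  refine OpField.Absorbs.mulDefined ?_ M.smooth_theta
  rw [M.thetaField_dot_eq, M.thetaField_eq]
  exact (M.fermi.absorbs_ϑ_ϑ.coeff_left _).coeff_right _

theorem mulDefined_dot_dot (M : VirGlModule c k₁ k₂ V) :
    (thetaField V).dot.dot.MulDefined (thetaField V).dot := by
  refine OpField.Absorbs.mulDefined ?_ M.smooth_theta.dot
  rw [M.thetaField_dot_dot_eq, M.thetaField_dot_eq]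
  exact (M.fermi.absorbs_ϑ_ϑ.coeff_left _).coeff_right _

theorem dThetaTheta_eq : dThetaTheta V = Complex.I • M.fermi.U := by
  rw [dThetaTheta, M.thetaField_dot_eq, M.thetaField_eq, M.fermi.mul_dot_ϑ_ϑ]

theorem ddThetaDTheta_eq : ddThetaDTheta V = Complex.I • M.fermi.V' := by
  rw [ddThetaDTheta, M.thetaField_dot_dot_eq, M.thetaField_dot_eq, M.fermi.mul_ddot_ϑ_dot_ϑ]

theorem absorbs_ddThetaDTheta (M : VirGlModule c k₁ k₂ V) :
    OpField.Absorbs (ddThetaDTheta V) (thetaField V) := by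
  rw [M.ddThetaDTheta_eq, M.thetaField_eq]
  refine OpField.Absorbs.coeff_right (OpField.Absorbs.coeff_left ?_ _) _
  exact M.fermi.smooth_V.absorbs 1 fun j k => by
    rw [one_smul]; exact cm_eq_zero.mp (M.fermi.cm_V_ϑ j k)

theorem mulDefined_ddThetaDTheta (M : VirGlModule c k₁ k₂ V) :
    (ddThetaDTheta V).MulDefined (thetaField V) :=
  M.absorbs_ddThetaDTheta.mulDefined M.smooth_theta

theorem ddThetaDThetaTheta_eq : (ddThetaDTheta V).mul (thetaField V) = M.fermi.Wop := by
  rw [M.ddThetaDTheta_eq, M.thetaField_eq, M.fermi.mul_V_ϑ]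

theorem opTheta_eq (m : ℤ) : opTheta V m = M.fermi.ϑ m := by
  rw [opTheta, OpField.fourier_apply, M.thetaField_eq, Pi.smul_apply, smul_smul, smul_smul]
  have := two_pi_ne_zero
  rw [show 1 / (2 * (Real.pi : ℂ) * Complex.I) * (2 * Real.pi) * Complex.I = 1 by field_simp,
    one_smul]

theorem opU_eq (m : ℤ) : opU V m = M.fermi.U m := by
  rw [opU, OpField.fourier_apply, M.dThetaTheta_eq, Pi.smul_apply, smul_smul, smul_smul]
  have := two_pi_ne_zero
  rw [show 1 / (2 * (Real.pi : ℂ) * Complex.I) * (2 * Real.pi) * Complex.I = 1 by field_simp,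
    one_smul]

theorem opV_eq (m : ℤ) : opV V m = M.fermi.V' m := by
  rw [opV, OpField.fourier_apply, M.ddThetaDTheta_eq, Pi.smul_apply, smul_smul, smul_smul]
  have := two_pi_ne_zero
  rw [show 1 / (2 * (Real.pi : ℂ) * Complex.I) * (2 * Real.pi) * Complex.I = 1 by field_simp,
    one_smul]

theorem opW_eq (m : ℤ) : opW V m = M.fermi.Wop m := by
  rw [opW, OpField.fourier_apply, M.ddThetaDThetaTheta_eq, smul_smul,
    one_div_mul_cancel two_pi_ne_zero, one_smul]

theorem normalDefined_dot (M : VirGlModule c k₁ k₂ V) :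
    OpField.NormalDefined (thetaField V).dot (pField V) :=
  M.smooth_theta.dot.normalDefined M.smooth_p

theorem normalDefined_theta (M : VirGlModule c k₁ k₂ V) :
    OpField.NormalDefined (thetaField V) (pField V) :=
  M.smooth_theta.normalDefined M.smooth_p

theorem smooth_dThetaTheta (M : VirGlModule c k₁ k₂ V) : OpField.Smooth (dThetaTheta V) := by
  rw [M.dThetaTheta_eq]
  exact M.fermi.smooth_U.smul _

theorem normalDefined_dThetaTheta (M : VirGlModule c k₁ k₂ V) :
    OpField.NormalDefined (dThetaTheta V) (pField V) :=
  M.smooth_dThetaTheta.normalDefined M.smooth_p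

theorem mulDefined_theta_dot (M : VirGlModule c k₁ k₂ V) :
    (thetaField V).MulDefined (thetaField V).dot :=
  M.absorbs_theta_dot.mulDefined M.smooth_theta.dot

theorem theta_mul_dot (M : VirGlModule c k₁ k₂ V) :
    (thetaField V).mul (thetaField V).dot = -dThetaTheta V := by
  rw [M.dThetaTheta_eq, M.thetaField_dot_eq, M.thetaField_eq]
  exact M.fermi.mul_ϑ_dot_ϑ

end VirGlModule

/-! #### The restriction to the contact algebra -/

namespace OpField

variable {W : Type*} [AddCommGroup W] [Module ℂ W]

theorem zero_mul (X : OpField W) : mul 0 X = 0 := by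
  funext n
  simp only [mul, Pi.zero_apply, MulZeroClass.zero_mul, locSum_zero]

theorem smul_shift_unit_mul (r : ℂ) (m : ℤ) (X : OpField W) :
    mul (r • shift m (unit W)) X = r • shift m X := by
  rw [smul_mul ((mulDefined_unit_left X).shift_left m), mul_shift_left (mulDefined_unit_left X),
    unit_mul]

theorem smul_shift_mul {X Y : OpField W} (h : MulDefined X Y) (r : ℂ) (m : ℤ) :
    mul (r • shift m X) Y = r • shift m (mul X Y) := by
  rw [smul_mul (h.shift_left m), mul_shift_left h]

/-- A factor e^{imt} is an index shift by m, which passes through products and normal ordering.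
Pulling it out turns the integral into the m-th Fourier coefficient. -/
theorem fourier_ell {θ p L : OpField W} {T : ZMod 2 → ZMod 2 → OpField W}
    (h1 : NormalDefined θ.dot p) (h2 : NormalDefined θ p) (hT : MulDefined θ (T 0 1)) (m : ℤ) :
    fourier (normal 1 (((m : ℂ) / 2) • shift m θ
          - mul ((-Complex.I) • shift m (unit W)) θ.dot) p
        + mul ((-Complex.I) • shift m (unit W)) L
        + ((mul ((Complex.I * m * -Complex.I) • shift m (unit W)) (T 0 0) + mul 0 (T 1 0))
          + ((-1 : ℂ) • mul ((Complex.I * m * ((m : ℂ) / 2)) • shift m θ) (T 0 1)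
            + mul (((m : ℂ) / 2) • shift m (unit W)) (T 1 1)))) 0
      = fourier (Complex.I • normal 1 θ.dot p + ((m : ℂ) / 2) • normal 1 θ p - Complex.I • L
          + (m : ℂ) • T 0 0 - (Complex.I * (m : ℂ) ^ 2 / 2) • mul θ (T 0 1)
          + ((m : ℂ) / 2) • T 1 1) m := by
  have hI : Complex.I * m * -Complex.I = m := by linear_combination (-(m : ℂ)) * Complex.I_mul_I
  have e : ((m : ℂ) / 2) • shift m θ - (-Complex.I) • shift m θ.dot
      = shift m (((m : ℂ) / 2) • θ + Complex.I • θ.dot) := by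
    funext n
    simp only [Pi.add_apply, Pi.sub_apply, Pi.smul_apply, shift]
    module
  rw [smul_shift_unit_mul, smul_shift_unit_mul, smul_shift_unit_mul, smul_shift_unit_mul,
    smul_shift_mul hT, zero_mul, e, normal_shift ((h2.smul _).add (h1.smul _)),
    normal_add (h2.smul _) (h1.smul _), normal_smul h1, normal_smul h2, ← fourier_shift m,
    hI]
  congr 1
  funext n
  simp only [Pi.add_apply, Pi.sub_apply, Pi.smul_apply, Pi.zero_apply, shift]
  module

theorem fourier_gee {θ p L : OpField W} {T : ZMod 2 → ZMod 2 → OpField W}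
    (h1 : NormalDefined (mul θ.dot θ) p) (hθ : MulDefined θ θ.dot)
    (hd : mul θ θ.dot = -mul θ.dot θ) (hL : MulDefined θ L) (hT : MulDefined θ (T 0 0)) (m : ℤ) :
    fourier (normal 0 ((-Complex.I) • shift m (unit W)
          - mul ((1 : ℂ) • shift m θ) θ.dot) p
        + mul ((1 : ℂ) • shift m θ) L
        + (((1 : ℂ) • mul ((Complex.I * m * 1) • shift m θ) (T 0 0)
            + (-1 : ℂ) • mul ((1 : ℂ) • shift m (unit W)) (T 1 0))
          + ((-1 : ℂ) • mul ((Complex.I * m * -Complex.I) • shift m (unit W)) (T 0 1)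
            + mul 0 (T 1 1)))) 0
      = fourier (normal 0 (mul θ.dot θ) p - Complex.I • p + mul θ L
          + (Complex.I * m) • mul θ (T 0 0) - (m : ℂ) • T 0 1 - T 1 0) m := by
  have hI : Complex.I * m * -Complex.I = m := by linear_combination (-(m : ℂ)) * Complex.I_mul_I
  -- For g_m the component ξ⁰ is θ itself; the sign in -ξ⁰ dθ/dt is compensated by reversing θ and
  -- its derivative.
  have e : (-Complex.I) • shift m (unit W) - (1 : ℂ) • shift m (-mul θ.dot θ)
      = shift m ((-Complex.I) • unit W + mul θ.dot θ) := by
    funext n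
    simp only [Pi.add_apply, Pi.sub_apply, Pi.smul_apply, Pi.neg_apply, shift]
    module
  rw [smul_shift_unit_mul, smul_shift_unit_mul, smul_shift_mul hL, smul_shift_mul hT,
    smul_shift_mul hθ, hd, zero_mul, e, normal_shift (((normalDefined_unit p).smul _).add h1),
    normal_add ((normalDefined_unit p).smul _) h1, normal_smul (normalDefined_unit p),
    normal_unit, ← fourier_shift m, hI]
  congr 1
  funext n
  simp only [Pi.add_apply, Pi.sub_apply, Pi.smul_apply, Pi.zero_apply, shift]
  module

end OpField

namespace VirGlModule

variable {c k₁ k₂ : ℂ} {V : Type*} [AddCommGroup V] [Module ℂ V] (M : VirGlModule c k₁ k₂ V)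

theorem sum_zmod_two {A : Type*} [AddCommMonoid A] (f : ZMod 2 → A) : ∑ μ, f μ = f 0 + f 1 :=
  Fin.sum_univ_two f

theorem mulDefined_theta_LField : (thetaField V).MulDefined M.LField :=
  M.absorbs_theta_LField.mulDefined M.smooth_LField

theorem mulDefined_theta_TField (μ ν : ZMod 2) : (thetaField V).MulDefined (M.TField μ ν) :=
  (M.absorbs_theta_TField μ ν).mulDefined (M.smooth_TField μ ν)

theorem opL_eq_fourier (m : ℤ) : M.opL m = OpField.fourier
    (Complex.I • OpField.normal 1 (thetaField V).dot (pField V)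
      + ((m : ℂ) / 2) • OpField.normal 1 (thetaField V) (pField V)
      - Complex.I • M.LField
      + (m : ℂ) • M.TField 0 0
      - (Complex.I * (m : ℂ) ^ 2 / 2) • (thetaField V).mul (M.TField 0 1)
      + ((m : ℂ) / 2) • M.TField 1 1) m := by
  have s1 : sg ((0 + 0) * 0 + 0) = 1 := rfl
  have s3 : sg ((0 + 1) * 0 + 1) = -1 := rfl
  have s4 : sg ((0 + 1) * 1 + 1) = 1 := rfl
  rw [← OpField.fourier_ell M.normalDefined_dot M.normalDefined_theta
    (M.mulDefined_theta_TField 0 1) m, opL, realize, xiTilde]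
  simp only [sum_zmod_two]
  rw [SFun.contact_ell_zero, SFun.contact_ell_one, SFun.pd_zero_even, SFun.pd_zero_odd,
    SFun.pd_one_even, SFun.pd_one_odd, evalTraj_zero, evalTraj_even, evalTraj_even, evalTraj_even,
    evalTraj_odd, evalTraj_odd, OpField.zero_mul, smul_zero, s1, s3, s4, one_smul, one_smul,
    zero_add (1 : ZMod 2)]

theorem opG_eq_fourier (m : ℤ) : M.opG m = OpField.fourier
    (OpField.normal 0 (dThetaTheta V) (pField V)
      - Complex.I • pField V
      + (thetaField V).mul M.LField
      + (Complex.I * m) • (thetaField V).mul (M.TField 0 0)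
      - (m : ℂ) • M.TField 0 1
      - M.TField 1 0) m := by
  have s1 : sg ((1 + 0) * 0 + 0) = 1 := rfl
  have s2 : sg ((1 + 0) * 1 + 0) = -1 := rfl
  have s3 : sg ((1 + 1) * 0 + 1) = -1 := rfl
  have s5 : (1 : ZMod 2) + 1 = 0 := rfl
  rw [dThetaTheta, ← OpField.fourier_gee M.normalDefined_dThetaTheta M.mulDefined_theta_dot
    M.theta_mul_dot M.mulDefined_theta_LField (M.mulDefined_theta_TField 0 0) m, opG, realize,
    xiTilde]
  simp only [sum_zmod_two]
  rw [SFun.contact_gee_zero, SFun.contact_gee_one, SFun.pd_zero_even, SFun.pd_zero_odd,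
    SFun.pd_one_even, SFun.pd_one_odd, evalTraj_zero, evalTraj_even, evalTraj_even, evalTraj_even,
    evalTraj_odd, evalTraj_odd, OpField.zero_mul, smul_zero, s1, s2, s3, s5]

theorem opL_eq (m : ℤ) : M.opL m = M.fermi.Lop m := by
  rw [opL_eq_fourier, M.thetaField_dot_eq, M.thetaField_eq, M.pField_eq, M.LField_eq, M.TField_eq,
    M.TField_eq, M.TField_eq]
  exact M.fermi.fourier_Lop m

theorem opG_eq (m : ℤ) : M.opG m = M.fermi.Gop m := by
  rw [opG_eq_fourier, M.dThetaTheta_eq, M.thetaField_eq, M.pField_eq, M.LField_eq, M.TField_eq,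
    M.TField_eq, M.TField_eq]
  exact M.fermi.fourier_Gop m

theorem rep_eq : M.rep = M.fermi.genRep := by
  rw [rep, FermiModule.genRep]
  congr 1
  funext k
  cases k with
  | L m => exact M.opL_eq m
  | G m => exact M.opG_eq m
  | θ m => exact M.opTheta_eq m
  | U m => exact M.opU_eq m
  | V m => exact M.opV_eq m
  | W m => exact M.opW_eq m
  | one => rfl

theorem rep_isSuperRep :
    IsSuperRep Xsc.part (Xsc.bracket (fockParams c k₁ k₂)) M.parity M.rep := by
  rw [rep_eq]
  exact M.fermi.genRep_isSuperRep

theorem rep_one : M.rep (Xsc.el .one) = 1 := by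
  rw [rep_eq, FermiModule.genRep_el]
  rfl

end VirGlModule

/-! ### The realized parameters and the central charge -/

theorem fockParams_relation (c k₁ k₂ : ℂ) :
    2 * (fockParams c k₁ k₂).α - (fockParams c k₁ k₂).β
      = 2 * (fockParams c k₁ k₂).a - (fockParams c k₁ k₂).b / 2 := by
  simp only [fockParams]; ring

theorem fockParams_centralCharge (c k₁ k₂ : ℂ) :
    12 * (fockParams c k₁ k₂).a = -11 + 9 * k₁ + 3 * k₂ + c := by
  simp only [fockParams]; ring

theorem mainTheorem3 :
    -- for all parameters with `2 α - β = 2 a - b / 2`, the brackets define a Lie superalgebra; all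
    -- parameters except `a` are removed by the redefinition of `L_m` and `G_m`; and the redefined
    -- generators span a superconformal algebra with central charge `12 a`
    (∀ P : XscParams, 2 * P.α - P.β = 2 * P.a - P.b / 2 →
      IsLieSuperalgebra Xsc.part (Xsc.bracket P) ∧
      (IsSuperHom Xsc.part (Xsc.bracket P.reduced) Xsc.part (Xsc.bracket P) (Xsc.redefine P) ∧
        Function.Bijective (Xsc.redefine P)) ∧
      ∀ s : ℂ,
        IsLieSuperalgebra Sconf.part (Sconf.bracket (12 * P.a) (P.a' + 2 * s)) ∧
        IsSuperHom Sconf.part (Sconf.bracket (12 * P.a) (P.a' + 2 * s))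
          Xsc.part (Xsc.bracket P) (Sconf.embed P s) ∧
        Function.Injective (Sconf.embed P s)) ∧
    -- the Fock realization
    (∀ (c k₁ k₂ : ℂ) (V : Type*) [AddCommGroup V] [Module ℂ V] (M : VirGlModule c k₁ k₂ V),
      -- all operators are well defined: the products of fields are locally finite sums
      (∀ ξ : VField,
        (evalTraj V (ξ 0)).MulDefined (thetaField V).dot ∧
        (xiTilde V ξ).MulDefined (pField V).neg ∧
        (pField V).pos.MulDefined (xiTilde V ξ) ∧
        (evalTraj V (ξ 0)).MulDefined M.LField ∧
        ∀ μ ν : ZMod 2, (evalTraj V (SFun.pd ν (ξ μ))).MulDefined (M.TField ν μ)) ∧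
      (thetaField V).dot.MulDefined (thetaField V) ∧
      (thetaField V).dot.dot.MulDefined (thetaField V).dot ∧
      (ddThetaDTheta V).MulDefined (thetaField V) ∧
      -- the explicit form of the restriction to the contact algebra
      (∀ m : ℤ, M.opL m = OpField.fourier
        (Complex.I • OpField.normal 1 (thetaField V).dot (pField V)
          + ((m : ℂ) / 2) • OpField.normal 1 (thetaField V) (pField V)
          - Complex.I • M.LField
          + (m : ℂ) • M.TField 0 0
          - (Complex.I * (m : ℂ) ^ 2 / 2) • (thetaField V).mul (M.TField 0 1)
          + ((m : ℂ) / 2) • M.TField 1 1) m) ∧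
      (∀ m : ℤ, M.opG m = OpField.fourier
        (OpField.normal 0 (dThetaTheta V) (pField V)
          - Complex.I • pField V
          + (thetaField V).mul M.LField
          + (Complex.I * m) • (thetaField V).mul (M.TField 0 0)
          - (m : ℂ) • M.TField 0 1
          - M.TField 1 0) m) ∧
      -- the operators satisfy the brackets of the Lie superalgebra with the given parameters
      2 * (fockParams c k₁ k₂).α - (fockParams c k₁ k₂).β
        = 2 * (fockParams c k₁ k₂).a - (fockParams c k₁ k₂).b / 2 ∧
      M.rep (Xsc.el .one) = 1 ∧
      IsSuperRep Xsc.part (Xsc.bracket (fockParams c k₁ k₂)) M.parity M.rep ∧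
      -- the redefined operators represent the superconformal algebra with central charge
      -- `-11 + 9 k₁ + 3 k₂ + c`
      12 * (fockParams c k₁ k₂).a = -11 + 9 * k₁ + 3 * k₂ + c ∧
      ∀ s : ℂ, IsSuperRep Sconf.part
        (Sconf.bracket (-11 + 9 * k₁ + 3 * k₂ + c) ((c - 2) / 12 + 2 * s)) M.parity
        (M.rep ∘ₗ Sconf.embed (fockParams c k₁ k₂) s)) := by
  refine ⟨fun P hP => ⟨Xsc.isLieSuperalgebra hP, ⟨Xsc.redefine_isSuperHom hP,
    Xsc.redefine_bijective P⟩, fun s => ⟨Sconf.isLieSuperalgebra hP s,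
    Sconf.embed_isSuperHom hP s, Sconf.embed_injective P s⟩⟩, ?_⟩
  intro c k₁ k₂ V _ _ M
  refine ⟨fun ξ => ⟨M.mulDefined_evalTraj_dot _, (M.normalDefined_xiTilde ξ).1,
      (M.normalDefined_xiTilde ξ).2, M.mulDefined_evalTraj_LField _,
      fun μ ν => M.mulDefined_evalTraj_TField _ ν μ⟩,
    M.mulDefined_dot_theta, M.mulDefined_dot_dot, M.mulDefined_ddThetaDTheta,
    M.opL_eq_fourier, M.opG_eq_fourier, fockParams_relation c k₁ k₂, M.rep_one,
    M.rep_isSuperRep, fockParams_centralCharge c k₁ k₂, fun s => ?_⟩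
  have h := Sconf.embed_isSuperHom (fockParams_relation c k₁ k₂) s
  rw [fockParams_centralCharge] at h
  exact M.rep_isSuperRep.comp h
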